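/- Fix finite non-empty sets $\mathrm{Ag}$ of agents, $\mathrm{Act}$ of actions and $\mathrm{AP}$ of atomic propositions. **Systems.** A stochastic system consists of a finite non-empty set $S$ of states, non-empty sets $L(s,a)\subseteq \mathrm{Act}$ of legal actions ($s\in S$, $a\in\mathrm{Ag}$), a probability distribution $t(s,\alpha)$ on $S$ for each state $s$ and each legal action profile $\alpha\in\prod_a L(s,a)$, a labelling $v:S\to 2^{\mathrm{AP}}$, and observation functions $o_a:S\to O_a$ with $O_a$ finite. A parametric system $\mathcal S$ has, in addition, a finite set $X$ of parameters (of arbitrary size) and a finite set of constraints $A\bowtie B$ with $A,B\in\mathbb Q[X]$ and $\bowtie\,\in\{<,>,\le,\ge,=\}$, and its transition probabilities are quotients of polynomials in $\mathbb Q[X]$. A valuation $\mathrm{Val}:X\to\mathbb R$ is well-defined if it satisfies the constraints and, for all legal profiles, the denominators do not vanish and the values of $t(s,\alpha)$ form a probability distribution; $\mathcal S[\mathrm{Val}]$ is then the resulting stochastic system. **Strategies.** For $b\in\mathbb N_+$, a randomized $b$-bounded-memory strategy of agent $a$ consists of a set $Q$ of $b$ modes and of maps $\mathit{start}:O_a\to\mathrm{Dist}(Q)$,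 $\Delta:Q\times O_a\to\mathrm{Dist}(Q)$, $\mathit{act}:Q\times O_a\to\mathrm{Dist}(\mathrm{Act})$, such that $\mathit{act}(q,o_a(s))$ is supported in $L(s,a)$ for all $q,s$. The first mode is drawn from $\mathit{start}$; in mode $q$ and state $s$ the agent draws independently its action from $\mathit{act}(q,o_a(s))$ and its next mode from $\Delta(q,o_a(s))$. Once such strategies $\sigma_C$ are fixed for a coalition $C\subseteq\mathrm{Ag}$, the agents outside $C$ play in the decision process whose configurations are the pairs (state, modes of the agents in $C$): each of them uses an arbitrary randomized strategy, with perfect information and unbounded memory, i.e. a map from finite histories of configurations to distributions on its legal actions. All agents randomize independently. Together with an initial state $s$, strategies $\sigma_C$ and $\mu_{-C}$ induce a probability measure $\Pr_s^{\sigma_C,\mu_{-C}}$ on infinite plays $\pi\in S^\omega$. **PATL.** Formulas are $\varphi::=p\mid\varphi\lor\varphi\mid\neg\varphi\mid\langle\langle C\rangle\rangle^{\bowtie d}\mathbf X\varphi\mid\langle\langle C\rangle\rangle^{\bowtie d}(\varphi\,\mathbf U\,\varphi)\mid\langle\langle C\rangle\rangle^{\bowtie d}(\varphi\,\mathbf R\,\varphi)$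 with $p\in\mathrm{AP}$, $C\subseteq\mathrm{Ag}$, $d\in\mathbb Q\cap[0,1]$, $\bowtie\,\in\{\le,<,>,\ge\}$. Satisfaction $\models_b$ at a state is the usual one for $p,\lor,\neg$, and $s\models_b\langle\langle C\rangle\rangle^{\bowtie d}\psi$ iff there are randomized $b$-bounded-memory strategies $\sigma_C$ of the agents in $C$ such that, for all strategies $\mu_{-C}$ of the other agents, $\Pr_s^{\sigma_C,\mu_{-C}}(\{\pi:\pi\models_b\psi\})\bowtie d$. Here $\pi\models_b\mathbf X\varphi$ iff $\pi_1\models_b\varphi$; $\pi\models_b\varphi_1\mathbf U\varphi_2$ iff there is $k\ge0$ with $\pi_k\models_b\varphi_2$ and $\pi_j\models_b\varphi_1$ for all $j<k$; $\pi\models_b\varphi_1\mathbf R\varphi_2$ iff for every $k\ge0$, $\pi_k\models_b\varphi_2$ or $\pi_j\models_b\varphi_1$ for some $j<k$. **Theorem.** The following problem is in $\Sigma_3^{\mathbb R}=\exists\forall\exists\mathbb R$: given a parametric system $\mathcal S$, a state $s$, a memory bound $b\in\mathbb N_+$ (in unary) and a PATL formula $\varphi$ (polynomials being given by arithmetic expressions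 and rational constants in binary), decide whether $\mathcal S[\mathrm{Val}],s\models_b\varphi$ for every well-defined valuation $\mathrm{Val}$. That is, the problem is polynomial-time many-one reducible to deciding the truth in $\mathbb R$ of sentences $\exists x\,\forall y\,\exists z\;M(x,y,z)$, where $x,y,z$ are tuples of variables and $M$ is a Boolean combination of conditions $f\ge0$ and $f>0$ on polynomials $f$ with rational coefficients. -/

import Mathlib

/-! ## Polynomial-time computation

Inputs and outputs are binary trees (S-expressions), whose size is the number of nodes. Programs are
closed under sequencing, pairing, branching and while-loops; every operation is charged at least the
size of the tree it works on, so that the cost is, up to a polynomial, the running time of a Turing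
machine. -/

/-- Binary trees, the data on which programs compute. -/
inductive Data : Type
  | nil : Data
  | cons : Data → Data → Data

namespace Data

/-- Number of nodes. -/
def size : Data → ℕ
  | nil => 1
  | cons x y => x.size + y.size + 1

def fst : Data → Data
  | nil => nil
  | cons x _ => x

def snd : Data → Data
  | nil => nil
  | cons _ y => y

end Data

/-- Programs; each maps a tree to a tree (and may diverge because of `loop`). -/
inductive Prog : Type
  | id : Prog
  | nil : Prog
  | fst : Prog
  | snd : Prog
  | pair : Prog → Prog → Prog
  | comp : Prog → Prog → Prog
  | ite : Prog → Prog → Prog → Prog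
  | loop : Prog → Prog

/-- `Prog.Runs p x y t`: on input `x`, the program `p` halts with output `y` at total cost `t`.
`comp p q` runs `p`, then `q`; `ite c p q` runs `q` if `c` outputs `nil` and `p` otherwise;
`loop p` repeats `p` as long as the first component of the current tree is not `nil`. -/
inductive Prog.Runs : Prog → Data → Data → ℕ → Prop
  | id (x : Data) : Runs .id x x (x.size + 1)
  | nil (x : Data) : Runs .nil x .nil (x.size + 1)
  | fst (x : Data) : Runs .fst x x.fst (x.size + 1)
  | snd (x : Data) : Runs .snd x x.snd (x.size + 1)
  | pair {p q : Prog} {x y z : Data} {t u : ℕ} :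
      Runs p x y t → Runs q x z u → Runs (.pair p q) x (.cons y z) (t + u + x.size + 1)
  | comp {p q : Prog} {x y z : Data} {t u : ℕ} :
      Runs p x y t → Runs q y z u → Runs (.comp p q) x z (t + u + 1)
  | ite_true {c p q : Prog} {x v w y : Data} {t u : ℕ} :
      Runs c x (.cons v w) t → Runs p x y u → Runs (.ite c p q) x y (t + u + x.size + 1)
  | ite_false {c p q : Prog} {x y : Data} {t u : ℕ} :
      Runs c x .nil t → Runs q x y u → Runs (.ite c p q) x y (t + u + x.size + 1)
  | loop_done {p : Prog} {x : Data} :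
      x.fst = .nil → Runs (.loop p) x x (x.size + 1)
  | loop_step {p : Prog} {x y z : Data} {t u : ℕ} :
      x.fst ≠ .nil → Runs p x y t → Runs (.loop p) y z u →
        Runs (.loop p) x z (t + u + x.size + 1)

/-! ### Codes -/

/-- A one-to-one coding of the objects of type `α` by trees. -/
structure Code (α : Type) where
  enc : α → Data
  inj : Function.Injective enc

namespace Code

def encUnary : ℕ → Data
  | 0 => .nil
  | n + 1 => .cons .nil (encUnary n)

/-- Natural numbers in unary. -/
def unary : Code ℕ where
  enc := encUnary
  inj := by
    intro m
    induction m with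
    | zero => intro n h; cases n <;> simp_all [encUnary]
    | succ m ih =>
      intro n h
      cases n with
      | zero => simp [encUnary] at h
      | succ n => simp only [encUnary, Data.cons.injEq, true_and] at h; rw [ih h]

/-- The code of `α` transported along an injection. -/
def comap {α β : Type} (c : Code β) (f : α → β) (hf : Function.Injective f) : Code α where
  enc x := c.enc (f x)
  inj := c.inj.comp hf

def prod {α β : Type} (c : Code α) (d : Code β) : Code (α × β) where
  enc x := .cons (c.enc x.1) (d.enc x.2)
  inj := by
    rintro ⟨a, b⟩ ⟨a', b'⟩ h
    simp only [Data.cons.injEq] at h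
    rw [c.inj h.1, d.inj h.2]

def encList {α : Type} (f : α → Data) : List α → Data
  | [] => .nil
  | a :: l => .cons (f a) (encList f l)

def list {α : Type} (c : Code α) : Code (List α) where
  enc := encList c.enc
  inj := by
    intro l
    induction l with
    | nil => intro l' h; cases l' <;> simp_all [encList]
    | cons a l ih =>
      intro l' h
      cases l' with
      | nil => simp [encList] at h
      | cons a' l' =>
        simp only [encList, Data.cons.injEq] at h
        rw [c.inj h.1, ih h.2]

/-- Elements of `Fin n`, in unary. -/
def fin (n : ℕ) : Code (Fin n) := unary.comap Fin.val Fin.val_injective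

/-- Functions on `Fin n`, as the list of their values. -/
def finFun {α : Type} (n : ℕ) (c : Code α) : Code (Fin n → α) :=
  c.list.comap List.ofFn List.ofFn_injective

/-- Functions on `Fin k → Fin m`, as the list of their values. -/
def profileFun {α : Type} (k m : ℕ) (c : Code α) : Code ((Fin k → Fin m) → α) :=
  (finFun (m ^ k) c).comap (fun f i => f (finFunctionFinEquiv.symm i))
    (fun _ _ h => funext fun v => by simpa using congrFun h (finFunctionFinEquiv v))

def bool : Code Bool where
  enc x := if x then .cons .nil .nil else .nil
  inj := by intro x y; cases x <;> cases y <;> simp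

/-- Subsets of `Fin n`, as bit vectors. -/
def finset (n : ℕ) : Code (Finset (Fin n)) :=
  (finFun n bool).comap (fun s i => decide (i ∈ s))
    (fun _ _ h => Finset.ext fun i => by simpa using congrFun h i)

/-- Natural numbers in binary. -/
def binary : Code ℕ :=
  bool.list.comap Nat.bits (fun m n h => by
    have := congrArg (fun l : List Bool => Nat.ofDigits 2 (l.map fun b => cond b 1 0)) h
    simpa [← Nat.digits_two_eq_bits, Nat.ofDigits_digits] using this)

/-- Rational numbers: sign, numerator and denominator in binary. -/
def rat : Code ℚ :=
  (bool.prod (binary.prod binary)).comap (fun q => (decide (q.num < 0), q.num.natAbs, q.den))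
    (by
      intro p q h
      simp only [Prod.mk.injEq, decide_eq_decide] at h
      apply Rat.ext <;> omega)

end Code

/-! ### Decision problems and the class of `∃∀∃` sentences over the reals -/

/-- A decision problem: instances, their codes, and the set of positive instances. -/
structure DecisionProblem where
  Inst : Type
  code : Code Inst
  Yes : Inst → Prop

/-- Polynomial-time many-one reducibility. -/
def DecisionProblem.PolyReduces (P Q : DecisionProblem) : Prop :=
  ∃ (f : P.Inst → Q.Inst) (p : Prog) (T : Polynomial ℕ),
    (∀ i, ∃ t ≤ T.eval (P.code.enc i).size, p.Runs (P.code.enc i) (Q.code.enc (f i)) t) ∧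
      ∀ i, P.Yes i ↔ Q.Yes (f i)

/-- Polynomials with rational coefficients in the variables `V`, given by arithmetic
expressions. -/
inductive PolyExpr (V : Type) : Type
  | const : ℚ → PolyExpr V
  | var : V → PolyExpr V
  | add : PolyExpr V → PolyExpr V → PolyExpr V
  | mul : PolyExpr V → PolyExpr V → PolyExpr V

namespace PolyExpr

noncomputable def toMvPolynomial {V : Type} : PolyExpr V → MvPolynomial V ℚ
  | const c => MvPolynomial.C c
  | var v => MvPolynomial.X v
  | add e f => e.toMvPolynomial + f.toMvPolynomial
  | mul e f => e.toMvPolynomial * f.toMvPolynomial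

/-- The value of the polynomial at a real point. -/
noncomputable def eval {V : Type} (x : V → ℝ) (e : PolyExpr V) : ℝ :=
  MvPolynomial.aeval x e.toMvPolynomial

def enc {V : Type} (c : Code V) : PolyExpr V → Data
  | const q => .cons (Code.encUnary 0) (Code.rat.enc q)
  | var v => .cons (Code.encUnary 1) (c.enc v)
  | add e f => .cons (Code.encUnary 2) (.cons (e.enc c) (f.enc c))
  | mul e f => .cons (Code.encUnary 3) (.cons (e.enc c) (f.enc c))

def code {V : Type} (c : Code V) : Code (PolyExpr V) where
  enc := enc c
  inj := by
    intro e
    induction e with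
    | const q =>
      intro f h
      cases f <;> simp_all [enc, Code.encUnary]
      exact Code.rat.inj h
    | var v =>
      intro f h
      cases f <;> simp_all [enc, Code.encUnary]
      exact c.inj h
    | add e₁ e₂ ih₁ ih₂ =>
      intro f h
      cases f <;> simp [enc, Code.encUnary] at h
      rw [ih₁ h.1, ih₂ h.2]
    | mul e₁ e₂ ih₁ ih₂ =>
      intro f h
      cases f <;> simp [enc, Code.encUnary] at h
      rw [ih₁ h.1, ih₂ h.2]

end PolyExpr

/-- Quantifier-free formulas over the ordered field of the reals. -/
inductive RealFormula (V : Type) : Type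
  | nonneg : PolyExpr V → RealFormula V
  | pos : PolyExpr V → RealFormula V
  | not : RealFormula V → RealFormula V
  | and : RealFormula V → RealFormula V → RealFormula V
  | or : RealFormula V → RealFormula V → RealFormula V

namespace RealFormula

def Holds {V : Type} (x : V → ℝ) : RealFormula V → Prop
  | nonneg e => 0 ≤ e.eval x
  | pos e => 0 < e.eval x
  | not φ => ¬ φ.Holds x
  | and φ ψ => φ.Holds x ∧ ψ.Holds x
  | or φ ψ => φ.Holds x ∨ ψ.Holds x

def enc {V : Type} (c : Code V) : RealFormula V → Data
  | nonneg e => .cons (Code.encUnary 0) ((PolyExpr.code c).enc e)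
  | pos e => .cons (Code.encUnary 1) ((PolyExpr.code c).enc e)
  | not φ => .cons (Code.encUnary 2) (φ.enc c)
  | and φ ψ => .cons (Code.encUnary 3) (.cons (φ.enc c) (ψ.enc c))
  | or φ ψ => .cons (Code.encUnary 4) (.cons (φ.enc c) (ψ.enc c))

def code {V : Type} (c : Code V) : Code (RealFormula V) where
  enc := enc c
  inj := by
    intro φ
    induction φ with
    | nonneg e =>
      intro ψ h
      cases ψ <;> simp_all [enc, Code.encUnary]
      exact (PolyExpr.code c).inj h
    | pos e =>
      intro ψ h
      cases ψ <;> simp_all [enc, Code.encUnary]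
      exact (PolyExpr.code c).inj h
    | not φ ih =>
      intro ψ h
      cases ψ <;> simp [enc, Code.encUnary] at h
      rw [ih h]
    | and φ₁ φ₂ ih₁ ih₂ =>
      intro ψ h
      cases ψ <;> simp [enc, Code.encUnary] at h
      rw [ih₁ h.1, ih₂ h.2]
    | or φ₁ φ₂ ih₁ ih₂ =>
      intro ψ h
      cases ψ <;> simp [enc, Code.encUnary] at h
      rw [ih₁ h.1, ih₂ h.2]

end RealFormula

/-- Truth of sentences `∃ x ∀ y ∃ z, M(x, y, z)` over the reals with a quantifier-free matrix `M`.
The variable `(i, j)` is the `j`-th variable of the `i`-th quantifier block; only the finitely many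
variables that occur in `M` matter. -/
def exForallExReals : DecisionProblem where
  Inst := RealFormula (Fin 3 × ℕ)
  code := RealFormula.code ((Code.fin 3).prod Code.unary)
  Yes M := ∃ x : ℕ → ℝ, ∀ y : ℕ → ℝ, ∃ z : ℕ → ℝ, M.Holds fun v => ![x, y, z] v.1 v.2

/-- The third level `Σ₃^ℝ = ∃∀∃ℝ` of the hierarchy of the reals. -/
def DecisionProblem.InSigma3R (P : DecisionProblem) : Prop :=
  P.PolyReduces exForallExReals

/-! ## Stochastic multi-agent systems

Agents, actions and atomic propositions are `Fin nAg`, `Fin nAct` and `Fin nAP`. -/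

/-- The non-probabilistic part of a system. -/
structure Frame (nAg nAct nAP : ℕ) where
  /-- number of states -/
  nS : ℕ
  nS_pos : 0 < nS
  legal : Fin nS → Fin nAg → Finset (Fin nAct)
  legal_nonempty : ∀ s a, (legal s a).Nonempty
  label : Fin nS → Finset (Fin nAP)
  /-- number of observations of each agent -/
  nO : Fin nAg → ℕ
  obs : (a : Fin nAg) → Fin nS → Fin (nO a)

/-- The action profiles in which every agent plays a legal action. -/
def Frame.LegalProfile {nAg nAct nAP : ℕ} (F : Frame nAg nAct nAP) (s : Fin F.nS)
    (α : Fin nAg → Fin nAct) : Prop :=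
  ∀ a, α a ∈ F.legal s a

/-- A stochastic system. The values of `trans` at illegal profiles are irrelevant. -/
structure StochSystem (nAg nAct nAP : ℕ) extends Frame nAg nAct nAP where
  trans : Fin nS → (Fin nAg → Fin nAct) → Fin nS → ℝ
  trans_mem : ∀ s α, toFrame.LegalProfile s α → trans s α ∈ stdSimplex ℝ (Fin nS)

/-- The product distribution. -/
def prodDist {ι : Type} [Fintype ι] [DecidableEq ι] {κ : ι → Type} [∀ i, Fintype (κ i)]
    (w : (i : ι) → stdSimplex ℝ (κ i)) : stdSimplex ℝ ((i : ι) → κ i) :=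
  ⟨fun x => ∏ i, w i (x i), fun x => Finset.prod_nonneg fun i _ => (w i).2.1 (x i), by
    have h := Finset.prod_univ_sum (fun i => (Finset.univ : Finset (κ i))) (fun i x => w i x)
    rw [Fintype.piFinset_univ] at h
    rw [← h]
    exact Finset.prod_eq_one fun i _ => (w i).2.2⟩

/-- A distribution on a finite set, as a measure. -/
noncomputable def distMeasure {α : Type} [Fintype α] [MeasurableSpace α]
    (w : stdSimplex ℝ α) : MeasureTheory.Measure α :=
  ∑ x, ENNReal.ofReal (w x) • MeasureTheory.Measure.dirac x

instance {α : Type} [Fintype α] [MeasurableSpace α] (w : stdSimplex ℝ α) :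
    MeasureTheory.IsProbabilityMeasure (distMeasure w) where
  measure_univ := by
    have h : ∑ x, w x = 1 := w.2.2
    simp only [distMeasure, MeasureTheory.Measure.coe_finsetSum, Finset.sum_apply,
      MeasureTheory.Measure.smul_apply, MeasureTheory.measure_univ, smul_eq_mul, mul_one]
    rw [← ENNReal.ofReal_sum_of_nonneg (f := fun x => w x) fun x _ => w.2.1 x, h,
      ENNReal.ofReal_one]

section Semantics

variable {nAg nAct nAP : ℕ}

/-- A randomized scheduler with memory `Fin b` for agent `a`, which sees the states through the
observation function of `a` and plays legal actions only. In mode `q`, on observation `o`, the next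
action is drawn from `act q o` and the next mode from `next q o`. -/
structure Scheduler (F : Frame nAg nAct nAP) (b : ℕ) (a : Fin nAg) where
  start : Fin (F.nO a) → stdSimplex ℝ (Fin b)
  next : Fin b → Fin (F.nO a) → stdSimplex ℝ (Fin b)
  act : Fin b → Fin (F.nO a) → stdSimplex ℝ (Fin nAct)
  act_legal : ∀ q s α, α ∉ F.legal s a → act q (F.obs a s) α = 0

/-- Configurations: a state together with the memory modes of the agents of the coalition `C`. -/
abbrev Conf (F : Frame nAg nAct nAP) (C : Finset (Fin nAg)) (b : ℕ) : Type :=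
  Fin F.nS × (C → Fin b)

/-- Histories of length `n + 1`. -/
abbrev Hist (F : Frame nAg nAct nAP) (C : Finset (Fin nAg)) (b n : ℕ) : Type :=
  Finset.Iic n → Conf F C b

/-- The last configuration of a history. -/
def Hist.last {F : Frame nAg nAct nAP} {C : Finset (Fin nAg)} {b n : ℕ} (h : Hist F C b n) :
    Conf F C b :=
  h ⟨n, Finset.mem_Iic.2 le_rfl⟩

/-- An unbounded-memory, randomized, perfect-information strategy of an agent `a` outside the
coalition: it depends on the whole history in the decision process that arises once the schedulers
of the coalition are fixed. -/
structure Opponent (F : Frame nAg nAct nAP) (C : Finset (Fin nAg)) (b : ℕ) (a : Fin nAg) where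
  act : (n : ℕ) → Hist F C b n → stdSimplex ℝ (Fin nAct)
  act_legal : ∀ n (h : Hist F C b n) α, α ∉ F.legal h.last.1 a → act n h α = 0

/-- Schedulers for all the agents of the coalition. -/
abbrev CoalitionStrategy (F : Frame nAg nAct nAP) (C : Finset (Fin nAg)) (b : ℕ) : Type :=
  (a : C) → Scheduler F b a

/-- Strategies for all the agents outside the coalition. -/
abbrev OpponentStrategy (F : Frame nAg nAct nAP) (C : Finset (Fin nAg)) (b : ℕ) : Type :=
  (a : {a : Fin nAg // a ∉ C}) → Opponent F C b a

/-- The distribution of the action of agent `a` after a history. -/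
def actionDist {F : Frame nAg nAct nAP} {C : Finset (Fin nAg)} {b n : ℕ}
    (σ : CoalitionStrategy F C b) (μ : OpponentStrategy F C b) (h : Hist F C b n) (a : Fin nAg) :
    stdSimplex ℝ (Fin nAct) :=
  if ha : a ∈ C then (σ ⟨a, ha⟩).act (h.last.2 ⟨a, ha⟩) (F.obs a h.last.1)
  else (μ ⟨a, ha⟩).act n h

theorem actionDist_eq_zero {F : Frame nAg nAct nAP} {C : Finset (Fin nAg)} {b n : ℕ}
    (σ : CoalitionStrategy F C b) (μ : OpponentStrategy F C b) (h : Hist F C b n) (a : Fin nAg)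
    (α : Fin nAct) (hα : α ∉ F.legal h.last.1 a) : actionDist σ μ h a α = 0 := by
  unfold actionDist
  split_ifs with ha
  · exact (σ ⟨a, ha⟩).act_legal _ _ _ hα
  · exact (μ ⟨a, ha⟩).act_legal _ _ _ hα

/-- The distribution of the state that follows a history: the agents draw their actions
independently, and the system moves according to the resulting profile. -/
def stateDist (M : StochSystem nAg nAct nAP) {C : Finset (Fin nAg)} {b n : ℕ}
    (σ : CoalitionStrategy M.toFrame C b) (μ : OpponentStrategy M.toFrame C b)
    (h : Hist M.toFrame C b n) : stdSimplex ℝ (Fin M.nS) :=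
  ⟨fun s' => ∑ α : Fin nAg → Fin nAct,
      prodDist (actionDist σ μ h) α * M.trans h.last.1 α s', by
    have key : ∀ α : Fin nAg → Fin nAct, prodDist (actionDist σ μ h) α = 0 ∨
        M.trans h.last.1 α ∈ stdSimplex ℝ (Fin M.nS) := by
      intro α
      by_cases hα : M.toFrame.LegalProfile h.last.1 α
      · exact Or.inr (M.trans_mem _ _ hα)
      · simp only [Frame.LegalProfile, not_forall] at hα
        obtain ⟨a, ha⟩ := hα
        exact Or.inl (Finset.prod_eq_zero (Finset.mem_univ a) (actionDist_eq_zero σ μ h a _ ha))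
    refine ⟨fun s' => Finset.sum_nonneg fun α _ => ?_, ?_⟩
    · rcases key α with h0 | h1
      · simp [h0]
      · exact mul_nonneg ((prodDist (actionDist σ μ h)).2.1 α) (h1.1 s')
    · rw [Finset.sum_comm, ← (prodDist (actionDist σ μ h)).2.2]
      refine Finset.sum_congr rfl fun α _ => ?_
      rw [← Finset.mul_sum]
      rcases key α with h0 | h1
      · rw [h0, zero_mul]; exact h0.symm
      · rw [h1.2, mul_one]; rfl⟩

/-- The distribution of the modes of the coalition that follow a configuration. -/
def modeDist {F : Frame nAg nAct nAP} {C : Finset (Fin nAg)} {b : ℕ}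
    (σ : CoalitionStrategy F C b) (c : Conf F C b) : stdSimplex ℝ (C → Fin b) :=
  prodDist fun a : C => (σ a).next (c.2 a) (F.obs a c.1)

/-- The initial distribution of the modes of the coalition. -/
def startDist {F : Frame nAg nAct nAP} {C : Finset (Fin nAg)} {b : ℕ}
    (σ : CoalitionStrategy F C b) (s : Fin F.nS) : stdSimplex ℝ (C → Fin b) :=
  prodDist fun a : C => (σ a).start (F.obs a s)

/-- One step of the process that follows a history of length `n + 1`. -/
noncomputable def stepKernel (M : StochSystem nAg nAct nAP) {C : Finset (Fin nAg)} {b : ℕ}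
    (σ : CoalitionStrategy M.toFrame C b) (μ : OpponentStrategy M.toFrame C b) (n : ℕ) :
    ProbabilityTheory.Kernel (Hist M.toFrame C b n) (Conf M.toFrame C b) :=
  ProbabilityTheory.Kernel.ofFunOfCountable fun h =>
    (distMeasure (stateDist M σ μ h)).prod (distMeasure (modeDist σ h.last))

instance (M : StochSystem nAg nAct nAP) {C : Finset (Fin nAg)} {b : ℕ}
    (σ : CoalitionStrategy M.toFrame C b) (μ : OpponentStrategy M.toFrame C b) (n : ℕ) :
    ProbabilityTheory.IsMarkovKernel (stepKernel M σ μ n) where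
  isProbabilityMeasure h := by
    change MeasureTheory.IsProbabilityMeasure
      ((distMeasure (stateDist M σ μ h)).prod (distMeasure (modeDist σ h.last)))
    infer_instance

/-- The probability measure on the infinite sequences of configurations that is induced by the
strategies of all agents from the state `s`. -/
noncomputable def outcome (M : StochSystem nAg nAct nAP) {C : Finset (Fin nAg)} {b : ℕ}
    (σ : CoalitionStrategy M.toFrame C b) (μ : OpponentStrategy M.toFrame C b) (s : Fin M.nS) :
    MeasureTheory.Measure (ℕ → Conf M.toFrame C b) :=
  ProbabilityTheory.Kernel.trajMeasure (X := fun _ => Conf M.toFrame C b)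
    ((MeasureTheory.Measure.dirac s).prod (distMeasure (startDist σ s))) (stepKernel M σ μ)

/-! ### PATL -/

/-- The comparisons allowed in coalition operators. -/
inductive Cmp : Type
  | le | lt | gt | ge

def Cmp.Rel : Cmp → ℝ → ℝ → Prop
  | .le, x, y => x ≤ y
  | .lt, x, y => x < y
  | .gt, x, y => x > y
  | .ge, x, y => x ≥ y

/-- PATL formulas: `next C ⋈ d φ`, `untl C ⋈ d φ ψ`, `release C ⋈ d φ ψ` are the formulas
`⟨⟨C⟩⟩^{⋈ d} X φ`, `⟨⟨C⟩⟩^{⋈ d} (φ U ψ)`, `⟨⟨C⟩⟩^{⋈ d} (φ R ψ)`. -/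
inductive PATL (nAg nAP : ℕ) : Type
  | atom : Fin nAP → PATL nAg nAP
  | or : PATL nAg nAP → PATL nAg nAP → PATL nAg nAP
  | not : PATL nAg nAP → PATL nAg nAP
  | next : Finset (Fin nAg) → Cmp → Set.Icc (0 : ℚ) 1 → PATL nAg nAP → PATL nAg nAP
  | untl : Finset (Fin nAg) → Cmp → Set.Icc (0 : ℚ) 1 → PATL nAg nAP → PATL nAg nAP →
      PATL nAg nAP
  | release : Finset (Fin nAg) → Cmp → Set.Icc (0 : ℚ) 1 → PATL nAg nAP → PATL nAg nAP →
      PATL nAg nAP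

/-- The coalition `C` has schedulers with memory `Fin b` such that, whatever the other agents do,
the probability that the play from `s` is in `E` is in relation `⋈` with `d`. -/
def Enforces (M : StochSystem nAg nAct nAP) (b : ℕ) (C : Finset (Fin nAg)) (r : Cmp) (d : ℚ)
    (s : Fin M.nS) (E : Set (ℕ → Fin M.nS)) : Prop :=
  ∃ σ : CoalitionStrategy M.toFrame C b, ∀ μ : OpponentStrategy M.toFrame C b,
    r.Rel ((outcome M σ μ s).real {ω | (fun n => (ω n).1) ∈ E}) d

/-- `PATL.Sat M b φ s`: the state `s` of `M` satisfies `φ` with `b`-bounded memory. -/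
def PATL.Sat (M : StochSystem nAg nAct nAP) (b : ℕ) : PATL nAg nAP → Fin M.nS → Prop
  | .atom p, s => p ∈ M.label s
  | .or φ ψ, s => φ.Sat M b s ∨ ψ.Sat M b s
  | .not φ, s => ¬ φ.Sat M b s
  | .next C r d φ, s => Enforces M b C r d s {π | φ.Sat M b (π 1)}
  | .untl C r d φ ψ, s => Enforces M b C r d s
      {π | ∃ k, ψ.Sat M b (π k) ∧ ∀ j < k, φ.Sat M b (π j)}
  | .release C r d φ ψ, s => Enforces M b C r d s
      {π | ∀ k, ψ.Sat M b (π k) ∨ ∃ j < k, φ.Sat M b (π j)}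

end Semantics

/-! ## Parametric systems -/

/-- A quotient of two polynomials. -/
structure RatFun (nX : ℕ) where
  num : PolyExpr (Fin nX)
  den : PolyExpr (Fin nX)

noncomputable def RatFun.eval {nX : ℕ} (x : Fin nX → ℝ) (f : RatFun nX) : ℝ :=
  f.num.eval x / f.den.eval x

inductive CmpEq : Type
  | lt | gt | le | ge | eq

def CmpEq.Rel : CmpEq → ℝ → ℝ → Prop
  | .lt, x, y => x < y
  | .gt, x, y => x > y
  | .le, x, y => x ≤ y
  | .ge, x, y => x ≥ y
  | .eq, x, y => x = y

/-- A polynomial constraint `lhs ⋈ rhs`. -/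
structure PolyConstraint (nX : ℕ) where
  lhs : PolyExpr (Fin nX)
  rel : CmpEq
  rhs : PolyExpr (Fin nX)

/-- A parametric stochastic system with parameters `Fin nX`. The entries of `trans` at illegal
profiles are irrelevant. -/
structure ParamSystem (nAg nAct nAP : ℕ) extends Frame nAg nAct nAP where
  nX : ℕ
  trans : Fin nS → (Fin nAg → Fin nAct) → Fin nS → RatFun nX
  constraints : List (PolyConstraint nX)

namespace ParamSystem

variable {nAg nAct nAP : ℕ}

/-- Well-defined valuations: the transition probabilities are defined and form distributions, and
the constraints hold. -/
structure WellDefined (P : ParamSystem nAg nAct nAP) (x : Fin P.nX → ℝ) : Prop where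
  den_ne_zero : ∀ s α, P.toFrame.LegalProfile s α → ∀ s', (P.trans s α s').den.eval x ≠ 0
  nonneg : ∀ s α, P.toFrame.LegalProfile s α → ∀ s', 0 ≤ (P.trans s α s').eval x
  sum_eq_one : ∀ s α, P.toFrame.LegalProfile s α → ∑ s', (P.trans s α s').eval x = 1
  constraints : ∀ c ∈ P.constraints, c.rel.Rel (c.lhs.eval x) (c.rhs.eval x)

/-- The stochastic system obtained from a well-defined valuation. -/
noncomputable def instantiate (P : ParamSystem nAg nAct nAP) (x : Fin P.nX → ℝ)
    (hx : P.WellDefined x) : StochSystem nAg nAct nAP where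
  toFrame := P.toFrame
  trans s α s' := (P.trans s α s').eval x
  trans_mem s α hα := ⟨hx.nonneg s α hα, hx.sum_eq_one s α hα⟩

end ParamSystem

/-! ## The parametric model checking problem -/

/-- An instance: a parametric system, a state, a memory bound and a formula. -/
structure ParamMCInstance (nAg nAct nAP : ℕ) where
  sys : ParamSystem nAg nAct nAP
  state : Fin sys.nS
  bound : ℕ+
  formula : PATL nAg nAP

namespace Code

def cmp : Code Cmp where
  enc
    | .le => encUnary 0
    | .lt => encUnary 1
    | .gt => encUnary 2
    | .ge => encUnary 3
  inj := by intro x y; cases x <;> cases y <;> simp [encUnary]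

def cmpEq : Code CmpEq where
  enc
    | .lt => encUnary 0
    | .gt => encUnary 1
    | .le => encUnary 2
    | .ge => encUnary 3
    | .eq => encUnary 4
  inj := by intro x y; cases x <;> cases y <;> simp [encUnary]

def coalitionOp (nAg : ℕ) : Code (Finset (Fin nAg) × Cmp × Set.Icc (0 : ℚ) 1) :=
  (finset nAg).prod (cmp.prod (rat.comap Subtype.val Subtype.val_injective))

def encPATL {nAg nAP : ℕ} : PATL nAg nAP → Data
  | .atom p => .cons (encUnary 0) ((fin nAP).enc p)
  | .or φ ψ => .cons (encUnary 1) (.cons (encPATL φ) (encPATL ψ))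
  | .not φ => .cons (encUnary 2) (encPATL φ)
  | .next C r d φ => .cons (encUnary 3) (.cons ((coalitionOp nAg).enc (C, r, d)) (encPATL φ))
  | .untl C r d φ ψ => .cons (encUnary 4)
      (.cons ((coalitionOp nAg).enc (C, r, d)) (.cons (encPATL φ) (encPATL ψ)))
  | .release C r d φ ψ => .cons (encUnary 5)
      (.cons ((coalitionOp nAg).enc (C, r, d)) (.cons (encPATL φ) (encPATL ψ)))

def patl (nAg nAP : ℕ) : Code (PATL nAg nAP) where
  enc := encPATL
  inj := by
    intro φ
    induction φ with
    | atom p =>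
      intro ψ h
      cases ψ <;> simp_all [encPATL, encUnary]
      exact (fin nAP).inj h
    | or φ₁ φ₂ ih₁ ih₂ =>
      intro ψ h
      cases ψ <;> simp [encPATL, encUnary] at h
      rw [ih₁ h.1, ih₂ h.2]
    | not φ ih =>
      intro ψ h
      cases ψ <;> simp [encPATL, encUnary] at h
      rw [ih h]
    | next C r d φ ih =>
      intro ψ h
      cases ψ <;> simp only [encPATL, encUnary, Data.cons.injEq, true_and, reduceCtorEq,
        false_and, and_false] at h
      have h' := (coalitionOp nAg).inj h.1
      simp only [Prod.mk.injEq] at h'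
      obtain ⟨rfl, rfl, rfl⟩ := h'
      rw [ih h.2]
    | untl C r d φ₁ φ₂ ih₁ ih₂ =>
      intro ψ h
      cases ψ <;> simp only [encPATL, encUnary, Data.cons.injEq, true_and, reduceCtorEq,
        false_and, and_false] at h
      have h' := (coalitionOp nAg).inj h.1
      simp only [Prod.mk.injEq] at h'
      obtain ⟨rfl, rfl, rfl⟩ := h'
      rw [ih₁ h.2.1, ih₂ h.2.2]
    | release C r d φ₁ φ₂ ih₁ ih₂ =>
      intro ψ h
      cases ψ <;> simp only [encPATL, encUnary, Data.cons.injEq, true_and, reduceCtorEq,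
        false_and, and_false] at h
      have h' := (coalitionOp nAg).inj h.1
      simp only [Prod.mk.injEq] at h'
      obtain ⟨rfl, rfl, rfl⟩ := h'
      rw [ih₁ h.2.1, ih₂ h.2.2]

def ratFun (nX : ℕ) : Code (RatFun nX) :=
  ((PolyExpr.code (fin nX)).prod (PolyExpr.code (fin nX))).comap (fun f => (f.num, f.den))
    (by rintro ⟨_, _⟩ ⟨_, _⟩ h; simpa using h)

def polyConstraint (nX : ℕ) : Code (PolyConstraint nX) :=
  ((PolyExpr.code (fin nX)).prod (cmpEq.prod (PolyExpr.code (fin nX)))).comap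
    (fun c => (c.lhs, c.rel, c.rhs)) (by rintro ⟨_, _, _⟩ ⟨_, _, _⟩ h; simpa using h)

/-- The instances; the numbers of states, of observations and of parameters and the memory bound are
in unary, the rational constants in binary. -/
def paramMCInstance (nAg nAct nAP : ℕ) : Code (ParamMCInstance nAg nAct nAP) where
  enc I :=
    .cons (unary.enc I.sys.nS) <|
    .cons (unary.enc I.sys.nX) <|
    .cons ((finFun nAg unary).enc I.sys.nO) <|
    .cons ((finFun _ (finFun nAg (finset nAct))).enc I.sys.legal) <|
    .cons ((finFun _ (finset nAP)).enc I.sys.label) <|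
    .cons ((finFun nAg (finFun _ unary)).enc fun a s => (I.sys.obs a s : ℕ)) <|
    .cons ((finFun _ (profileFun nAg nAct (finFun _ (ratFun _)))).enc I.sys.trans) <|
    .cons ((polyConstraint _).list.enc I.sys.constraints) <|
    .cons ((fin _).enc I.state) <|
    .cons (unary.enc I.bound) ((patl nAg nAP).enc I.formula)
  inj := by
    rintro ⟨⟨⟨nS, _, legal, _, label, nO, obs⟩, nX, trans, cs⟩, s, b, φ⟩
      ⟨⟨⟨nS', _, legal', _, label', nO', obs'⟩, nX', trans', cs'⟩, s', b', φ'⟩ h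
    simp only [Data.cons.injEq] at h
    obtain ⟨h1, h2, h3, h4, h5, h6, h7, h8, h9, h10, h11⟩ := h
    obtain rfl := unary.inj h1
    obtain rfl := unary.inj h2
    obtain rfl := (finFun nAg unary).inj h3
    obtain rfl := (finFun _ _).inj h4
    obtain rfl := (finFun _ _).inj h5
    have h6' := (finFun _ _).inj h6
    obtain rfl : obs = obs' := by
      funext a s
      exact Fin.ext (congrFun (congrFun h6' a) s)
    obtain rfl := (finFun _ _).inj h7
    obtain rfl := (polyConstraint _).list.inj h8
    obtain rfl := (fin _).inj h9
    obtain rfl := PNat.coe_injective (unary.inj h10)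
    obtain rfl := (patl nAg nAP).inj h11
    rfl

end Code

/-- Parametric model checking of PATL: does the given state satisfy the formula, with the given
memory bound, under every well-defined valuation of the parameters? -/
def paramModelChecking (nAg nAct nAP : ℕ) : DecisionProblem where
  Inst := ParamMCInstance nAg nAct nAP
  code := Code.paramMCInstance nAg nAct nAP
  Yes I := ∀ (x : Fin I.sys.nX → ℝ) (hx : I.sys.WellDefined x),
    I.formula.Sat (I.sys.instantiate x hx) I.bound I.state

/-! ## A calculus of polynomial-time functions -/

/-! Fix a valuation of the parameters and strategies of a coalition. The other agents then control a
finite Markov decision process whose configurations are a state together with the modes of the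
coalition. Having perfect information, they attain the extreme probability of an until event by
decisions that depend on the current configuration only (`FinMDP.exists_policy`,
`exists_prob_until_eq`), and neither history nor randomization helps them (`mul_prob_until_le`). So
the quantifier over the opponents disappears: a coalition strategy wins iff one number, the optimal
value averaged over the initial modes, satisfies the bound. Release events are complements of until
events, and next events need a single step.

This number is pinned down by polynomial conditions on further real unknowns. The optimality
equations alone do not suffice, because cycles that avoid the goal support spurious solutions. A
real rank for every configuration, which can decrease with positive probability wherever the value
is positive (under some optimal decision when maximizing, under every decision when minimizing),
excludes them (`FinMDP.Cert.eq_val`); such ranks exist for the true value (`FinMDP.exists_cert`). As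
the certified value is unique, success and failure of a given strategy can both be asserted by an
existential quantifier over certificates.

Nested and negated coalition operators cost no alternations, because truth is tabulated. The
universal block consists of a valuation, its transition probabilities, a truth table for all
subformulas at all states, and a strategy for every coalition entry marked true. The last block
points out an error: an entry marked true whose strategy is malformed or has a certified value that
violates the bound, or an entry marked false together with a strategy whose certified value meets
the bound. The matrix says that, if the universal data are consistent, then the table affirms the
formula at the given state or an error is exhibited. A table in which no error can be exhibited is
correct, by induction on the subformulas (`truthReads_of_forall_not`), so in a positive instance it
affirms the formula. Conversely, the correct table with winning strategies admits no refutation,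
hence must affirm the formula (`yes_of_forall_exists`). No variable belongs to the first existential
block, so the sentences are in fact of the form ∀∃.

The numbers of agents and actions are fixed and the memory bound is in unary, so there are
polynomially many configurations and the matrix has polynomial size. That it is computed in
polynomial time follows from closure properties of `PolyTime`, which `fun_prop` applies; only the
renaming of the parameters and the flattening of the formula need recursion on trees
(`PolyTime.cata`). -/

theorem Polynomial.eval_mono_nat (T : Polynomial ℕ) {m n : ℕ} (h : m ≤ n) :
    T.eval m ≤ T.eval n := by
  rw [Polynomial.eval_eq_sum, Polynomial.eval_eq_sum]
  exact Finset.sum_le_sum fun i _ => Nat.mul_le_mul_left _ (Nat.pow_le_pow_left h i)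

theorem Data.size_pos (x : Data) : 0 < x.size := by cases x <;> simp [Data.size]

theorem Data.size_fst_le (x : Data) : x.fst.size ≤ x.size := by
  cases x <;> simp [Data.size, Data.fst]; omega

theorem Data.size_snd_le (x : Data) : x.snd.size ≤ x.size := by
  cases x <;> simp [Data.size, Data.snd]; omega

/-- Every operation is charged at least the size of what it outputs. Hence a time bound is also a
bound on the size of the output, which is what makes polynomial bounds compose. -/
theorem Prog.Runs.size_le {p : Prog} {x y : Data} {t : ℕ} (h : p.Runs x y t) : y.size ≤ t := by
  induction h with
  | id x => omega
  | nil x => simp [Data.size]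
  | fst x => have := x.size_fst_le; omega
  | snd x => have := x.size_snd_le; omega
  | pair _ _ h1 h2 => simp only [Data.size]; omega
  | comp _ _ _ h2 => omega
  | ite_true _ _ _ h2 => omega
  | ite_false _ _ _ h2 => omega
  | loop_done _ => omega
  | loop_step _ _ _ _ h2 => omega

/-- Types with a fixed coding by trees. -/
class Coded (α : Type) where
  code : Code α

/-- The tree that codes an object. -/
def cenc {α : Type} [Coded α] (a : α) : Data := Coded.code.enc a

/-- The size of the code of an object. -/
def csize {α : Type} [Coded α] (a : α) : ℕ := (cenc a).size

instance : Coded Data := ⟨⟨fun x => x, fun _ _ h => h⟩⟩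
instance : Coded ℕ := ⟨Code.unary⟩
instance : Coded Bool := ⟨Code.bool⟩
instance : Coded ℚ := ⟨Code.rat⟩
instance (n : ℕ) : Coded (Fin n) := ⟨Code.fin n⟩
instance {α β : Type} [Coded α] [Coded β] : Coded (α × β) := ⟨Coded.code.prod Coded.code⟩
instance {α : Type} [Coded α] : Coded (List α) := ⟨Coded.code.list⟩
instance {V : Type} [Coded V] : Coded (PolyExpr V) := ⟨PolyExpr.code Coded.code⟩
instance {V : Type} [Coded V] : Coded (RealFormula V) := ⟨RealFormula.code Coded.code⟩

section cenc

variable {α β : Type} [Coded α] [Coded β]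

theorem cenc_data (x : Data) : cenc x = x := rfl
theorem cenc_zero : cenc (0 : ℕ) = .nil := rfl
theorem cenc_succ (n : ℕ) : cenc (n + 1) = .cons .nil (cenc n) := rfl
theorem cenc_true : cenc true = .cons .nil .nil := rfl
theorem cenc_false : cenc false = .nil := rfl
theorem cenc_pair (a : α) (b : β) : cenc (a, b) = .cons (cenc a) (cenc b) := rfl
theorem cenc_nil : cenc ([] : List α) = .nil := rfl
theorem cenc_cons (a : α) (l : List α) : cenc (a :: l) = .cons (cenc a) (cenc l) := rfl

theorem csize_pos (a : α) : 0 < csize a := Data.size_pos _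
theorem csize_pair (a : α) (b : β) : csize (a, b) = csize a + csize b + 1 := rfl
theorem csize_nil : csize ([] : List α) = 1 := rfl
theorem csize_cons (a : α) (l : List α) : csize (a :: l) = csize a + csize l + 1 := rfl
theorem csize_nat (n : ℕ) : csize n = 2 * n + 1 := by
  induction n with
  | zero => rfl
  | succ n ih => change 1 + csize n + 1 = _; omega

theorem csize_append (l l' : List α) : csize (l ++ l') + 1 = csize l + csize l' := by
  induction l with
  | nil => simp [csize_nil]; omega
  | cons a l ih => simp only [List.cons_append, csize_cons]; omega

theorem length_lt_csize (l : List α) : l.length < csize l := by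
  induction l with
  | nil => simp [csize_nil]
  | cons a l ih => simp only [List.length_cons, csize_cons]; have := csize_pos a; omega

theorem csize_le_of_mem {l : List α} {a : α} (h : a ∈ l) : csize a ≤ csize l := by
  induction l with
  | nil => simp at h
  | cons b l ih =>
    rcases List.mem_cons.1 h with rfl | h
    · simp only [csize_cons]; omega
    · have := ih h; simp only [csize_cons]; omega

end cenc

/-- `f` is computed by a program in time polynomial in the size of the code of the input. -/
@[fun_prop]
def PolyTime {α β : Type} [Coded α] [Coded β] (f : α → β) : Prop :=
  ∃ (p : Prog) (T : Polynomial ℕ), ∀ a, ∃ t ≤ T.eval (csize a), p.Runs (cenc a) (cenc (f a)) t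

namespace PolyTime

variable {α β γ δ : Type} [Coded α] [Coded β] [Coded γ] [Coded δ]

/-- Programs see codes only. Constructors whose codes are nested pairs of a tag and the arguments
are thus handled by pairing, and two types with the same codes can be exchanged at no cost. -/
theorem of_cenc {f : α → β} {g : α → γ} (hg : PolyTime g) (h : ∀ a, cenc (f a) = cenc (g a)) :
    PolyTime f := by
  obtain ⟨p, T, hp⟩ := hg
  exact ⟨p, T, fun a => by rw [h]; exact hp a⟩

theorem exists_csize_le {f : α → β} (hf : PolyTime f) :
    ∃ B : Polynomial ℕ, ∀ a, csize (f a) ≤ B.eval (csize a) := by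
  obtain ⟨p, T, hp⟩ := hf
  refine ⟨T, fun a => ?_⟩
  obtain ⟨t, ht, hr⟩ := hp a
  exact hr.size_le.trans ht

@[fun_prop]
theorem id' : PolyTime (fun a : α => a) :=
  ⟨.id, Polynomial.X + 1, fun a => ⟨_, by simp [csize], Prog.Runs.id _⟩⟩

@[fun_prop]
theorem comp {f : β → γ} {g : α → β} (hf : PolyTime f) (hg : PolyTime g) :
    PolyTime (fun a => f (g a)) := by
  obtain ⟨p, T, hp⟩ := hf
  obtain ⟨q, U, hq⟩ := hg
  refine ⟨.comp q p, U + T.comp U + 1, fun a => ?_⟩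
  obtain ⟨t, ht, hr⟩ := hq a
  obtain ⟨u, hu, hs⟩ := hp (g a)
  refine ⟨_, ?_, hr.comp hs⟩
  have h1 := T.eval_mono_nat (hr.size_le.trans ht)
  simp only [Polynomial.eval_add, Polynomial.eval_comp, Polynomial.eval_one]
  simp only [csize] at *
  omega

theorem exists_const (x : Data) :
    ∃ (p : Prog) (c : ℕ), ∀ y : Data, ∃ t ≤ c * (y.size + 1), p.Runs y x t := by
  induction x with
  | nil => exact ⟨.nil, 1, fun y => ⟨_, by omega, Prog.Runs.nil y⟩⟩
  | cons x y hx hy =>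
    obtain ⟨p, c, hp⟩ := hx
    obtain ⟨q, d, hq⟩ := hy
    refine ⟨.pair p q, c + d + 1, fun z => ?_⟩
    obtain ⟨t, ht, hr⟩ := hp z
    obtain ⟨u, hu, hs⟩ := hq z
    exact ⟨_, by linarith, hr.pair hs⟩

@[fun_prop]
theorem const (b : β) : PolyTime (fun _ : α => b) := by
  obtain ⟨p, c, h⟩ := exists_const (cenc b)
  refine ⟨p, Polynomial.C c * (Polynomial.X + 1), fun a => ?_⟩
  obtain ⟨t, ht, hr⟩ := h (cenc a)
  exact ⟨t, by simpa [csize] using ht, hr⟩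

@[fun_prop]
theorem prodMk {f : α → β} {g : α → γ} (hf : PolyTime f) (hg : PolyTime g) :
    PolyTime (fun a => (f a, g a)) := by
  obtain ⟨p, T, hp⟩ := hf
  obtain ⟨q, U, hq⟩ := hg
  refine ⟨.pair p q, T + U + Polynomial.X + 1, fun a => ?_⟩
  obtain ⟨t, ht, hr⟩ := hp a
  obtain ⟨u, hu, hs⟩ := hq a
  refine ⟨_, ?_, hr.pair hs⟩
  simp only [Polynomial.eval_add, Polynomial.eval_X, Polynomial.eval_one]
  simp only [csize] at *
  omega

theorem fst_data : PolyTime Data.fst :=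
  ⟨.fst, Polynomial.X + 1, fun x => ⟨_, by simp [csize], Prog.Runs.fst _⟩⟩

theorem snd_data : PolyTime Data.snd :=
  ⟨.snd, Polynomial.X + 1, fun x => ⟨_, by simp [csize], Prog.Runs.snd _⟩⟩

theorem toData : PolyTime (cenc : α → Data) :=
  ⟨.id, Polynomial.X + 1, fun a => ⟨_, by simp [csize], Prog.Runs.id _⟩⟩

/-- A function is polynomial-time if it is, on the level of codes, a polynomial-time function on
trees. -/
theorem of_data {f : α → β} {F : Data → Data} (hF : PolyTime F)
    (h : ∀ a, cenc (f a) = F (cenc a)) : PolyTime f :=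
  of_cenc (g := fun a => F (cenc a)) (hF.comp toData) h

@[fun_prop]
theorem fst {f : α → β × γ} (hf : PolyTime f) : PolyTime (fun a => (f a).1) :=
  comp (f := Prod.fst) (of_data fst_data fun _ => rfl) hf

@[fun_prop]
theorem snd {f : α → β × γ} (hf : PolyTime f) : PolyTime (fun a => (f a).2) :=
  comp (f := Prod.snd) (of_data snd_data fun _ => rfl) hf

@[fun_prop]
theorem data_cons {f g : α → Data} (hf : PolyTime f) (hg : PolyTime g) :
    PolyTime (fun a => Data.cons (f a) (g a)) :=
  of_cenc (hf.prodMk hg) fun _ => rfl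

@[fun_prop]
theorem data_fst {f : α → Data} (hf : PolyTime f) : PolyTime (fun a => (f a).fst) :=
  fst_data.comp hf

@[fun_prop]
theorem data_snd {f : α → Data} (hf : PolyTime f) : PolyTime (fun a => (f a).snd) :=
  snd_data.comp hf

/-- Branching on whether a tree is `nil`. -/
theorem ite_nil {c : α → γ} {f g : α → β} (hc : PolyTime c) (hf : PolyTime f) (hg : PolyTime g)
    {d : α → Prop} [DecidablePred d] (hd : ∀ a, d a ↔ cenc (c a) ≠ .nil) :
    PolyTime (fun a => if d a then f a else g a) := by
  obtain ⟨r, V, hr⟩ := hc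
  obtain ⟨p, T, hp⟩ := hf
  obtain ⟨q, U, hq⟩ := hg
  refine ⟨.ite r p q, V + T + U + Polynomial.X + 1, fun a => ?_⟩
  obtain ⟨v, hv, hrv⟩ := hr a
  obtain ⟨t, ht, hpt⟩ := hp a
  obtain ⟨u, hu, hqu⟩ := hq a
  simp only [Polynomial.eval_add, Polynomial.eval_X, Polynomial.eval_one]
  by_cases h : d a
  · have h' := (hd a).1 h
    rw [if_pos h]
    cases hx : cenc (c a) with
    | nil => exact absurd hx h'
    | cons x y =>
      rw [hx] at hrv
      exact ⟨_, by simp only [csize] at *; omega, hrv.ite_true hpt⟩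
  · have h' : cenc (c a) = .nil := by
      by_contra hne
      exact h ((hd a).2 hne)
    rw [h'] at hrv
    rw [if_neg h]
    exact ⟨_, by simp only [csize] at *; omega, hrv.ite_false hqu⟩

@[fun_prop]
theorem ite_bool {c : α → Bool} {f g : α → β} (hc : PolyTime c) (hf : PolyTime f)
    (hg : PolyTime g) : PolyTime (fun a => if c a = true then f a else g a) :=
  ite_nil hc hf hg fun a => by cases h : c a <;> simp [cenc_true, cenc_false]

@[fun_prop]
theorem cond {c : α → Bool} {f g : α → β} (hc : PolyTime c) (hf : PolyTime f)
    (hg : PolyTime g) : PolyTime (fun a => bif c a then f a else g a) := by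
  simp only [Bool.cond_eq_ite]
  exact ite_bool hc hf hg

@[fun_prop]
theorem list_cons {f : α → β} {g : α → List β} (hf : PolyTime f) (hg : PolyTime g) :
    PolyTime (fun a => f a :: g a) :=
  of_cenc (hf.prodMk hg) fun _ => rfl

@[fun_prop]
theorem list_tail {f : α → List β} (hf : PolyTime f) : PolyTime (fun a => (f a).tail) :=
  comp (f := List.tail) (of_data snd_data fun l => by cases l <;> rfl) hf

/-- The first element of a list. -/
@[fun_prop]
theorem list_headD {f : α → List β} {g : α → β} (hf : PolyTime f) (hg : PolyTime g) :
    PolyTime (fun a => (f a).headD (g a)) := by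
  have h : PolyTime (fun a => if f a ≠ [] then cenc ((f a).headD (g a)) else cenc (g a)) := by
    have h1 : PolyTime (fun a => (cenc (f a)).fst) := by
      have := toData.comp hf
      exact fst_data.comp this
    have h2 := ite_nil hf h1 (toData.comp hg) (d := fun a => f a ≠ [])
      fun a => by cases h : f a <;> simp [cenc_cons, cenc_nil]
    refine of_cenc h2 fun a => ?_
    cases h : f a <;> simp [cenc_cons, Data.fst]
  refine of_cenc h fun a => ?_
  cases h : f a <;> simp [cenc_data]

/-! ### Loops over lists -/

/-- A polynomial-time step can square the size of the accumulator, so iterating it may leave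
polynomial time; the hypothesis on prefixes bounds the accumulator at every intermediate stage. The
loop works on triples of the remaining list, the parameter and the accumulator, and stops when the
list, the first component, is `nil`. -/
theorem foldl {l : α → List γ} {z : α → δ} {g : α → δ → γ → δ} (hl : PolyTime l)
    (hz : PolyTime z) (hg : PolyTime (fun p : (α × δ) × γ => g p.1.1 p.1.2 p.2))
    (hB : ∃ B : Polynomial ℕ, ∀ a l', l' <+: l a →
      csize (l'.foldl (g a) (z a)) ≤ B.eval (csize a)) :
    PolyTime (fun a => (l a).foldl (g a) (z a)) := by
  obtain ⟨B, hB⟩ := hB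
  obtain ⟨p, T, hp⟩ := hg
  have hstart : PolyTime (fun a => (l a, a, z a)) := by fun_prop
  have hout : PolyTime (fun x : List γ × α × δ => x.2.2) := by fun_prop
  obtain ⟨L, hL⟩ := hl.exists_csize_le
  -- On `(c :: l', a, d)` the three parts produce `l'`, `a`, and the result of `p` on `((a, d), c)`.
  let body : Prog := .pair (.comp .fst .snd) (.pair (.comp .snd .fst)
    (.comp (.pair (.pair (.comp .snd .fst) (.comp .snd .snd)) (.comp .fst .fst)) p))
  -- size bounds valid throughout the loop
  let S : Polynomial ℕ := L + Polynomial.X + B + 4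
  let K : Polynomial ℕ := T.comp S + 30 * S + 30
  have hbody : ∀ (a : α) (c : γ) (l' : List γ) (d : δ),
      csize (c :: l', a, d) ≤ S.eval (csize a) → ∃ t ≤ K.eval (csize a),
        body.Runs (cenc (c :: l', a, d)) (cenc (l', a, g a d c)) t := by
    intro a c l' d hS
    obtain ⟨t, ht, hr⟩ := hp ((a, d), c)
    refine ⟨_, ?_, Prog.Runs.pair (.comp (.fst _) (.snd _)) (Prog.Runs.pair
      (.comp (.snd _) (.fst _)) (Prog.Runs.comp (.pair (.pair (.comp (.snd _) (.fst _))
        (.comp (.snd _) (.snd _))) (.comp (.fst _) (.fst _))) hr))⟩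
    have h1 : csize ((a, d), c) ≤ S.eval (csize a) := by
      refine le_trans ?_ hS
      simp only [csize_pair, csize_cons]; omega
    have h2 := ht.trans (T.eval_mono_nat h1)
    simp only [K, Polynomial.eval_add, Polynomial.eval_comp, Polynomial.eval_mul]
    simp only [csize, cenc_pair, cenc_cons, Data.fst, Data.snd, Data.size,
      Polynomial.eval_ofNat] at *
    omega
  have hloop : ∀ (a : α) (l' pre : List γ), pre ++ l' = l a →
      ∃ t ≤ (l'.length + 1) * (K.eval (csize a) + S.eval (csize a) + 1),
        (Prog.loop body).Runs (cenc (l', a, pre.foldl (g a) (z a)))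
          (cenc (([] : List γ), a, (l a).foldl (g a) (z a))) t := by
    -- The induction is on the remaining list `l'`, with the processed prefix `pre` generalized: the
    -- accumulator is always the fold over `pre`.
    intro a l'
    have hSize : ∀ pre l', pre ++ l' = l a →
        csize (l', a, pre.foldl (g a) (z a)) ≤ S.eval (csize a) := by
      intro pre l' h
      have h1 := hB a pre ⟨l', h⟩
      have h2 := hL a
      have h3 := csize_append pre l'
      have h4 := csize_pos pre
      rw [h] at h3
      simp only [S, csize_pair, Polynomial.eval_add, Polynomial.eval_X, Polynomial.eval_ofNat]
      omega
    induction l' with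
    | nil =>
      intro pre h
      have h1 := hSize pre [] h
      rw [List.append_nil] at h
      subst h
      refine ⟨_, ?_, Prog.Runs.loop_done rfl⟩
      simp only [List.length_nil, zero_add, one_mul, csize] at *
      omega
    | cons c l' ih =>
      intro pre h
      have h1 := hSize pre _ h
      obtain ⟨t, ht, hr⟩ := hbody a c l' _ h1
      obtain ⟨u, hu, hs⟩ := ih (pre ++ [c]) (by simpa using h)
      rw [List.foldl_append] at hs
      refine ⟨_, ?_, Prog.Runs.loop_step (by simp [cenc_pair, cenc_cons, Data.fst]) hr hs⟩
      have e : ((c :: l').length + 1) * (K.eval (csize a) + S.eval (csize a) + 1) =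
        (l'.length + 1) * (K.eval (csize a) + S.eval (csize a) + 1) +
          (K.eval (csize a) + S.eval (csize a) + 1) := by
        rw [List.length_cons]; ring
      rw [e]
      simp only [csize] at *
      omega
  obtain ⟨q, U, hq⟩ := hstart
  obtain ⟨r, V, hr⟩ := hout
  refine ⟨.comp q (.comp (.loop body) r),
    U + (L + 1) * (K + S + 1) + V.comp S + 2, fun a => ?_⟩
  obtain ⟨t, ht, hqt⟩ := hq a
  obtain ⟨u, hu, hlu⟩ := hloop a (l a) [] rfl
  obtain ⟨v, hv, hrv⟩ := hr (([] : List γ), a, (l a).foldl (g a) (z a))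
  refine ⟨_, ?_, hqt.comp (hlu.comp hrv)⟩
  have h1 : csize (([] : List γ), a, (l a).foldl (g a) (z a)) ≤ S.eval (csize a) := by
    have h1 := hB a (l a) (List.prefix_refl _)
    simp only [S, csize_pair, csize_nil, Polynomial.eval_add, Polynomial.eval_X,
      Polynomial.eval_ofNat]
    omega
  have h2 := hv.trans (V.eval_mono_nat h1)
  have h3 : ((l a).length + 1) * (K.eval (csize a) + S.eval (csize a) + 1) ≤
      (L.eval (csize a) + 1) * (K.eval (csize a) + S.eval (csize a) + 1) := by
    apply Nat.mul_le_mul_right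
    have := length_lt_csize (l a)
    have := hL a
    omega
  simp only [Polynomial.eval_add, Polynomial.eval_mul, Polynomial.eval_comp, Polynomial.eval_one,
    Polynomial.eval_ofNat]
  omega

@[fun_prop]
theorem list_reverse {l : α → List β} (hl : PolyTime l) : PolyTime (fun a => (l a).reverse) := by
  have key : ∀ l : List β, l.foldl (fun acc b => b :: acc) [] = l.reverse := by
    intro l; simp
  have hsize : ∀ l : List β, csize l.reverse = csize l := by
    intro l
    induction l with
    | nil => rfl
    | cons b l ih =>
      have := csize_append l.reverse [b]
      simp only [List.reverse_cons, csize_cons, csize_nil] at *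
      omega
  have h := foldl (l := l) (z := fun _ => ([] : List β)) (g := fun _ acc b => b :: acc) hl
    (by fun_prop) (by fun_prop) ?_
  · simpa only [key] using h
  · obtain ⟨L, hL⟩ := hl.exists_csize_le
    refine ⟨L, fun a l' h' => ?_⟩
    rw [key, hsize]
    refine le_trans ?_ (hL a)
    obtain ⟨s, hs⟩ := h'
    have h1 := csize_append l' s
    have h2 := csize_pos s
    rw [hs] at h1
    omega

/-- A right fold is a left fold over the reversed list, so suffixes take over the role of prefixes
in the size bound. -/
theorem foldr {l : α → List γ} {z : α → δ} {g : α → γ → δ → δ} (hl : PolyTime l)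
    (hz : PolyTime z) (hg : PolyTime (fun p : (α × δ) × γ => g p.1.1 p.2 p.1.2))
    (hB : ∃ B : Polynomial ℕ, ∀ a l', l' <:+ l a →
      csize (l'.foldr (g a) (z a)) ≤ B.eval (csize a)) :
    PolyTime (fun a => (l a).foldr (g a) (z a)) := by
  simp only [List.foldr_eq_foldl_reverse]
  refine foldl (g := fun a d c => g a c d) hl.list_reverse hz hg ?_
  obtain ⟨B, hB⟩ := hB
  refine ⟨B, fun a l' h => ?_⟩
  have := hB a l'.reverse (by simpa using List.reverse_suffix.2 h)
  rwa [List.foldr_eq_foldl_reverse, List.reverse_reverse] at this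

/-- Folds whose accumulator grows by a bounded amount in every step. -/
theorem foldr_of_le_add {l : α → List γ} {z : α → δ} {g : α → γ → δ → δ} (hl : PolyTime l)
    (hz : PolyTime z) (hg : PolyTime (fun p : (α × δ) × γ => g p.1.1 p.2 p.1.2))
    (hB : ∃ B : Polynomial ℕ, ∀ a c d, csize (g a c d) ≤ csize d + B.eval (csize (a, c))) :
    PolyTime (fun a => (l a).foldr (g a) (z a)) := by
  refine foldr hl hz hg ?_
  obtain ⟨B, hB⟩ := hB
  obtain ⟨L, hL⟩ := hl.exists_csize_le
  obtain ⟨Z, hZ⟩ := hz.exists_csize_le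
  refine ⟨Z + L * B.comp (Polynomial.X + L + 1), fun a l' h => ?_⟩
  have key : ∀ l' : List γ, l' <:+ l a → csize (l'.foldr (g a) (z a)) ≤
      Z.eval (csize a) + l'.length * B.eval (csize a + L.eval (csize a) + 1) := by
    intro l' h
    induction l' with
    | nil => simpa using hZ a
    | cons c l' ih =>
      have h1 := ih ((List.suffix_cons c l').trans h)
      have h2 := hB a c (l'.foldr (g a) (z a))
      have h3 : csize (a, c) ≤ csize a + L.eval (csize a) + 1 := by
        have := csize_le_of_mem (h.subset (List.mem_cons_self (a := c) (l := l')))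
        have := hL a
        rw [csize_pair]; omega
      have h4 := B.eval_mono_nat h3
      simp only [List.foldr_cons, List.length_cons, add_mul, one_mul]
      omega
  refine (key l' h).trans ?_
  simp only [Polynomial.eval_add, Polynomial.eval_mul, Polynomial.eval_comp, Polynomial.eval_X,
    Polynomial.eval_one]
  gcongr
  have := length_lt_csize (l a)
  have := hL a
  have := h.length_le
  omega

@[fun_prop]
theorem list_append {f g : α → List β} (hf : PolyTime f) (hg : PolyTime g) :
    PolyTime (fun a => f a ++ g a) := by
  have h := foldr_of_le_add (g := fun (_ : α) (c : β) l => c :: l) hf hg (by fun_prop)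
    ⟨Polynomial.X + 1, fun a c d => by simp [csize_cons, csize_pair]; omega⟩
  simpa using h

@[fun_prop]
theorem list_flatMap {l : α → List γ} {f : α → γ → List β} (hl : PolyTime l)
    (hf : PolyTime (fun p : α × γ => f p.1 p.2)) :
    PolyTime (fun a => (l a).flatMap (f a)) := by
  obtain ⟨B, hB⟩ := hf.exists_csize_le
  have hf' : PolyTime (fun p : (α × List β) × γ => f p.1.1 p.2) :=
    comp (f := fun p : α × γ => f p.1 p.2) (g := fun p : (α × List β) × γ => (p.1.1, p.2)) hf
      (by fun_prop)
  have h := foldr_of_le_add (z := fun _ => ([] : List β)) (g := fun a c acc => f a c ++ acc) hl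
    (by fun_prop) (by fun_prop) ⟨B, fun a c d => by
      have := csize_append (f a c) d
      have := hB (a, c)
      simp only at this
      omega⟩
  have e : ∀ (f : γ → List β) (l : List γ),
      l.foldr (fun c acc => f c ++ acc) [] = l.flatMap f := by
    intro f l
    induction l with
    | nil => rfl
    | cons c l ih => simp [ih]
  simpa only [e] using h

@[fun_prop]
theorem list_map {l : α → List γ} {f : α → γ → β} (hl : PolyTime l)
    (hf : PolyTime (fun p : α × γ => f p.1 p.2)) :
    PolyTime (fun a => (l a).map (f a)) := by
  have h := list_flatMap (f := fun a c => [f a c]) hl (by fun_prop)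
  have e : ∀ (f : γ → β) (l : List γ), l.flatMap (fun c => [f c]) = l.map f := by
    intro f l
    induction l with
    | nil => rfl
    | cons c l ih => rw [List.flatMap_cons, ih]; rfl
  simpa only [e] using h

end PolyTime


namespace PolyTime

variable {α β γ δ : Type} [Coded α] [Coded β] [Coded γ] [Coded δ]

/-! ### Natural numbers, Booleans and lists -/

@[fun_prop]
theorem list_isEmpty {l : α → List β} (hl : PolyTime l) : PolyTime (fun a => (l a).isEmpty) := by
  have h := ite_nil hl (const false) (const true) (d := fun a => l a ≠ [])
    fun a => by cases h : l a <;> simp [cenc_cons, cenc_nil]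
  refine of_cenc h fun a => ?_
  cases h : l a <;> simp

/-- A number in unary has the same code as a list of that many `nil`s, so numbers can serve as loop
counters and loops over numbers reduce to loops over lists. -/
theorem units {n : α → ℕ} (hn : PolyTime n) :
    PolyTime (fun a => List.replicate (n a) Data.nil) :=
  of_cenc hn fun a => by
    generalize n a = k
    induction k with
    | zero => rfl
    | succ k ih => rw [List.replicate_succ, cenc_cons, ih]; rfl

theorem iterate {n : α → ℕ} {z : α → δ} {g : α → δ → δ} (hn : PolyTime n) (hz : PolyTime z)
    (hg : PolyTime (fun p : α × δ => g p.1 p.2))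
    (hB : ∃ B : Polynomial ℕ, ∀ a, ∀ k ≤ n a, csize ((g a)^[k] (z a)) ≤ B.eval (csize a)) :
    PolyTime (fun a => (g a)^[n a] (z a)) := by
  have key : ∀ (h : δ → δ) (w : δ) (k : ℕ),
      (List.replicate k Data.nil).foldr (fun _ => h) w = h^[k] w := by
    intro h w k
    induction k with
    | zero => rfl
    | succ k ih => rw [List.replicate_succ, List.foldr_cons, ih, Function.iterate_succ_apply']
  have h := foldr (l := fun a => List.replicate (n a) Data.nil) (g := fun a _ => g a) (units hn) hz
    (comp (f := fun p : α × δ => g p.1 p.2) hg (by fun_prop)) ?_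
  · simpa only [key] using h
  · obtain ⟨B, hB⟩ := hB
    refine ⟨B, fun a l' hl' => ?_⟩
    obtain ⟨h1, h2⟩ := List.suffix_replicate_iff.1 hl'
    rw [h2, key]
    exact hB a _ h1

theorem iterate_of_le_add {n : α → ℕ} {z : α → δ} {g : α → δ → δ} (hn : PolyTime n)
    (hz : PolyTime z) (hg : PolyTime (fun p : α × δ => g p.1 p.2))
    (hB : ∃ B : Polynomial ℕ, ∀ a d, csize (g a d) ≤ csize d + B.eval (csize a)) :
    PolyTime (fun a => (g a)^[n a] (z a)) := by
  refine iterate hn hz hg ?_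
  obtain ⟨B, hB⟩ := hB
  obtain ⟨L, hL⟩ := hn.exists_csize_le
  obtain ⟨Z, hZ⟩ := hz.exists_csize_le
  refine ⟨Z + L * B, fun a k hk => ?_⟩
  have key : csize ((g a)^[k] (z a)) ≤ Z.eval (csize a) + k * B.eval (csize a) := by
    clear hk
    induction k with
    | zero => simpa using hZ a
    | succ k ih =>
      have := hB a ((g a)^[k] (z a))
      rw [Function.iterate_succ_apply', add_mul, one_mul]
      omega
  refine key.trans ?_
  simp only [Polynomial.eval_add, Polynomial.eval_mul]
  gcongr
  have := hL a
  rw [csize_nat] at this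
  omega

@[fun_prop]
theorem nat_add {f g : α → ℕ} (hf : PolyTime f) (hg : PolyTime g) :
    PolyTime (fun a => f a + g a) := by
  have hs : PolyTime (fun n : ℕ => n + 1) :=
    of_cenc (g := fun n => Data.cons .nil (cenc n)) ((const Data.nil).data_cons toData)
      fun _ => rfl
  have h := iterate_of_le_add (g := fun (_ : α) (n : ℕ) => n + 1) hf hg
    (hs.comp (by fun_prop)) ⟨2, fun a d => by simp [csize_nat]; omega⟩
  refine of_cenc h fun a => ?_
  congr 1
  generalize f a = k
  induction k with
  | zero => simp
  | succ k ih => rw [Function.iterate_succ_apply', ← ih]; omega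

@[fun_prop]
theorem nat_mul {f g : α → ℕ} (hf : PolyTime f) (hg : PolyTime g) :
    PolyTime (fun a => f a * g a) := by
  obtain ⟨G, hG⟩ := hg.exists_csize_le
  have h := iterate_of_le_add (g := fun (a : α) (n : ℕ) => n + g a) (z := fun _ => 0) hf
    (by fun_prop) (by fun_prop) ⟨G, fun a d => by
      have := hG a; simp only [csize_nat] at *; omega⟩
  refine of_cenc h fun a => ?_
  congr 1
  generalize f a = k
  induction k with
  | zero => simp
  | succ k ih => rw [Function.iterate_succ_apply', ← ih]; ring

@[fun_prop]
theorem nat_sub {f g : α → ℕ} (hf : PolyTime f) (hg : PolyTime g) :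
    PolyTime (fun a => f a - g a) := by
  have hs : PolyTime Nat.pred := of_data snd_data fun n => by cases n <;> rfl
  have h := iterate_of_le_add (g := fun (_ : α) (n : ℕ) => n.pred) hg hf
    (hs.comp (by fun_prop)) ⟨0, fun a d => by simp [csize_nat]⟩
  refine of_cenc h fun a => ?_
  congr 1
  generalize g a = k
  induction k with
  | zero => simp
  | succ k ih => rw [Function.iterate_succ_apply', ← ih]; rfl

@[fun_prop]
theorem bool_not {c : α → Bool} (hc : PolyTime c) : PolyTime (fun a => !c a) := by
  refine of_cenc (hc.ite_bool (const false) (const true)) fun a => ?_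
  cases c a <;> rfl

@[fun_prop]
theorem bool_and {c d : α → Bool} (hc : PolyTime c) (hd : PolyTime d) :
    PolyTime (fun a => c a && d a) := by
  refine of_cenc (hc.ite_bool hd (const false)) fun a => ?_
  cases c a <;> rfl

@[fun_prop]
theorem nat_ble {f g : α → ℕ} (hf : PolyTime f) (hg : PolyTime g) :
    PolyTime (fun a => Nat.ble (f a) (g a)) := by
  have h := ite_nil (hf.nat_sub hg) (const false) (const true) (d := fun a => f a - g a ≠ 0)
    fun a => by cases h : f a - g a <;> simp [cenc_succ, cenc_zero]
  refine of_cenc h fun a => ?_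
  congr 1
  rw [Bool.eq_iff_iff, Nat.ble_eq]
  simp only [ne_eq, ite_not]
  split_ifs <;> simp <;> omega

@[fun_prop]
theorem nat_beq {f g : α → ℕ} (hf : PolyTime f) (hg : PolyTime g) :
    PolyTime (fun a => Nat.beq (f a) (g a)) := by
  refine of_cenc ((hf.nat_ble hg).bool_and (hg.nat_ble hf)) fun a => ?_
  congr 1
  rw [Bool.eq_iff_iff, Bool.and_eq_true, Nat.ble_eq, Nat.ble_eq, Nat.beq_eq]
  omega

@[fun_prop]
theorem list_range {n : α → ℕ} (hn : PolyTime n) : PolyTime (fun a => List.range (n a)) := by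
  have hit : ∀ k, (fun p : ℕ × List ℕ => (p.1 + 1, p.2 ++ [p.1]))^[k] (0, []) =
      (k, List.range k) := by
    intro k
    induction k with
    | zero => rfl
    | succ k ih => rw [Function.iterate_succ_apply', ih, List.range_succ]
  have hsz : ∀ k, csize (List.range k) ≤ k * (2 * k + 2) + 1 := by
    intro k
    induction k with
    | zero => simp [csize_nil]
    | succ k ih =>
      have := csize_append (List.range k) [k]
      rw [List.range_succ]
      simp only [csize_cons, csize_nil, csize_nat] at this
      nlinarith
  have h := iterate (g := fun (_ : α) (p : ℕ × List ℕ) => (p.1 + 1, p.2 ++ [p.1]))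
    (z := fun _ => (0, [])) hn (by fun_prop) (by fun_prop) ?_
  · refine of_cenc h.snd fun a => ?_
    rw [hit]
  · obtain ⟨L, hL⟩ := hn.exists_csize_le
    refine ⟨L + L * (2 * L + 2) + 2, fun a k hk => ?_⟩
    have h1 := hL a
    have h2 := hsz k
    rw [csize_nat] at h1
    rw [hit, csize_pair, csize_nat]
    simp only [Polynomial.eval_add, Polynomial.eval_mul, Polynomial.eval_ofNat]
    have : k * (2 * k + 2) ≤ L.eval (csize a) * (2 * L.eval (csize a) + 2) := by
      gcongr <;> omega
    omega

theorem csize_tail_le (l : List α) : csize l.tail ≤ csize l := by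
  cases l
  · exact le_rfl
  · simp only [List.tail_cons, csize_cons]; omega

@[fun_prop]
theorem list_drop {n : α → ℕ} {l : α → List β} (hn : PolyTime n) (hl : PolyTime l) :
    PolyTime (fun a => (l a).drop (n a)) := by
  have h := iterate_of_le_add (g := fun (_ : α) (l : List β) => l.tail) hn hl (by fun_prop)
    ⟨0, fun a d => by simpa using csize_tail_le d⟩
  simpa only [List.tail_iterate] using h

@[fun_prop]
theorem list_getD {n : α → ℕ} {l : α → List β} {d : α → β} (hl : PolyTime l) (hn : PolyTime n)
    (hd : PolyTime d) : PolyTime (fun a => (l a).getD (n a) (d a)) := by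
  refine of_cenc ((hn.list_drop hl).list_headD hd) fun a => ?_
  rw [List.getD_eq_getElem?_getD, List.headD_eq_head?_getD, List.head?_drop]

@[fun_prop]
theorem list_length {l : α → List β} (hl : PolyTime l) : PolyTime (fun a => (l a).length) := by
  have h := foldr_of_le_add (g := fun (_ : α) (_ : β) (n : ℕ) => n + 1) (z := fun _ => 0) hl
    (by fun_prop) (by fun_prop) ⟨2, fun a c d => by simp [csize_nat]; omega⟩
  refine of_cenc h fun a => ?_
  congr 1
  generalize l a = l
  induction l with
  | nil => rfl
  | cons b l ih => rw [List.foldr_cons, List.length_cons, ih]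

@[fun_prop]
theorem list_sum {l : α → List ℕ} (hl : PolyTime l) : PolyTime (fun a => (l a).sum) := by
  have h := foldr_of_le_add (g := fun (_ : α) (m : ℕ) (n : ℕ) => m + n) (z := fun _ => 0) hl
    (by fun_prop) (by fun_prop) ⟨Polynomial.X, fun a c d => by
      simp [csize_pair, csize_nat]; omega⟩
  exact h

/-! ### Loops on typed data and recursion on trees -/

/-- `Reaches step S n x y`: iterating `step` on `x` leads to `y` in `n` steps; before, the work list
is non-empty, and all states have size at most `S`. -/
inductive Reaches (step : List γ × δ → List γ × δ) (S : ℕ) :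
    ℕ → List γ × δ → List γ × δ → Prop
  | refl (x) : csize x ≤ S → Reaches step S 0 x x
  | head {n x y} : x.1 ≠ [] → csize x ≤ S → Reaches step S n (step x) y →
      Reaches step S (n + 1) x y

theorem Reaches.trans {step : List γ × δ → List γ × δ} {S m n : ℕ} {x y z : List γ × δ}
    (h : Reaches step S m x y) (h' : Reaches step S n y z) : Reaches step S (m + n) x z := by
  induction h with
  | refl x _ => simpa using h'
  | head h1 h2 _ ih =>
    rw [add_right_comm]
    exact .head h1 h2 (ih h')

/-- Unlike a fold, this loop may push new tasks on its work list, so the number of rounds is not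
known from the input. It has to be bounded together with all intermediate sizes. -/
theorem loop {step : List γ × δ → List γ × δ} {x₀ out : α → List γ × δ} (hs : PolyTime step)
    (hx₀ : PolyTime x₀) (hout : ∀ a, (out a).1 = [])
    (h : ∃ B : Polynomial ℕ, ∀ a, ∃ n ≤ B.eval (csize a),
      Reaches step (B.eval (csize a)) n (x₀ a) (out a)) : PolyTime out := by
  obtain ⟨p, T, hp⟩ := hs
  obtain ⟨q, U, hq⟩ := hx₀
  obtain ⟨B, hB⟩ := h
  have key : ∀ (S n : ℕ) (x y : List γ × δ), Reaches step S n x y → y.1 = [] →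
      ∃ t ≤ (n + 1) * (T.eval S + S + 1), (Prog.loop p).Runs (cenc x) (cenc y) t := by
    intro S n x y hr hy
    induction hr with
    | refl x hx =>
      refine ⟨_, ?_, .loop_done ?_⟩
      · simp only [csize] at hx; rw [zero_add, one_mul]; omega
      · obtain ⟨x1, x2⟩ := x
        simp only at hy
        subst hy
        rfl
    | @head n x y h1 h2 _ ih =>
      obtain ⟨t, ht, hrt⟩ := hp x
      obtain ⟨u, hu, hru⟩ := ih hy
      refine ⟨_, ?_, .loop_step ?_ hrt hru⟩
      · have := T.eval_mono_nat h2
        have e : (n + 1 + 1) * (T.eval S + S + 1) =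
          (n + 1) * (T.eval S + S + 1) + (T.eval S + S + 1) := by ring
        rw [e]
        simp only [csize] at *
        omega
      · obtain ⟨x1, x2⟩ := x
        cases x1 with
        | nil => exact absurd rfl h1
        | cons c l => simp [cenc_pair, cenc_cons, Data.fst]
  refine ⟨.comp q (.loop p), U + (B + 1) * (T.comp B + B + 1) + 1, fun a => ?_⟩
  obtain ⟨t, ht, hqt⟩ := hq a
  obtain ⟨n, hn, hr⟩ := hB a
  obtain ⟨u, hu, hru⟩ := key _ _ _ _ hr (hout a)
  refine ⟨_, ?_, hqt.comp hru⟩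
  have : (n + 1) * (T.eval (B.eval (csize a)) + B.eval (csize a) + 1) ≤
      (B.eval (csize a) + 1) * (T.eval (B.eval (csize a)) + B.eval (csize a) + 1) := by gcongr
  simp only [Polynomial.eval_add, Polynomial.eval_mul, Polynomial.eval_comp, Polynomial.eval_one]
  omega

end PolyTime

/-- Iteration along the structure of a tree. -/
def Data.cata {β : Type} (z : β) (g : β → β → β) : Data → β
  | .nil => z
  | .cons x y => g (x.cata z g) (y.cata z g)

def Data.isNil : Data → Bool
  | .nil => true
  | .cons _ _ => false

namespace PolyTime

variable {α β : Type} [Coded α] [Coded β]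

@[fun_prop]
theorem data_isNil {f : α → Data} (hf : PolyTime f) : PolyTime (fun a => (f a).isNil) := by
  have h := ite_nil hf (const false) (const true) (d := fun a => (f a).isNil = false)
    fun a => by cases h : f a <;> simp [cenc_data, Data.isNil]
  refine of_cenc h fun a => ?_
  cases h : (f a).isNil <;> simp

/-- One step of the evaluation of `Data.cata` with a stack. -/
def cataStep (z : α → β) (g : α → β → β → β) (x : List (List Data) × α × List β) :
    List (List Data) × α × List β :=
  -- The stack holds two kinds of tasks: a singleton `[x]` asks for the evaluation of the tree `x`,
  -- the empty list asks for `g` to be applied to the last two values. The right subtree is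
  -- evaluated last, so its value lies on top and becomes the second argument.
  bif (x.1.headD []).isEmpty then
    (x.1.tail, x.2.1, g x.2.1 (x.2.2.tail.headD (z x.2.1)) (x.2.2.headD (z x.2.1)) ::
      x.2.2.tail.tail)
  else bif ((x.1.headD []).headD .nil).isNil then (x.1.tail, x.2.1, z x.2.1 :: x.2.2)
  else ([((x.1.headD []).headD .nil).fst] :: [((x.1.headD []).headD .nil).snd] :: [] :: x.1.tail,
    x.2.1, x.2.2)

/-- Evaluation in post-order with an explicit stack visits every node a bounded number of times. The
size bound concerns arbitrary trees, because the recursion also runs through subtrees that need not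
be codes of anything. -/
theorem cata {z : α → β} {g : α → β → β → β} {f : α → Data} (hz : PolyTime z)
    (hg : PolyTime (fun p : (α × β) × β => g p.1.1 p.1.2 p.2)) (hf : PolyTime f)
    (hB : ∃ B : Polynomial ℕ, ∀ a x, csize (Data.cata (z a) (g a) x) ≤ B.eval (csize (a, x))) :
    PolyTime (fun a => Data.cata (z a) (g a) (f a)) := by
  have hstep : PolyTime (cataStep z g) := by
    unfold cataStep
    have : PolyTime fun x : List (List Data) × α × List β =>
        g x.2.1 (x.2.2.tail.headD (z x.2.1)) (x.2.2.headD (z x.2.1)) :=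
      comp (f := fun p : (α × β) × β => g p.1.1 p.1.2 p.2)
        (g := fun x : List (List Data) × α × List β =>
          ((x.2.1, x.2.2.tail.headD (z x.2.1)), x.2.2.headD (z x.2.1))) hg (by fun_prop)
    exact cond (by fun_prop) (prodMk (by fun_prop) (prodMk (by fun_prop)
      (list_cons this (by fun_prop)))) (by fun_prop)
  -- Evaluating `x` leaves the tasks and values below it untouched. The term `(V + 10) * x.size`
  -- pays for the values, each of size at most `V`, and the tasks that are produced meanwhile.
  have key : ∀ (a : α) (V n S : ℕ), (∀ y : Data, y.size ≤ n → csize (y.cata (z a) (g a)) ≤ V) →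
      ∀ (x : Data), x.size ≤ n → ∀ (todo : List (List Data)) (vals : List β),
      csize todo + csize vals + csize a + (V + 10) * x.size + 10 ≤ S →
      ∃ k ≤ 3 * x.size, Reaches (cataStep z g) S k ([x] :: todo, a, vals)
        (todo, a, x.cata (z a) (g a) :: vals) := by
    intro a V n S hV x
    induction x with
    | nil =>
      intro hx todo vals hS
      have h0 := hV .nil hx
      have e1 : csize [Data.nil] = 3 := rfl
      refine ⟨1, by simp [Data.size], .head (by simp) ?_ (.refl _ ?_)⟩
      · simp only [csize_pair, csize_cons [Data.nil], e1, Data.size] at *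
        omega
      · simp only [cataStep, csize_pair, csize_cons, List.headD_cons, List.isEmpty_cons,
          Data.isNil, cond_true, cond_false, List.tail_cons, Data.size, Data.cata] at *
        omega
    | cons x y ihx ihy =>
      intro hx todo vals hS
      have ex : ∀ w : Data, csize [w] = w.size + 2 := fun w => rfl
      have e0 : csize ([] : List Data) = 1 := rfl
      simp only [Data.size] at hx
      have hx1 := hV x (by omega)
      have hy1 := hV y (by omega)
      have h0 := hV (.cons x y) (by simpa [Data.size] using hx)
      simp only [Data.size, mul_add, mul_one] at hS
      have px := Nat.mul_le_mul_left (V + 10) x.size_pos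
      have py := Nat.mul_le_mul_left (V + 10) y.size_pos
      have qx : 10 * x.size ≤ (V + 10) * x.size := Nat.mul_le_mul_right _ (by omega)
      have qy : 10 * y.size ≤ (V + 10) * y.size := Nat.mul_le_mul_right _ (by omega)
      obtain ⟨k1, hk1, h1⟩ := ihx (by omega) ([y] :: [] :: todo) vals (by
        simp only [csize_cons [y], csize_cons ([] : List Data), ex, e0]; omega)
      obtain ⟨k2, hk2, h2⟩ := ihy (by omega) ([] :: todo) (x.cata (z a) (g a) :: vals) (by
        simp only [csize_cons ([] : List Data), csize_cons (x.cata (z a) (g a)), e0]; omega)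
      refine ⟨_, ?_, .head (by simp) ?_ ((h1.trans h2).trans (.head (by simp) ?_ (.refl _ ?_)))⟩
      · simp only [Data.size]; omega
      · simp only [csize_pair, csize_cons [Data.cons x y], ex, Data.size]
        omega
      · simp only [csize_pair, csize_cons ([] : List Data), csize_cons (x.cata (z a) (g a)),
          csize_cons (y.cata (z a) (g a)), e0]
        omega
      · simp only [cataStep, csize_pair, csize_cons, List.headD_cons, List.headD_nil,
          List.isEmpty_nil, cond_true, List.tail_cons, Data.cata] at *
        omega
  obtain ⟨B, hB⟩ := hB
  obtain ⟨L, hL⟩ := hf.exists_csize_le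
  have hstart : PolyTime fun a => ([[f a]], a, ([] : List β)) := by fun_prop
  have hl := loop (out := fun a => ([], a, [Data.cata (z a) (g a) (f a)])) hstep hstart
    (fun _ => rfl) ?_
  · exact of_cenc (hl.snd.snd.list_headD hz) fun a => rfl
  · let V : Polynomial ℕ := B.comp (Polynomial.X + L + 1)
    refine ⟨Polynomial.X + (V + 13) * L + 20, fun a => ?_⟩
    have hfa := hL a
    have h := key a (V.eval (csize a)) (f a).size
      ((Polynomial.X + (V + 13) * L + 20 : Polynomial ℕ).eval (csize a)) ?_ (f a) le_rfl [] [] ?_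
    · obtain ⟨k, hk, hr⟩ := h
      refine ⟨k, hk.trans ?_, hr⟩
      simp only [Polynomial.eval_add, Polynomial.eval_mul, Polynomial.eval_X,
        Polynomial.eval_ofNat]
      change (f a).size ≤ _ at hfa
      nlinarith
    · intro y hy
      refine (hB a y).trans ?_
      simp only [V, Polynomial.eval_comp, Polynomial.eval_add, Polynomial.eval_X,
        Polynomial.eval_one]
      apply Polynomial.eval_mono_nat
      rw [csize_pair]
      change (f a).size ≤ _ at hfa
      change csize a + y.size + 1 ≤ _
      omega
    · simp only [Polynomial.eval_add, Polynomial.eval_mul, Polynomial.eval_X,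
        Polynomial.eval_ofNat, csize_nil]
      change (f a).size ≤ _ at hfa
      have : (V.eval (csize a) + 10) * (f a).size ≤
          (V.eval (csize a) + 13) * L.eval (csize a) := by gcongr <;> omega
      omega

end PolyTime


/-! ## Reachability in finite Markov decision processes -/

/-- `v` is the maximum (if `mx`) or the minimum (otherwise) of `f` on `A`. -/
def IsOpt {B : Type} (mx : Bool) (A : Finset B) (f : B → ℝ) (v : ℝ) : Prop :=
  if mx then (∀ β ∈ A, f β ≤ v) ∧ ∃ β ∈ A, v ≤ f β
  else (∀ β ∈ A, v ≤ f β) ∧ ∃ β ∈ A, f β ≤ v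

theorem IsOpt.mono {B : Type} {mx : Bool} {A : Finset B} {f g : B → ℝ} {v w : ℝ}
    (hf : IsOpt mx A f v) (hg : IsOpt mx A g w) (h : ∀ β ∈ A, f β ≤ g β) : v ≤ w := by
  cases mx
  · obtain ⟨hf, -⟩ := hf
    obtain ⟨-, β, hβ, hg⟩ := hg
    exact (hf β hβ).trans ((h β hβ).trans hg)
  · obtain ⟨-, β, hβ, hf⟩ := hf
    obtain ⟨hg, -⟩ := hg
    exact hf.trans ((h β hβ).trans (hg β hβ))

theorem IsOpt.unique {B : Type} {mx : Bool} {A : Finset B} {f : B → ℝ} {v w : ℝ}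
    (hv : IsOpt mx A f v) (hw : IsOpt mx A f w) : v = w :=
  le_antisymm (hv.mono hw fun _ _ => le_rfl) (hw.mono hv fun _ _ => le_rfl)

theorem IsOpt.exists_eq {B : Type} {mx : Bool} {A : Finset B} {f : B → ℝ} {v : ℝ}
    (hv : IsOpt mx A f v) : ∃ β ∈ A, f β = v := by
  cases mx
  · obtain ⟨h, β, hβ, h'⟩ := hv
    exact ⟨β, hβ, le_antisymm h' (h β hβ)⟩
  · obtain ⟨h, β, hβ, h'⟩ := hv
    exact ⟨β, hβ, le_antisymm (h β hβ) h'⟩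

/-- A finite Markov decision process with configurations `X` and decisions `B`. -/
structure FinMDP (X B : Type) [Fintype X] where
  P : X → B → X → ℝ
  avail : X → Finset B
  avail_nonempty : ∀ c, (avail c).Nonempty
  nonneg : ∀ c, ∀ β ∈ avail c, ∀ c', 0 ≤ P c β c'
  sum_eq_one : ∀ c, ∀ β ∈ avail c, ∑ c', P c β c' = 1

namespace FinMDP

open Classical in
/-- The value at a configuration, given the value that is obtained by continuing. -/
noncomputable def absorb {X : Type} (goal ok : X → Prop) (c : X) (v : ℝ) : ℝ :=
  if goal c then 1 else if ok c then v else 0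

theorem absorb_mono {X : Type} {goal ok : X → Prop} {c : X} {v w : ℝ} (h : v ≤ w) :
    absorb goal ok c v ≤ absorb goal ok c w := by
  unfold absorb; split_ifs <;> simp [h]

variable {X B : Type} [Fintype X] (D : FinMDP X B)

/-- The expectation of `f` after one step. -/
def ex (f : X → ℝ) (c : X) (β : B) : ℝ := ∑ c', D.P c β c' * f c'

/-- The optimal expectation of `f` after one step. -/
noncomputable def opt (mx : Bool) (f : X → ℝ) (c : X) : ℝ :=
  if mx then (D.avail c).sup' (D.avail_nonempty c) (D.ex f c)
  else (D.avail c).inf' (D.avail_nonempty c) (D.ex f c)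

theorem isOpt_opt (mx : Bool) (f : X → ℝ) (c : X) :
    IsOpt mx (D.avail c) (D.ex f c) (D.opt mx f c) := by
  cases mx
  · obtain ⟨β, hβ, h⟩ := Finset.exists_mem_eq_inf' (D.avail_nonempty c) (D.ex f c)
    exact ⟨fun β hβ => Finset.inf'_le _ hβ, β, hβ, h.symm.le⟩
  · obtain ⟨β, hβ, h⟩ := Finset.exists_mem_eq_sup' (D.avail_nonempty c) (D.ex f c)
    exact ⟨fun β hβ => Finset.le_sup' _ hβ, β, hβ, h.le⟩

variable {D}

theorem ex_mono {f g : X → ℝ} (h : ∀ c, f c ≤ g c) {c : X} {β : B} (hβ : β ∈ D.avail c) :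
    D.ex f c β ≤ D.ex g c β :=
  Finset.sum_le_sum fun c' _ => mul_le_mul_of_nonneg_left (h c') (D.nonneg c β hβ c')

theorem ex_const (x : ℝ) {c : X} {β : B} (hβ : β ∈ D.avail c) :
    D.ex (fun _ => x) c β = x := by
  rw [ex, ← Finset.sum_mul, D.sum_eq_one c β hβ, one_mul]

theorem opt_mono (mx : Bool) {f g : X → ℝ} (h : ∀ c, f c ≤ g c) (c : X) :
    D.opt mx f c ≤ D.opt mx g c :=
  (D.isOpt_opt mx f c).mono (D.isOpt_opt mx g c) fun _ hβ => ex_mono h hβ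

theorem opt_const (mx : Bool) (x : ℝ) (c : X) : D.opt mx (fun _ => x) c = x := by
  obtain ⟨β, hβ, h⟩ := (D.isOpt_opt mx (fun _ => x) c).exists_eq
  rw [← h, ex_const x hβ]

theorem tendsto_opt (mx : Bool) {f : ℕ → X → ℝ} {g : X → ℝ}
    (h : ∀ c, Filter.Tendsto (fun n => f n c) Filter.atTop (nhds (g c))) (c : X) :
    Filter.Tendsto (fun n => D.opt mx (f n) c) Filter.atTop (nhds (D.opt mx g c)) := by
  have hex : ∀ β ∈ D.avail c,
      Filter.Tendsto (fun n => D.ex (f n) c β) Filter.atTop (nhds (D.ex g c β)) := fun β _ =>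
    tendsto_finsetSum _ fun c' _ => (h c').const_mul _
  cases mx
  · exact Filter.Tendsto.finset_inf'_nhds_apply (D.avail_nonempty c) hex
  · exact Filter.Tendsto.finset_sup'_nhds_apply (D.avail_nonempty c) hex

/-! ### Value iteration and the optimality equations -/

variable (D) (mx : Bool) (goal ok : X → Prop)

/-- Value iteration: the optimal probability of reaching `goal` through `ok` within `n` steps. -/
noncomputable def iter : ℕ → X → ℝ
  | 0, c => absorb goal ok c 0
  | n + 1, c => absorb goal ok c (D.opt mx (iter n) c)

variable {D mx goal ok}

theorem iter_nonneg (n : ℕ) : ∀ c, 0 ≤ D.iter mx goal ok n c := by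
  induction n with
  | zero => intro c; unfold iter absorb; split_ifs <;> simp
  | succ n ih =>
    intro c
    have h := D.opt_mono mx ih c
    rw [opt_const] at h
    unfold iter absorb; split_ifs <;> simp [h]

theorem iter_le_one (n : ℕ) : ∀ c, D.iter mx goal ok n c ≤ 1 := by
  induction n with
  | zero => intro c; unfold iter absorb; split_ifs <;> simp
  | succ n ih =>
    intro c
    have h := D.opt_mono mx ih c
    rw [opt_const] at h
    unfold iter absorb; split_ifs <;> simp [h]

theorem iter_le_succ (n : ℕ) : ∀ c, D.iter mx goal ok n c ≤ D.iter mx goal ok (n + 1) c := by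
  induction n with
  | zero =>
    intro c
    have h := D.opt_mono mx (iter_nonneg (D := D) (mx := mx) (goal := goal) (ok := ok) 0) c
    rw [opt_const] at h
    exact absorb_mono h
  | succ n ih => intro c; exact absorb_mono (D.opt_mono mx ih c)

variable (D mx goal ok) in
/-- The optimal probability of reaching `goal` through `ok`. -/
noncomputable def val (c : X) : ℝ := ⨆ n, D.iter mx goal ok n c

theorem tendsto_iter (c : X) : Filter.Tendsto (fun n => D.iter mx goal ok n c) Filter.atTop
    (nhds (D.val mx goal ok c)) :=
  tendsto_atTop_ciSup (monotone_nat_of_le_succ fun n => iter_le_succ n c)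
    ⟨1, by rintro _ ⟨n, rfl⟩; exact iter_le_one n c⟩

theorem iter_le_val (n : ℕ) (c : X) : D.iter mx goal ok n c ≤ D.val mx goal ok c :=
  le_ciSup (f := fun n => D.iter mx goal ok n c)
    ⟨1, by rintro _ ⟨n, rfl⟩; exact iter_le_one n c⟩ n

theorem val_nonneg (c : X) : 0 ≤ D.val mx goal ok c := (iter_nonneg 0 c).trans (iter_le_val 0 c)

/-- Let the recursion of value iteration tend to the limit: an optimum over finitely many decisions
is continuous in the values. -/
theorem val_eq (c : X) :
    D.val mx goal ok c = absorb goal ok c (D.opt mx (D.val mx goal ok) c) := by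
  have h1 := (Filter.tendsto_add_atTop_iff_nat 1).2 (D.tendsto_iter (mx := mx) (goal := goal)
    (ok := ok) c)
  refine tendsto_nhds_unique h1 ?_
  simp only [iter]
  unfold absorb
  split_ifs
  · exact tendsto_const_nhds
  · exact tendsto_opt mx tendsto_iter c
  · exact tendsto_const_nhds

theorem val_of_goal {c : X} (h : goal c) : D.val mx goal ok c = 1 := by
  rw [val_eq, absorb, if_pos h]

theorem val_of_not {c : X} (h : ¬ goal c) (h' : ¬ ok c) : D.val mx goal ok c = 0 := by
  rw [val_eq, absorb, if_neg h, if_neg h']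

theorem val_of_ok {c : X} (h : ¬ goal c) (h' : ok c) :
    D.val mx goal ok c = D.opt mx (D.val mx goal ok) c := by
  rw [val_eq, absorb, if_neg h, if_pos h']

/-- The value is the least non-negative solution of the optimality inequalities. -/
theorem val_le {u : X → ℝ} (h0 : ∀ c, 0 ≤ u c) (hg : ∀ c, goal c → 1 ≤ u c)
    (ho : ∀ c, ¬ goal c → ok c → D.opt mx u c ≤ u c) (c : X) : D.val mx goal ok c ≤ u c := by
  have key : ∀ n c, D.iter mx goal ok n c ≤ u c := by
    intro n
    induction n with
    | zero =>
      intro c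
      unfold iter absorb
      split_ifs with h
      exacts [hg c h, h0 c, h0 c]
    | succ n ih =>
      intro c
      unfold iter absorb
      split_ifs with h h'
      exacts [hg c h, (D.opt_mono mx ih c).trans (ho c h h'), h0 c]
  exact ciSup_le fun n => key n c

/-! ### Certificates for optimal values -/

variable (D mx) in
/-- From `c` one can (if `mx`, by an optimal decision for `u`) or one must (otherwise) move into `R`
with positive probability. -/
def Progress (u : X → ℝ) (R : X → Prop) (c : X) : Prop :=
  if mx then ∃ β ∈ D.avail c, u c ≤ D.ex u c β ∧ ∃ c', 0 < D.P c β c' ∧ R c'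
  else ∀ β ∈ D.avail c, ∃ c', 0 < D.P c β c' ∧ R c'

variable (D mx goal ok) in
/-- `u` solves the optimality equations, and the ranks `r` show that `goal` is reached with positive
probability from all configurations where `u` is positive. -/
structure Cert (u r : X → ℝ) : Prop where
  nonneg : ∀ c, 0 ≤ u c
  eq_one : ∀ c, goal c → u c = 1
  eq_zero : ∀ c, ¬ goal c → ¬ ok c → u c = 0
  isOpt : ∀ c, ¬ goal c → ok c → IsOpt mx (D.avail c) (D.ex u c) (u c)
  rank : ∀ c, ¬ goal c → ok c → 0 < u c → D.Progress mx u (fun c' => r c' < r c) c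

/-- An average of numbers at most `m` reaches `m` only if all numbers of positive weight are `m`. -/
theorem eq_of_ex_ge {f : X → ℝ} {m : ℝ} (hf : ∀ c, f c ≤ m) {c : X} {β : B}
    (hβ : β ∈ D.avail c) (h : m ≤ D.ex f c β) {c' : X} (hc' : 0 < D.P c β c') : f c' = m := by
  by_contra hne
  have hlt : f c' < m := lt_of_le_of_ne (hf c') hne
  have : D.ex f c β < D.ex (fun _ => m) c β := by
    refine Finset.sum_lt_sum (fun x _ => mul_le_mul_of_nonneg_left (hf x) (D.nonneg c β hβ x))
      ⟨c', Finset.mem_univ _, mul_lt_mul_of_pos_left hlt hc'⟩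
  rw [ex_const m hβ] at this
  linarith

theorem ex_sub (f g : X → ℝ) (c : X) (β : B) :
    D.ex (fun x => f x - g x) c β = D.ex f c β - D.ex g c β := by
  simp only [ex, mul_sub, Finset.sum_sub_distrib]

/-- The true value `w` is below `u` by leastness. If they differ, take the configurations where `u -
w` attains its maximum `m > 0`, and among them one of least rank. A decision that is optimal for `w`
(when minimizing) or for `u` (when maximizing) has expected difference at least `m`, so all its
successors have difference `m`. But the certificate provides a successor of smaller rank. -/
theorem Cert.eq_val {u r : X → ℝ} (h : D.Cert mx goal ok u r) : u = D.val mx goal ok := by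
  set w := D.val mx goal ok with hw
  have hle : ∀ c, w c ≤ u c := val_le h.nonneg (fun c hc => (h.eq_one c hc).ge)
    fun c hg ho => ((D.isOpt_opt mx u c).unique (h.isOpt c hg ho)).le
  funext c₀
  refine le_antisymm ?_ (hle c₀)
  by_contra hlt
  push Not at hlt
  obtain ⟨c₁, -, hmax⟩ := Finset.exists_max_image Finset.univ (fun c => u c - w c)
    ⟨c₀, Finset.mem_univ _⟩
  set m := u c₁ - w c₁ with hm
  have hm0 : 0 < m := by have := hmax c₀ (Finset.mem_univ _); linarith
  have hf : ∀ c, u c - w c ≤ m := fun c => hmax c (Finset.mem_univ _)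
  -- The set is finite, so real ranks have a least one; no integrality has to be expressed in the
  -- sentence.
  obtain ⟨c, hc, hmin⟩ := Finset.exists_min_image
    (Finset.univ.filter fun c => u c - w c = m) r ⟨c₁, by simp [hm]⟩
  rw [Finset.mem_filter] at hc
  have hcm := hc.2
  have hupos : 0 < u c := by have := val_nonneg (D := D) (mx := mx) (goal := goal) (ok := ok) c
                             linarith
  have hng : ¬ goal c := fun hg => by
    have h1 := h.eq_one c hg
    have h2 : w c = 1 := val_of_goal hg
    linarith
  have hok : ok c := by
    by_contra hno
    have := h.eq_zero c hng hno
    linarith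
  have hwc : w c = D.opt mx w c := val_of_ok hng hok
  have hwo := D.isOpt_opt mx w c
  rw [← hwc] at hwo
  have hp := h.rank c hng hok hupos
  have : ∃ β ∈ D.avail c, m ≤ D.ex (fun x => u x - w x) c β ∧
      ∃ c', 0 < D.P c β c' ∧ r c' < r c := by
    have huo := h.isOpt c hng hok
    cases mx
    · obtain ⟨β, hβ, e⟩ := hwo.exists_eq
      refine ⟨β, hβ, ?_, hp β hβ⟩
      rw [ex_sub]
      have := huo.1 β hβ
      linarith
    · obtain ⟨β, hβ, e, h2⟩ := hp
      refine ⟨β, hβ, ?_, h2⟩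
      rw [ex_sub]
      have := hwo.1 β hβ
      linarith
  obtain ⟨β, hβ, h1, c', hc', hr⟩ := this
  have h2 := eq_of_ex_ge hf hβ h1 hc'
  have h3 := hmin c' (by simp [h2])
  linarith

/-! ### Existence of ranks -/

variable (D mx goal ok) in
/-- The configurations of rank at most `n`. -/
def Ranked : ℕ → X → Prop
  | 0, c => goal c
  | n + 1, c => goal c ∨ (ok c ∧ D.Progress mx (D.val mx goal ok) (Ranked n) c)

theorem Progress.mono {u : X → ℝ} {R R' : X → Prop} (h : ∀ c, R c → R' c) {c : X}
    (hp : D.Progress mx u R c) : D.Progress mx u R' c := by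
  cases mx
  · intro β hβ
    obtain ⟨c', h1, h2⟩ := hp β hβ
    exact ⟨c', h1, h c' h2⟩
  · obtain ⟨β, hβ, h0, c', h1, h2⟩ := hp
    exact ⟨β, hβ, h0, c', h1, h c' h2⟩

theorem ranked_succ (n : ℕ) : ∀ c, D.Ranked mx goal ok n c → D.Ranked mx goal ok (n + 1) c := by
  induction n with
  | zero => intro c h; exact Or.inl h
  | succ n ih =>
    intro c h
    rcases h with h | ⟨h, h'⟩
    · exact Or.inl h
    · exact Or.inr ⟨h, h'.mono ih⟩

theorem ranked_mono {m n : ℕ} (h : m ≤ n) (c : X) (hc : D.Ranked mx goal ok m c) :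
    D.Ranked mx goal ok n c := by
  induction h with
  | refl => exact hc
  | step _ ih => exact ranked_succ _ c ih

/-- From a configuration without rank that is not a goal, the minimizer either is in a configuration
that is not `ok` or has a decision all of whose successors have no rank. So it avoids the goal
forever, and every stage of value iteration is zero there. -/
theorem exists_ranked_min {c : X} (hc : 0 < D.val false goal ok c) :
    ∃ n, D.Ranked false goal ok n c := by
  by_contra hno
  have key : ∀ n c, (¬ ∃ n, D.Ranked false goal ok n c) → D.iter false goal ok n c = 0 := by
    intro n
    induction n with
    | zero =>
      intro c h
      have hg : ¬ goal c := fun hg => h ⟨0, hg⟩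
      unfold iter absorb
      rw [if_neg hg]; simp
    | succ n ih =>
      intro c h
      have hg : ¬ goal c := fun hg => h ⟨0, hg⟩
      unfold iter absorb
      rw [if_neg hg]
      split_ifs with ho
      -- Otherwise every decision can reach some rank, and the maximum of these ranks over the
      -- finitely many decisions, plus one, would be a rank of `c`.
      · have : ∃ β ∈ D.avail c, ∀ c', 0 < D.P c β c' → ¬ ∃ n, D.Ranked false goal ok n c' := by
          by_contra hcon
          push Not at hcon
          have : ∀ β : B, ∃ k, β ∈ D.avail c → ∃ c', 0 < D.P c β c' ∧
              D.Ranked false goal ok k c' := by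
            intro β
            by_cases hβ : β ∈ D.avail c
            · obtain ⟨c', h1, k, hk⟩ := hcon β hβ
              exact ⟨k, fun _ => ⟨c', h1, hk⟩⟩
            · exact ⟨0, fun h => absurd h hβ⟩
          choose k hk using this
          refine h ⟨(D.avail c).sup k + 1, Or.inr ⟨ho, fun β hβ => ?_⟩⟩
          obtain ⟨c', h1, h2⟩ := hk β hβ
          exact ⟨c', h1, ranked_mono (Finset.le_sup hβ) c' h2⟩
        obtain ⟨β, hβ, h1⟩ := this
        have h2 : D.ex (D.iter false goal ok n) c β = 0 := by
          refine Finset.sum_eq_zero fun c' _ => ?_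
          rcases (D.nonneg c β hβ c').lt_or_eq with h3 | h3
          · rw [ih c' (h1 c' h3), mul_zero]
          · rw [← h3, zero_mul]
        refine le_antisymm ?_ ?_
        · rw [← h2]; exact (D.isOpt_opt false (D.iter false goal ok n) c).1 β hβ
        · have h := D.opt_mono false
            (iter_nonneg (D := D) (mx := false) (goal := goal) (ok := ok) n) c
          rwa [opt_const] at h
      · rfl
  have h0 : D.val false goal ok c = 0 := by
    unfold val
    simp only [fun n => key n c hno, ciSup_const]
  linarith

/-- Suppose that unranked configurations of positive value exist, and let `A` be those of largest
value. Optimal decisions never leave `A`, while the other decisions lose at least some `ε`. Lowering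
the value by `ε` on `A` therefore preserves the optimality inequalities, against the leastness of
the value. -/
theorem exists_ranked_max {c₀ : X} (hc₀ : 0 < D.val true goal ok c₀) :
    ∃ n, D.Ranked true goal ok n c₀ := by
  classical
  by_contra hno
  set w := D.val true goal ok with hw
  -- the unranked configurations of maximal value
  obtain ⟨c₁, hc₁, hmax⟩ := Finset.exists_max_image
    (Finset.univ.filter fun c => ¬ ∃ n, D.Ranked true goal ok n c) w ⟨c₀, by simpa using hno⟩
  rw [Finset.mem_filter] at hc₁
  have hM : 0 < w c₁ := lt_of_lt_of_le hc₀ (hmax c₀ (by simpa using hno))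
  have hmax' : ∀ c, (¬ ∃ n, D.Ranked true goal ok n c) → w c ≤ w c₁ := fun c hc =>
    hmax c (by simpa using hc)
  let A : X → Prop := fun c => (¬ ∃ n, D.Ranked true goal ok n c) ∧ w c = w c₁
  have hA : ∀ c, A c → ¬ goal c ∧ ok c := by
    intro c hc
    have hg : ¬ goal c := fun hg => hc.1 ⟨0, hg⟩
    refine ⟨hg, ?_⟩
    by_contra ho
    have := val_of_not (D := D) (mx := true) hg ho
    have := hc.2
    linarith
  have hstay : ∀ c, A c → ∀ β ∈ D.avail c, w c ≤ D.ex w c β → ∀ c', 0 < D.P c β c' → A c' := by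
    intro c hc β hβ hopt
    have hun : ∀ c', 0 < D.P c β c' → ¬ ∃ n, D.Ranked true goal ok n c' := by
      rintro c' hc' ⟨n, hn⟩
      exact hc.1 ⟨n + 1, Or.inr ⟨(hA c hc).2, β, hβ, hopt, c', hc', hn⟩⟩
    intro c' hc'
    refine ⟨hun c' hc', ?_⟩
    classical
    -- Ranked configurations may have larger values than `w c₁`. Truncating there does not change
    -- the expectation, as no successor is ranked, and makes `w c₁` a global bound, which
    -- `eq_of_ex_ge` requires.
    have hmod : D.ex (fun x => min (w x) (w c₁)) c β = D.ex w c β := by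
      refine Finset.sum_congr rfl fun x _ => ?_
      rcases (D.nonneg c β hβ x).lt_or_eq with h3 | h3
      · simp only [min_eq_left (hmax' x (hun x h3))]
      · rw [← h3, zero_mul, zero_mul]
    have := eq_of_ex_ge (f := fun x => min (w x) (w c₁)) (m := w c₁) (fun x => min_le_right _ _)
      hβ (by rw [hmod, ← hc.2]; exact hopt) hc'
    rwa [min_eq_left (hmax' c' (hun c' hc'))] at this
  -- non-optimal decisions lose at least `ε`
  have hloss : ∃ ε > 0, ε ≤ w c₁ ∧
      ∀ c, A c → ∀ β ∈ D.avail c, D.ex w c β < w c → D.ex w c β ≤ w c - ε := by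
    have hc : ∀ c : X, ∃ ε > 0, ∀ β ∈ D.avail c, D.ex w c β < w c → D.ex w c β ≤ w c - ε := by
      intro c
      classical
      by_cases hne : ((D.avail c).filter fun β => D.ex w c β < w c).Nonempty
      · obtain ⟨β₀, h0, h1⟩ := Finset.exists_max_image _ (D.ex w c) hne
        rw [Finset.mem_filter] at h0
        refine ⟨w c - D.ex w c β₀, by linarith [h0.2], fun β hβ h => ?_⟩
        have := h1 β (by simp [hβ, h])
        linarith
      · refine ⟨1, one_pos, fun β hβ h => ?_⟩
        exact absurd ⟨β, by simp [hβ, h]⟩ hne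
    choose ε hε hε' using hc
    obtain ⟨c₂, -, h2⟩ := Finset.exists_min_image Finset.univ ε ⟨c₁, Finset.mem_univ _⟩
    refine ⟨min (ε c₂) (w c₁), lt_min (hε c₂) hM, min_le_right _ _, fun c _ β hβ h => ?_⟩
    have h3 := hε' c β hβ h
    have h4 := h2 c (Finset.mem_univ _)
    have h5 := min_le_left (ε c₂) (w c₁)
    linarith
  obtain ⟨ε, hε, hεw, hε'⟩ := hloss
  classical
  -- The lowered value; it stays non-negative because `ε ≤ w c₁`.
  let u : X → ℝ := fun c => if A c then w c - ε else w c
  have huw : ∀ c, u c ≤ w c := by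
    intro c; simp only [u]; split_ifs <;> linarith
  have hle := val_le (D := D) (mx := true) (goal := goal) (ok := ok) (u := u) ?_ ?_ ?_ c₁
  · have : A c₁ := ⟨by simpa using hc₁.2, rfl⟩
    simp only [u, if_pos this] at hle
    linarith
  · intro c
    simp only [u]
    split_ifs with h
    · rw [h.2]; linarith
    · exact val_nonneg c
  · intro c hg
    have : ¬ A c := fun h => (hA c h).1 hg
    simp only [u, if_neg this]
    exact (val_of_goal hg).ge
  · intro c hg ho
    have hwc : w c = D.opt true w c := val_of_ok hg ho
    have hwo := D.isOpt_opt true w c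
    rw [← hwc] at hwo
    obtain ⟨β, hβ, e⟩ := (D.isOpt_opt true u c).exists_eq
    rw [← e]
    simp only [u]
    split_ifs with h
    · rcases (hwo.1 β hβ).lt_or_eq with h1 | h1
      · exact (ex_mono huw hβ).trans (hε' c h β hβ h1)
      · have h2 := hstay c h β hβ h1.ge
        have h3 : D.ex u c β = D.ex (fun _ => w c - ε) c β := by
          refine Finset.sum_congr rfl fun x _ => ?_
          rcases (D.nonneg c β hβ x).lt_or_eq with h3 | h3
          · have := h2 x h3
            simp only [u, if_pos this, this.2, h.2]
          · rw [← h3, zero_mul, zero_mul]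
        exact (h3.trans (ex_const _ hβ)).le
    · exact (ex_mono huw hβ).trans (hwo.1 β hβ)

theorem exists_cert : ∃ r, D.Cert mx goal ok (D.val mx goal ok) r := by
  classical
  -- The rank is the least number of stages. The default `0` is harmless: ranks are compared only
  -- where the value is positive or for successors that are themselves ranked.
  refine ⟨fun c => if h : ∃ n, D.Ranked mx goal ok n c then (Nat.find h : ℝ) else 0,
    val_nonneg, fun c => val_of_goal, fun c => val_of_not, fun c hg ho => ?_,
    fun c hg ho hpos => ?_⟩
  · rw [val_of_ok hg ho]; exact D.isOpt_opt mx _ c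
  · have h : ∃ n, D.Ranked mx goal ok n c := by
      cases mx
      · exact exists_ranked_min hpos
      · exact exists_ranked_max hpos
    rw [dif_pos h]
    have h1 := Nat.find_spec h
    cases hn : Nat.find h with
    | zero => rw [hn] at h1; exact absurd h1 hg
    | succ k =>
      rw [hn] at h1
      rcases h1 with h1 | ⟨-, h1⟩
      · exact absurd h1 hg
      · refine h1.mono fun c' hc' => ?_
        have h2 : ∃ n, D.Ranked mx goal ok n c' := ⟨k, hc'⟩
        rw [dif_pos h2]
        have := Nat.find_min' h2 hc'
        exact_mod_cast Nat.lt_succ_of_le this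

/-! ### Decisions that depend on the configuration only -/

/-- The Markov chain that arises when the decisions are fixed. -/
def fix (D : FinMDP X B) (π : X → B) (hπ : ∀ c, π c ∈ D.avail c) : FinMDP X B where
  P := D.P
  avail c := {π c}
  avail_nonempty c := ⟨π c, by simp⟩
  nonneg c β hβ c' := D.nonneg c β (by rw [Finset.mem_singleton.1 hβ]; exact hπ c) c'
  sum_eq_one c β hβ := D.sum_eq_one c β (by rw [Finset.mem_singleton.1 hβ]; exact hπ c)

theorem isOpt_singleton {mx : Bool} {β : B} {f : B → ℝ} {v : ℝ} (h : f β = v) :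
    IsOpt mx {β} f v := by
  cases mx <;> simp [IsOpt, h]

/-- Optimal decisions that depend only on the current configuration. -/
theorem exists_policy : ∃ (π : X → B) (hπ : ∀ c, π c ∈ D.avail c), ∀ mx',
    (if mx then D.val mx goal ok = (D.fix π hπ).val mx' goal ok
      else ∀ c, (D.fix π hπ).val mx' goal ok c ≤ D.val mx goal ok c) := by
  cases mx
  -- For the minimizer any locally optimal choice will do: the value satisfies the inequalities of
  -- the resulting chain, whose value is the least solution.
  · choose π hπ h using fun c => (D.isOpt_opt false (D.val false goal ok) c).exists_eq
    refine ⟨π, hπ, fun mx' => ?_⟩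
    simp only [Bool.false_eq_true, if_false]
    refine val_le val_nonneg (fun c hg => (val_of_goal hg).ge) fun c hg ho => ?_
    rw [val_of_ok hg ho, ← h c]
    exact (((D.fix π hπ).isOpt_opt mx' _ c).unique (isOpt_singleton rfl)).le
  · obtain ⟨r, hr⟩ := D.exists_cert (mx := true) (goal := goal) (ok := ok)
    set w := D.val true goal ok with hw
    have : ∀ c, ∃ β ∈ D.avail c, ¬ goal c → ok c → D.ex w c β = w c ∧
        (0 < w c → ∃ c', 0 < D.P c β c' ∧ r c' < r c) := by
      intro c
      by_cases hg : goal c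
      · obtain ⟨β, hβ⟩ := D.avail_nonempty c
        exact ⟨β, hβ, fun h => absurd hg h⟩
      by_cases ho : ok c
      · by_cases hpos : 0 < w c
        · obtain ⟨β, hβ, h1, h2⟩ := hr.rank c hg ho hpos
          exact ⟨β, hβ, fun _ _ => ⟨le_antisymm ((hr.isOpt c hg ho).1 β hβ) h1, fun _ => h2⟩⟩
        · obtain ⟨β, hβ, h⟩ := (hr.isOpt c hg ho).exists_eq
          exact ⟨β, hβ, fun _ _ => ⟨h, fun h => absurd h hpos⟩⟩
      · obtain ⟨β, hβ⟩ := D.avail_nonempty c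
        exact ⟨β, hβ, fun _ h => absurd h ho⟩
    choose π hπ h using this
    refine ⟨π, hπ, fun mx' => ?_⟩
    simp only [if_true]
    refine Cert.eq_val (r := r) ⟨hr.nonneg, hr.eq_one, hr.eq_zero, fun c hg ho => ?_,
      fun c hg ho hpos => ?_⟩
    · exact isOpt_singleton (h c hg ho).1
    · obtain ⟨h1, h2⟩ := h c hg ho
      obtain ⟨c', h3, h4⟩ := h2 hpos
      cases mx'
      · intro β hβ
        rw [Finset.mem_singleton.1 hβ]
        exact ⟨c', h3, h4⟩
      · exact ⟨π c, Finset.mem_singleton_self _, h1.ge, c', h3, h4⟩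

end FinMDP


/-! ## Trajectories of a process that is controlled step by step -/

section Trajectory

open MeasureTheory ProbabilityTheory Filter

variable {X : Type} [Fintype X] [MeasurableSpace X] [MeasurableSingletonClass X]
  (μ₀ : Measure X) [IsProbabilityMeasure μ₀]
  (κ : (n : ℕ) → Kernel (Finset.Iic n → X) X) [∀ n, IsMarkovKernel (κ n)]

/-- The law of the trajectory with initial distribution `μ₀` and transitions `κ`. -/
noncomputable abbrev trajLaw : Measure (ℕ → X) :=
  Kernel.trajMeasure (X := fun _ => X) μ₀ κ

theorem integral_trajLaw_zero (f : X → ℝ) : ∫ ω, f (ω 0) ∂trajLaw μ₀ κ = ∫ x, f x ∂μ₀ := by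
  have h : (trajLaw μ₀ κ).map (fun ω => ω 0) = μ₀ := by
    have h1 : (trajLaw μ₀ κ).map (Preorder.frestrictLe 0) =
        μ₀.map (MeasurableEquiv.piUnique (fun i : Finset.Iic 0 => X)).symm := by
      rw [trajLaw, Kernel.trajMeasure, Measure.map_comp _ _ (by fun_prop),
        Kernel.traj_map_frestrictLe, Kernel.partialTraj_self, Measure.id_comp]
    have h2 : (fun ω : ℕ → X => ω 0) =
        (fun h : Finset.Iic 0 → X => h ⟨0, by simp⟩) ∘ Preorder.frestrictLe 0 := rfl
    rw [h2, ← Measure.map_map (by fun_prop) (by fun_prop), h1,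
      Measure.map_map (by fun_prop) (by fun_prop)]
    exact Measure.map_id
  conv_rhs => rw [← h]
  rw [integral_map (measurable_pi_apply 0).aemeasurable
    (Integrable.of_finite).aestronglyMeasurable]

/-- The joint law of the history up to time `m` and the next point is the law of the history
composed with `κ m`; integrating out the next point gives the right side. -/
theorem integral_trajLaw_succ (m : ℕ) (g : (Finset.Iic m → X) → ℝ) (f : X → ℝ) :
    ∫ ω, g (Preorder.frestrictLe m ω) * f (ω (m + 1)) ∂trajLaw μ₀ κ =
      ∫ ω, g (Preorder.frestrictLe m ω) * ∫ x, f x ∂κ m (Preorder.frestrictLe m ω)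
        ∂trajLaw μ₀ κ := by
  have h := Kernel.map_frestrictLe_trajMeasure_compProd_eq_map_trajMeasure
    (X := fun _ => X) (μ₀ := μ₀) (κ := κ) (a := m)
  have hp : IsProbabilityMeasure ((trajLaw μ₀ κ).map (Preorder.frestrictLe m)) :=
    Measure.isProbabilityMeasure_map (by fun_prop)
  have h1 : ∫ ω, g (Preorder.frestrictLe m ω) * f (ω (m + 1)) ∂trajLaw μ₀ κ =
      ∫ x, g x.1 * f x.2 ∂((trajLaw μ₀ κ).map
        (fun x => (Preorder.frestrictLe m x, x (m + 1)))) := by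
    rw [integral_map (by fun_prop) (Integrable.of_finite).aestronglyMeasurable]
  rw [h1, ← h, Measure.integral_compProd Integrable.of_finite]
  rw [integral_map (by fun_prop) (Integrable.of_finite).aestronglyMeasurable]
  simp only [integral_const_mul]

/-! ### Reaching a goal within finitely many steps -/

variable (goal ok : X → Prop)

open Classical in
/-- The indicator of the trajectories that have reached `goal` through `ok` before time `m`. -/
noncomputable def reached (m : ℕ) (ω : ℕ → X) : ℝ :=
  if ∃ k < m, goal (ω k) ∧ ∀ j < k, ok (ω j) then 1 else 0

open Classical in
/-- The indicator of the trajectories that are undecided before time `m`. -/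
noncomputable def alive (m : ℕ) (ω : ℕ → X) : ℝ :=
  if ∀ j < m, ok (ω j) ∧ ¬ goal (ω j) then 1 else 0

-- A trajectory that is undecided before time `m` is decided by its point at time `m` exactly as
-- `absorb` does, or stays undecided and is worth `v`. This ties the indicators to one round of
-- value iteration.
omit [Fintype X] [MeasurableSpace X] [MeasurableSingletonClass X] in
theorem reached_succ (m : ℕ) (ω : ℕ → X) (v : ℝ) :
    reached goal ok (m + 1) ω + alive goal ok (m + 1) ω * v =
      reached goal ok m ω + alive goal ok m ω * FinMDP.absorb goal ok (ω m) v := by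
  classical
  by_cases hr : ∃ k < m, goal (ω k) ∧ ∀ j < k, ok (ω j)
  · have hr' : ∃ k < m + 1, goal (ω k) ∧ ∀ j < k, ok (ω j) := by
      obtain ⟨k, hk, h⟩ := hr; exact ⟨k, by omega, h⟩
    have ha : ¬ ∀ j < m, ok (ω j) ∧ ¬ goal (ω j) := by
      obtain ⟨k, hk, h, -⟩ := hr; exact fun h' => (h' k hk).2 h
    have ha' : ¬ ∀ j < m + 1, ok (ω j) ∧ ¬ goal (ω j) := fun h => ha fun j hj => h j (by omega)
    simp only [reached, alive, if_pos hr, if_pos hr', if_neg ha, if_neg ha']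
    simp
  by_cases ha : ∀ j < m, ok (ω j) ∧ ¬ goal (ω j)
  · by_cases hg : goal (ω m)
    · have hr' : ∃ k < m + 1, goal (ω k) ∧ ∀ j < k, ok (ω j) :=
        ⟨m, by omega, hg, fun j hj => (ha j hj).1⟩
      have ha' : ¬ ∀ j < m + 1, ok (ω j) ∧ ¬ goal (ω j) := fun h => (h m (by omega)).2 hg
      simp only [reached, alive, if_neg hr, if_pos hr', if_pos ha, if_neg ha', FinMDP.absorb]
      simp [hg]
    · have hr' : ¬ ∃ k < m + 1, goal (ω k) ∧ ∀ j < k, ok (ω j) := by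
        rintro ⟨k, hk, h1, h2⟩
        rcases Nat.lt_succ_iff_lt_or_eq.1 hk with h | rfl
        · exact hr ⟨k, h, h1, h2⟩
        · exact hg h1
      by_cases ho : ok (ω m)
      · have ha' : ∀ j < m + 1, ok (ω j) ∧ ¬ goal (ω j) := by
          intro j hj
          rcases Nat.lt_succ_iff_lt_or_eq.1 hj with h | rfl
          · exact ha j h
          · exact ⟨ho, hg⟩
        simp only [reached, alive, if_neg hr, if_neg hr', if_pos ha, if_pos ha', FinMDP.absorb]
        simp [hg, ho]
      · have ha' : ¬ ∀ j < m + 1, ok (ω j) ∧ ¬ goal (ω j) := fun h => ho (h m (by omega)).1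
        simp only [reached, alive, if_neg hr, if_neg hr', if_pos ha, if_neg ha', FinMDP.absorb]
        simp [hg, ho]
  · have ha' : ¬ ∀ j < m + 1, ok (ω j) ∧ ¬ goal (ω j) := fun h => ha fun j hj => h j (by omega)
    have hr' : ¬ ∃ k < m + 1, goal (ω k) ∧ ∀ j < k, ok (ω j) := by
      rintro ⟨k, hk, h1, h2⟩
      rcases Nat.lt_succ_iff_lt_or_eq.1 hk with h | rfl
      · exact hr ⟨k, h, h1, h2⟩
      · push Not at ha
        have hex : ∃ j, j < k ∧ goal (ω j) := by
          obtain ⟨j, hj, h3⟩ := ha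
          exact ⟨j, hj, h3 (h2 j hj)⟩
        obtain ⟨j, hj, h3⟩ := hex
        exact hr ⟨j, hj, h3, fun i hi => h2 i (hi.trans hj)⟩
    simp only [reached, alive, if_neg hr, if_neg hr', if_neg ha, if_neg ha']
    simp

/-- The set of the trajectories that satisfy `ok` until `goal`. -/
def untilSet : Set (ℕ → X) := {ω | ∃ k, goal (ω k) ∧ ∀ j < k, ok (ω j)}

/-- There are finitely many histories of a given length, so every function of them is bounded and
measurable. -/
theorem integrable_of_bounded {ν : Measure (ℕ → X)} [IsFiniteMeasure ν] (n : ℕ)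
    (F : (Finset.Iic n → X) → ℝ) : Integrable (fun ω => F (Preorder.frestrictLe n ω)) ν := by
  refine Integrable.of_bound
    ((Measurable.of_discrete (f := F)).comp (by fun_prop)).aestronglyMeasurable
    (∑ h, ‖F h‖) (ae_of_all _ fun ω => ?_)
  exact Finset.single_le_sum (f := fun h => ‖F h‖) (fun _ _ => norm_nonneg _) (Finset.mem_univ _)

theorem tendsto_integral_reached (ν : Measure (ℕ → X)) [IsProbabilityMeasure ν] :
    Tendsto (fun m => ∫ ω, reached goal ok m ω ∂ν) atTop (nhds (ν.real (untilSet goal ok))) := by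
  classical
  have hset : ∀ m, MeasurableSet {ω : ℕ → X | ∃ k < m, goal (ω k) ∧ ∀ j < k, ok (ω j)} := by
    intro m; measurability
  have h1 : ∀ m, ∫ ω, reached goal ok m ω ∂ν =
      ν.real {ω : ℕ → X | ∃ k < m, goal (ω k) ∧ ∀ j < k, ok (ω j)} := by
    intro m
    rw [← integral_indicator_one (hset m)]
    refine integral_congr_ae (ae_of_all _ fun ω => ?_)
    simp [Set.indicator, reached]
  have h2 : untilSet goal ok =
      ⋃ m, {ω : ℕ → X | ∃ k < m, goal (ω k) ∧ ∀ j < k, ok (ω j)} := by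
    ext ω
    simp only [untilSet, Set.mem_ofPred_eq, Set.mem_iUnion]
    exact ⟨fun ⟨k, h⟩ => ⟨k + 1, k, by omega, h⟩, fun ⟨m, k, _, h⟩ => ⟨k, h⟩⟩
  simp only [h1, h2, Measure.real]
  refine (ENNReal.tendsto_toReal (measure_ne_top _ _)).comp
    (tendsto_measure_iUnion_atTop ?_)
  intro m n hmn ω ⟨k, hk, h⟩
  exact ⟨k, hk.trans_le hmn, h⟩

variable {μ₀ κ} {B : Type} {D : FinMDP X B} {mx : Bool} {s : ℝ}

/-- Backward induction: the last step is replaced by an optimal one, which turns iterate `k` into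
iterate `k + 1`. Iterate `k` inspects the `k + 1` points at times `m` to `m + k`, hence the index `m
+ k + 1`. The factor `s` treats maximization and minimization at once. -/
theorem mul_integral_reached_le
    (H : ∀ n (h : Finset.Iic n → X) (f : X → ℝ), s * ∫ x, f x ∂κ n h ≤
      s * D.opt mx f (h ⟨n, Finset.mem_Iic.2 le_rfl⟩)) (k : ℕ) : ∀ m,
    s * ∫ ω, reached goal ok (m + k + 1) ω ∂trajLaw μ₀ κ ≤
      s * ∫ ω, (reached goal ok m ω + alive goal ok m ω * D.iter mx goal ok k (ω m))
        ∂trajLaw μ₀ κ := by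
  induction k with
  | zero =>
    intro m
    have : ∀ ω, reached goal ok (m + 0 + 1) ω =
        reached goal ok m ω + alive goal ok m ω * D.iter mx goal ok 0 (ω m) := by
      intro ω
      rw [FinMDP.iter, ← reached_succ]
      simp
    simp only [this]; exact le_rfl
  | succ k ih =>
    intro m
    have h1 := ih (m + 1)
    rw [show m + (k + 1) + 1 = m + 1 + k + 1 by ring]
    refine h1.trans ?_
    simp only [FinMDP.iter, ← reached_succ goal ok m]
    classical
    -- The indicators rewritten as functions of the history up to time `m`, as needed for
    -- conditioning on it.
    let R : (Finset.Iic m → X) → ℝ := fun h =>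
      if ∃ k, ∃ hk : k < m + 1, goal (h ⟨k, by simp; omega⟩) ∧
        ∀ j, ∀ hj : j < k, ok (h ⟨j, by simp; omega⟩) then 1 else 0
    let A : (Finset.Iic m → X) → ℝ := fun h =>
      if ∀ j, ∀ hj : j < m + 1, ok (h ⟨j, by simp; omega⟩) ∧ ¬ goal (h ⟨j, by simp; omega⟩)
        then 1 else 0
    have hR : ∀ ω, reached goal ok (m + 1) ω = R (Preorder.frestrictLe m ω) := by
      intro ω
      simp only [reached, R, Preorder.frestrictLe_apply, exists_prop]
    have hA : ∀ ω, alive goal ok (m + 1) ω = A (Preorder.frestrictLe m ω) := by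
      intro ω
      simp only [alive, A, Preorder.frestrictLe_apply]
      congr
    have hA0 : ∀ h, 0 ≤ A h := by intro h; simp only [A]; split_ifs <;> simp
    simp only [hR, hA]
    have i1 := integrable_of_bounded (ν := trajLaw μ₀ κ) m R
    have i2 : Integrable (fun ω => A (Preorder.frestrictLe m ω) *
        D.iter mx goal ok k (ω (m + 1))) (trajLaw μ₀ κ) :=
      integrable_of_bounded (m + 1) fun h =>
        A (fun i => h ⟨i.1, by have := Finset.mem_Iic.1 i.2; simp; omega⟩) *
          D.iter mx goal ok k (h ⟨m + 1, by simp⟩)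
    have i3 : Integrable (fun ω => A (Preorder.frestrictLe m ω) *
        ∫ x, D.iter mx goal ok k x ∂κ m (Preorder.frestrictLe m ω)) (trajLaw μ₀ κ) :=
      integrable_of_bounded m fun h => A h * ∫ x, D.iter mx goal ok k x ∂κ m h
    have i4 : Integrable (fun ω => A (Preorder.frestrictLe m ω) *
        D.opt mx (D.iter mx goal ok k) (ω m)) (trajLaw μ₀ κ) :=
      integrable_of_bounded m fun h => A h *
        D.opt mx (D.iter mx goal ok k) (h ⟨m, by simp⟩)
    rw [integral_add i1 i2, integral_add i1 i4, integral_trajLaw_succ, mul_add, mul_add]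
    refine add_le_add le_rfl ?_
    rw [← integral_const_mul, ← integral_const_mul]
    refine integral_mono (i3.const_mul s) (i4.const_mul s) fun ω => ?_
    have := mul_le_mul_of_nonneg_left (H m (Preorder.frestrictLe m ω) (D.iter mx goal ok k))
      (hA0 (Preorder.frestrictLe m ω))
    simp only [Preorder.frestrictLe_apply] at this
    simp only
    linarith

/-- If every step is at most as good as an optimal step, then the probability of reaching `goal` is
at most the value (`s = 1`); similarly with the reversed inequalities (`s = -1`). -/
theorem mul_prob_until_le
    (H : ∀ n (h : Finset.Iic n → X) (f : X → ℝ), s * ∫ x, f x ∂κ n h ≤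
      s * D.opt mx f (h ⟨n, Finset.mem_Iic.2 le_rfl⟩)) :
    s * (trajLaw μ₀ κ).real (untilSet goal ok) ≤ s * ∫ x, D.val mx goal ok x ∂μ₀ := by
  have h1 := ((tendsto_integral_reached goal ok (trajLaw μ₀ κ)).const_mul s).comp
    (tendsto_add_atTop_nat 1)
  have h2 : Tendsto (fun n => s * ∫ x, D.iter mx goal ok n x ∂μ₀) atTop
      (nhds (s * ∫ x, D.val mx goal ok x ∂μ₀)) := by
    refine Tendsto.const_mul s ?_
    simp only [integral_fintype Integrable.of_finite, smul_eq_mul]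
    exact tendsto_finsetSum _ fun c _ => (FinMDP.tendsto_iter c).const_mul _
  refine le_of_tendsto_of_tendsto' h1 h2 fun n => ?_
  have h3 := mul_integral_reached_le (μ₀ := μ₀) goal ok H n 0
  rw [← integral_trajLaw_zero μ₀ κ]
  rw [zero_add] at h3
  simpa [reached, alive] using h3

theorem mul_prob_next_le {E : X → Prop} [DecidablePred E]
    (H : ∀ n (h : Finset.Iic n → X) (f : X → ℝ), s * ∫ x, f x ∂κ n h ≤
      s * D.opt mx f (h ⟨n, Finset.mem_Iic.2 le_rfl⟩)) :
    s * (trajLaw μ₀ κ).real {ω | E (ω 1)} ≤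
      s * ∫ x, D.opt mx (fun c => if E c then 1 else 0) x ∂μ₀ := by
  have hset : MeasurableSet {ω : ℕ → X | E (ω 1)} := by measurability
  have h1 : (trajLaw μ₀ κ).real {ω | E (ω 1)} =
      ∫ ω, (if E (ω 1) then 1 else 0) ∂trajLaw μ₀ κ := by
    rw [← integral_indicator_one hset]
    refine integral_congr_ae (ae_of_all _ fun ω => ?_)
    simp [Set.indicator]
  have h2 := integral_trajLaw_succ μ₀ κ 0 (fun _ => 1) (fun c => if E c then 1 else 0)
  simp only [one_mul, zero_add] at h2
  rw [h1, h2, ← integral_trajLaw_zero μ₀ κ, ← integral_const_mul, ← integral_const_mul]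
  refine integral_mono ((integrable_of_bounded 0 fun h => ∫ x, (if E x then 1 else 0) ∂κ 0 h)
    |>.const_mul s) ((integrable_of_bounded 0 fun h =>
      D.opt mx (fun c => if E c then 1 else 0) (h ⟨0, by simp⟩)).const_mul s) fun ω => ?_
  exact H 0 (Preorder.frestrictLe 0 ω) _

end Trajectory


/-! ## The decision process that the coalition leaves to its opponents -/

section Opponents

open MeasureTheory ProbabilityTheory

variable {nAg nAct nAP : ℕ} (M : StochSystem nAg nAct nAP) {C : Finset (Fin nAg)} {b : ℕ}
  (σ : CoalitionStrategy M.toFrame C b)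

/-- The probability that agent `a` plays `y` at `c` when the opponents have chosen `β`. -/
noncomputable def playProb {F : Frame nAg nAct nAP} (σ : CoalitionStrategy F C b)
    (c : Conf F C b) (β : Fin nAg → Fin nAct) (a : Fin nAg) (y : Fin nAct) : ℝ :=
  if ha : a ∈ C then (σ ⟨a, ha⟩).act (c.2 ⟨a, ha⟩) (F.obs a c.1) y
  else if y = β a then 1 else 0

/-- The transition probabilities when the opponents have chosen `β`. -/
noncomputable def moveProb (c : Conf M.toFrame C b) (β : Fin nAg → Fin nAct)
    (c' : Conf M.toFrame C b) : ℝ :=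
  (∑ α : Fin nAg → Fin nAct, (∏ a, playProb σ c β a (α a)) * M.trans c.1 α c'.1) *
    modeDist σ c c'.2

/-- The distribution that is concentrated at a point. -/
def pointDist {α : Type} [Fintype α] [DecidableEq α] (x : α) : stdSimplex ℝ α :=
  ⟨Pi.single x 1, single_mem_stdSimplex ℝ x⟩

theorem pointDist_apply {α : Type} [Fintype α] [DecidableEq α] (x y : α) :
    pointDist x y = if y = x then 1 else 0 := by
  change (Pi.single x 1 : α → ℝ) y = _
  rw [Pi.single_apply]

/-- The opponents' strategy that depends only on the current configuration. -/
def pureOpponent {F : Frame nAg nAct nAP} (π : Conf F C b → Fin nAg → Fin nAct)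
    (hπ : ∀ c, F.LegalProfile c.1 (π c)) : OpponentStrategy F C b := fun a =>
  { act := fun _ h => pointDist (π h.last a)
    act_legal := fun _ h α hα => by
      rw [pointDist_apply, if_neg]
      rintro rfl
      exact hα (hπ _ _) }

/-- The probability of the configuration that follows a history. -/
noncomputable def stepProb (μ : OpponentStrategy M.toFrame C b) {n : ℕ}
    (h : Hist M.toFrame C b n) (c' : Conf M.toFrame C b) : ℝ :=
  stateDist M σ μ h c'.1 * modeDist σ h.last c'.2

theorem stateDist_apply (μ : OpponentStrategy M.toFrame C b) {n : ℕ}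
    (h : Hist M.toFrame C b n) (s' : Fin M.nS) : stateDist M σ μ h s' =
      ∑ α : Fin nAg → Fin nAct, (∏ a, actionDist σ μ h a (α a)) * M.trans h.last.1 α s' := rfl

theorem stepProb_pure (π : Conf M.toFrame C b → Fin nAg → Fin nAct)
    (hπ : ∀ c, M.toFrame.LegalProfile c.1 (π c)) {n : ℕ} (h : Hist M.toFrame C b n)
    (c' : Conf M.toFrame C b) :
    stepProb M σ (pureOpponent π hπ) h c' = moveProb M σ h.last (π h.last) c' := by
  unfold stepProb moveProb
  congr 1
  rw [stateDist_apply]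
  refine Finset.sum_congr rfl fun α _ => ?_
  congr 1
  refine Finset.prod_congr rfl fun a _ => ?_
  unfold actionDist playProb
  split_ifs with h1 h2
  · rfl
  · simp [pureOpponent, pointDist_apply, h2]
  · simp [pureOpponent, pointDist_apply, h2]

theorem stepProb_nonneg (μ : OpponentStrategy M.toFrame C b) {n : ℕ}
    (h : Hist M.toFrame C b n) (c' : Conf M.toFrame C b) : 0 ≤ stepProb M σ μ h c' :=
  mul_nonneg ((stateDist M σ μ h).2.1 _) ((modeDist σ h.last).2.1 _)

theorem sum_stepProb (μ : OpponentStrategy M.toFrame C b) {n : ℕ}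
    (h : Hist M.toFrame C b n) : ∑ c', stepProb M σ μ h c' = 1 := by
  unfold stepProb
  rw [Fintype.sum_prod_type]
  simp only [← Finset.mul_sum]
  have h1 : ∑ q, modeDist σ h.last q = 1 := (modeDist σ h.last).2.2
  have h2 : ∑ s', stateDist M σ μ h s' = 1 := (stateDist M σ μ h).2.2
  simp only [h1, mul_one, h2]

/-- Every available move is a step of actual strategies after a suitable history. So the moves are
probability distributions because the steps are, which saves a second verification. -/
theorem exists_pure (c : Conf M.toFrame C b) (β : Fin nAg → Fin nAct)
    (hβ : M.toFrame.LegalProfile c.1 β) :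
    ∃ (μ : OpponentStrategy M.toFrame C b) (h : Hist M.toFrame C b 0),
      ∀ c', moveProb M σ c β c' = stepProb M σ μ h c' := by
  classical
  choose β₀ hβ₀ using M.legal_nonempty
  let π : Conf M.toFrame C b → Fin nAg → Fin nAct := fun c' => if c' = c then β else β₀ c'.1
  have hπ : ∀ c', M.toFrame.LegalProfile c'.1 (π c') := by
    intro c'
    simp only [π]
    split_ifs with h
    · rw [h]; exact hβ
    · exact fun a => hβ₀ _ a
  refine ⟨pureOpponent π hπ, fun _ => c, fun c' => ?_⟩
  rw [stepProb_pure]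
  simp [Hist.last, π]

open Classical in
/-- The decision process of the opponents. -/
noncomputable def opponentMDP : FinMDP (Conf M.toFrame C b) (Fin nAg → Fin nAct) where
  P := moveProb M σ
  -- A decision names an action for every agent, but `playProb` ignores the entries of the
  -- coalition; they only produce several names for the same move.
  avail c := Finset.univ.filter (M.toFrame.LegalProfile c.1)
  avail_nonempty c := by
    choose β hβ using M.legal_nonempty c.1
    exact ⟨β, by simpa [Frame.LegalProfile] using hβ⟩
  nonneg c β hβ c' := by
    obtain ⟨μ, h, e⟩ := exists_pure M σ c β (by simpa using hβ)
    rw [e]; exact stepProb_nonneg M σ μ h c'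
  sum_eq_one c β hβ := by
    obtain ⟨μ, h, e⟩ := exists_pure M σ c β (by simpa using hβ)
    simp only [e]; exact sum_stepProb M σ μ h

theorem mem_opponentMDP_avail (c : Conf M.toFrame C b) (β : Fin nAg → Fin nAct) :
    β ∈ (opponentMDP M σ).avail c ↔ M.toFrame.LegalProfile c.1 β := by
  simp [opponentMDP]

/-- Every step is a mixture of the moves of the decision process. -/
theorem stepProb_eq_sum (μ : OpponentStrategy M.toFrame C b) {n : ℕ}
    (h : Hist M.toFrame C b n) (c' : Conf M.toFrame C b) :
    stepProb M σ μ h c' =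
      ∑ β, prodDist (actionDist σ μ h) β * moveProb M σ h.last β c' := by
  have key : ∀ α : Fin nAg → Fin nAct, ∏ a, actionDist σ μ h a (α a) =
      ∑ β : Fin nAg → Fin nAct, (∏ a, actionDist σ μ h a (β a)) *
        ∏ a, playProb σ h.last β a (α a) := by
    intro α
    -- An outsider's action is first drawn and then played for sure. For a member of the coalition
    -- the drawn action is irrelevant, and its probabilities sum to one. Expanding the product of
    -- these sums gives the sum over `β`.
    have e : ∀ a, actionDist σ μ h a (α a) = ∑ x, actionDist σ μ h a x *
        (if ha : a ∈ C then (σ ⟨a, ha⟩).act (h.last.2 ⟨a, ha⟩) (M.obs a h.last.1) (α a)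
          else if α a = x then 1 else 0) := by
      intro a
      by_cases ha : a ∈ C
      · simp only [dif_pos ha, ← Finset.sum_mul]
        have h1 : ∑ x, actionDist σ μ h a x = 1 := (actionDist σ μ h a).2.2
        rw [h1, one_mul]
        simp [actionDist, ha]
      · simp [dif_neg ha]
    simp only [e]
    rw [Finset.prod_univ_sum, Fintype.piFinset_univ]
    refine Finset.sum_congr rfl fun β _ => ?_
    rw [Finset.prod_mul_distrib]
    rfl
  have e2 : ∀ β, prodDist (actionDist σ μ h) β = ∏ a, actionDist σ μ h a (β a) := fun _ => rfl
  unfold stepProb moveProb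
  rw [stateDist_apply]
  simp only [e2, ← mul_assoc]
  rw [← Finset.sum_mul]
  congr 1
  rw [Finset.sum_congr rfl fun α _ => congrArg (· * _) (key α)]
  simp only [Finset.mul_sum, Finset.sum_mul]
  rw [Finset.sum_comm]
  simp only [mul_assoc]

theorem sum_stepProb_mul (μ : OpponentStrategy M.toFrame C b) {n : ℕ}
    (h : Hist M.toFrame C b n) (f : Conf M.toFrame C b → ℝ) :
    ∑ c', stepProb M σ μ h c' * f c' =
      ∑ β, prodDist (actionDist σ μ h) β * (opponentMDP M σ).ex f h.last β := by
  simp only [stepProb_eq_sum, Finset.sum_mul, FinMDP.ex, Finset.mul_sum]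
  rw [Finset.sum_comm]
  simp only [mul_assoc]
  rfl

/-- `1` for maximization, `-1` for minimization. -/
def optSign (mx : Bool) : ℝ := if mx then 1 else -1

theorem sign_mul_le_opt {X B : Type} [Fintype X] (D : FinMDP X B) (mx : Bool) (f : X → ℝ) (c : X)
    {β : B} (hβ : β ∈ D.avail c) : optSign mx * D.ex f c β ≤ optSign mx * D.opt mx f c := by
  have h := D.isOpt_opt mx f c
  cases mx
  · simpa [optSign] using h.1 β hβ
  · simpa [optSign] using h.1 β hβ

/-- A step averages over the drawn profiles. Legal ones are at most as good as the optimum, and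
illegal ones have weight zero. -/
theorem sign_mul_sum_le (μ : OpponentStrategy M.toFrame C b) {n : ℕ} (mx : Bool)
    (h : Hist M.toFrame C b n) (f : Conf M.toFrame C b → ℝ) :
    optSign mx * ∑ c', stepProb M σ μ h c' * f c' ≤
      optSign mx * (opponentMDP M σ).opt mx f h.last := by
  rw [sum_stepProb_mul, Finset.mul_sum]
  set O := (opponentMDP M σ).opt mx f h.last
  have h1 : ∑ β, prodDist (actionDist σ μ h) β = 1 := (prodDist (actionDist σ μ h)).2.2
  have h2 : optSign mx * O = ∑ β, prodDist (actionDist σ μ h) β * (optSign mx * O) := by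
    rw [← Finset.sum_mul, h1, one_mul]
  rw [h2]
  refine Finset.sum_le_sum fun β _ => ?_
  by_cases hβ : M.toFrame.LegalProfile h.last.1 β
  · have h3 := sign_mul_le_opt (opponentMDP M σ) mx f h.last
      ((mem_opponentMDP_avail M σ h.last β).2 hβ)
    have h4 := mul_le_mul_of_nonneg_left h3 ((prodDist (actionDist σ μ h)).2.1 β)
    calc _ = prodDist (actionDist σ μ h) β *
          (optSign mx * (opponentMDP M σ).ex f h.last β) := by ring
      _ ≤ _ := h4
  · have : prodDist (actionDist σ μ h) β = 0 := by
      simp only [Frame.LegalProfile, not_forall] at hβ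
      obtain ⟨a, ha⟩ := hβ
      exact Finset.prod_eq_zero (Finset.mem_univ a) (actionDist_eq_zero σ μ h a _ ha)
    rw [this]; simp

theorem distMeasure_real_singleton {α : Type} [Fintype α] [MeasurableSpace α]
    [MeasurableSingletonClass α] (w : stdSimplex ℝ α) (x : α) :
    (distMeasure w).real {x} = w x := by
  classical
  rw [Measure.real, distMeasure]
  simp only [Measure.coe_finsetSum, Finset.sum_apply, Measure.smul_apply, smul_eq_mul]
  rw [Finset.sum_eq_single x]
  · simp
  · intro y _ hy
    simp [hy]
  · simp

theorem integral_stepKernel (μ : OpponentStrategy M.toFrame C b) (n : ℕ)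
    (h : Hist M.toFrame C b n) (f : Conf M.toFrame C b → ℝ) :
    ∫ c, f c ∂stepKernel M σ μ n h = ∑ c', stepProb M σ μ h c' * f c' := by
  rw [integral_fintype Integrable.of_finite]
  refine Finset.sum_congr rfl fun c' _ => ?_
  rw [smul_eq_mul]
  congr 1
  change ((distMeasure (stateDist M σ μ h)).prod (distMeasure (modeDist σ h.last))).real {c'} = _
  have : ({c'} : Set (Conf M.toFrame C b)) = {c'.1} ×ˢ {c'.2} := by simp
  rw [this, measureReal_prod_prod, distMeasure_real_singleton, distMeasure_real_singleton]
  rfl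

theorem integral_start (s : Fin M.nS) (f : Conf M.toFrame C b → ℝ) :
    ∫ c, f c ∂((Measure.dirac s).prod (distMeasure (startDist σ s))) =
      ∑ q, startDist σ s q * f (s, q) := by
  rw [Measure.dirac_prod, integral_map (by fun_prop) (Integrable.of_finite).aestronglyMeasurable,
    integral_fintype Integrable.of_finite]
  simp only [distMeasure_real_singleton, smul_eq_mul]

/-- The worst case over the opponents, as a real number, determines what all opponents allow. -/
theorem forall_rel_iff {ι : Type} (r : Cmp) (d v : ℝ) (p : ι → ℝ) (mx : Bool)
    (hr : mx = match r with | .le => true | .lt => true | .gt => false | .ge => false)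
    (hle : ∀ μ, optSign mx * p μ ≤ optSign mx * v)
    (hex : ∃ μ, p μ = v) : (∀ μ, r.Rel (p μ) d) ↔ r.Rel v d := by
  obtain ⟨μ₀, h0⟩ := hex
  constructor
  · intro h; rw [← h0]; exact h μ₀
  · intro h μ
    have := hle μ
    cases r <;> simp [optSign, hr] at this <;> simp only [Cmp.Rel] at * <;> linarith

/-! ### The worst case over all opponents -/

variable (goal ok : Fin M.nS → Prop)

theorem prob_until_le (μ : OpponentStrategy M.toFrame C b) (s : Fin M.nS) (mx : Bool) :
    optSign mx * (outcome M σ μ s).real (untilSet (fun c => goal c.1) (fun c => ok c.1)) ≤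
      optSign mx * ∑ q, startDist σ s q *
        (opponentMDP M σ).val mx (fun c => goal c.1) (fun c => ok c.1) (s, q) := by
  rw [← integral_start M σ s ((opponentMDP M σ).val mx _ _)]
  refine mul_prob_until_le _ _ fun n h f => ?_
  rw [integral_stepKernel]
  exact sign_mul_sum_le M σ μ mx h f

theorem prob_next_le (μ : OpponentStrategy M.toFrame C b) (s : Fin M.nS) (mx : Bool)
    (E : Conf M.toFrame C b → Prop) [DecidablePred E] :
    optSign mx * (outcome M σ μ s).real {ω | E (ω 1)} ≤
      optSign mx * ∑ q, startDist σ s q *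
        (opponentMDP M σ).opt mx (fun c => if E c then 1 else 0) (s, q) := by
  rw [← integral_start M σ s ((opponentMDP M σ).opt mx _)]
  refine mul_prob_next_le fun n h f => ?_
  rw [integral_stepKernel]
  exact sign_mul_sum_le M σ μ mx h f

theorem fix_opt_eq {X B : Type} [Fintype X] (D : FinMDP X B) (π : X → B)
    (hπ : ∀ c, π c ∈ D.avail c) (mx : Bool) (f : X → ℝ) (c : X) :
    (D.fix π hπ).opt mx f c = D.ex f c (π c) :=
  ((D.fix π hπ).isOpt_opt mx f c).unique (FinMDP.isOpt_singleton rfl)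

theorem integral_stepKernel_pure (π : Conf M.toFrame C b → Fin nAg → Fin nAct)
    (hπ : ∀ c, π c ∈ (opponentMDP M σ).avail c) (mx : Bool) (n : ℕ) (h : Hist M.toFrame C b n)
    (f : Conf M.toFrame C b → ℝ) :
    ∫ c, f c ∂stepKernel M σ
      (pureOpponent π fun c => (mem_opponentMDP_avail M σ c _).1 (hπ c)) n h =
      ((opponentMDP M σ).fix π hπ).opt mx f h.last := by
  rw [integral_stepKernel, fix_opt_eq]
  simp only [stepProb_pure]
  rfl

/-- The opponents follow an optimal memoryless policy. The general bound, applied to the chain of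
this policy with both signs `1` and `-1`, becomes an equality, so the probability is the value of
the chain. For minimization the policy only yields one inequality, and `prob_until_le` gives the
other. -/
theorem exists_prob_until_eq (s : Fin M.nS) (mx : Bool) : ∃ μ : OpponentStrategy M.toFrame C b,
    (outcome M σ μ s).real (untilSet (fun c => goal c.1) (fun c => ok c.1)) =
      ∑ q, startDist σ s q *
        (opponentMDP M σ).val mx (fun c => goal c.1) (fun c => ok c.1) (s, q) := by
  obtain ⟨π, hπ, h⟩ := (opponentMDP M σ).exists_policy (mx := mx)
    (goal := fun c : Conf M.toFrame C b => goal c.1) (ok := fun c => ok c.1)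
  refine ⟨pureOpponent π fun c => (mem_opponentMDP_avail M σ c _).1 (hπ c), ?_⟩
  have hb := prob_until_le M σ goal ok
    (pureOpponent π fun c => (mem_opponentMDP_avail M σ c _).1 (hπ c)) s mx
  have hc : ∀ t : ℝ, t * (outcome M σ (pureOpponent π fun c =>
        (mem_opponentMDP_avail M σ c _).1 (hπ c)) s).real
        (untilSet (fun c => goal c.1) (fun c => ok c.1)) ≤
      t * ∑ q, startDist σ s q * ((opponentMDP M σ).fix π hπ).val mx
        (fun c => goal c.1) (fun c => ok c.1) (s, q) := by
    intro t
    rw [← integral_start M σ s (((opponentMDP M σ).fix π hπ).val mx _ _)]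
    refine mul_prob_until_le _ _ fun n h f => ?_
    rw [integral_stepKernel_pure M σ π hπ mx]
    exact le_rfl
  have h1 := hc 1
  have h2 := hc (-1)
  have h3 := h mx
  cases mx
  · simp only [Bool.false_eq_true, if_false, optSign] at h3 hb
    have h4 : ∑ q, startDist σ s q * ((opponentMDP M σ).fix π hπ).val false
        (fun c => goal c.1) (fun c => ok c.1) (s, q) ≤ ∑ q, startDist σ s q *
        (opponentMDP M σ).val false (fun c => goal c.1) (fun c => ok c.1) (s, q) :=
      Finset.sum_le_sum fun q _ => mul_le_mul_of_nonneg_left (h3 _) ((startDist σ s).2.1 q)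
    linarith
  · simp only [if_true] at h3
    rw [h3]
    linarith

theorem exists_prob_next_eq (s : Fin M.nS) (mx : Bool) (E : Conf M.toFrame C b → Prop)
    [DecidablePred E] : ∃ μ : OpponentStrategy M.toFrame C b,
    (outcome M σ μ s).real {ω | E (ω 1)} = ∑ q, startDist σ s q *
      (opponentMDP M σ).opt mx (fun c => if E c then 1 else 0) (s, q) := by
  choose π hπ h using fun c =>
    ((opponentMDP M σ).isOpt_opt mx (fun c => if E c then 1 else 0) c).exists_eq
  refine ⟨pureOpponent π fun c => (mem_opponentMDP_avail M σ c _).1 (hπ c), ?_⟩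
  have hc : ∀ t : ℝ, t * (outcome M σ (pureOpponent π fun c =>
        (mem_opponentMDP_avail M σ c _).1 (hπ c)) s).real {ω | E (ω 1)} ≤
      t * ∑ q, startDist σ s q * ((opponentMDP M σ).fix π hπ).opt mx
        (fun c => if E c then 1 else 0) (s, q) := by
    intro t
    rw [← integral_start M σ s (((opponentMDP M σ).fix π hπ).opt mx _)]
    refine mul_prob_next_le fun n h f => ?_
    rw [integral_stepKernel_pure M σ π hπ mx]
    exact le_rfl
  simp only [fix_opt_eq, h] at hc
  have h1 := hc 1
  have h2 := hc (-1)
  linarith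

/-- Whether upper (`true`) or lower (`false`) bounds are claimed. -/
def Cmp.isUpper : Cmp → Bool
  | .le => true
  | .lt => true
  | .gt => false
  | .ge => false

theorem forall_until_iff (r : Cmp) (d : ℝ) (s : Fin M.nS) {u rk : Conf M.toFrame C b → ℝ}
    (h : (opponentMDP M σ).Cert r.isUpper (fun c => goal c.1) (fun c => ok c.1) u rk) :
    (∀ μ : OpponentStrategy M.toFrame C b, r.Rel ((outcome M σ μ s).real
      {ω | (fun n => (ω n).1) ∈ {π : ℕ → Fin M.nS | ∃ k, goal (π k) ∧ ∀ j < k, ok (π j)}}) d) ↔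
      r.Rel (∑ q, startDist σ s q * u (s, q)) d := by
  rw [h.eq_val]
  exact forall_rel_iff r d _ _ r.isUpper (by cases r <;> rfl)
    (fun μ => prob_until_le M σ goal ok μ s _) (exists_prob_until_eq M σ goal ok s _)

/-- A play violates a release formula iff it satisfies the until formula of the negated arguments.
The opponents' worst case for one is the best case for the other, whence the reversed optimization
and the complementary probability. -/
theorem forall_release_iff (r : Cmp) (d : ℝ) (s : Fin M.nS) {u rk : Conf M.toFrame C b → ℝ}
    (h : (opponentMDP M σ).Cert (!r.isUpper) (fun c => ¬ goal c.1) (fun c => ¬ ok c.1) u rk) :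
    (∀ μ : OpponentStrategy M.toFrame C b, r.Rel ((outcome M σ μ s).real
      {ω | (fun n => (ω n).1) ∈ {π : ℕ → Fin M.nS | ∀ k, goal (π k) ∨ ∃ j < k, ok (π j)}}) d) ↔
      r.Rel (1 - ∑ q, startDist σ s q * u (s, q)) d := by
  rw [h.eq_val]
  have hc : ∀ μ : OpponentStrategy M.toFrame C b, (outcome M σ μ s).real
      {ω | (fun n => (ω n).1) ∈ {π : ℕ → Fin M.nS | ∀ k, goal (π k) ∨ ∃ j < k, ok (π j)}} =
      1 - (outcome M σ μ s).real (untilSet (fun c => ¬ goal c.1) (fun c => ¬ ok c.1)) := by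
    intro μ
    have hp : IsProbabilityMeasure (outcome M σ μ s) := by unfold outcome; infer_instance
    have hm : MeasurableSet (untilSet (fun c : Conf M.toFrame C b => ¬ goal c.1)
        (fun c => ¬ ok c.1)) := by
      unfold untilSet
      measurability
    rw [← probReal_compl_eq_one_sub hm]
    congr 1
    ext ω
    simp [untilSet, or_iff_not_imp_left]
  have key := fun μ => prob_until_le M σ (fun s => ¬ goal s) (fun s => ¬ ok s) μ s (!r.isUpper)
  obtain ⟨μ₀, h0⟩ := exists_prob_until_eq M σ (fun s => ¬ goal s) (fun s => ¬ ok s) s (!r.isUpper)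
  refine forall_rel_iff r d _ _ r.isUpper (by cases r <;> rfl) (fun μ => ?_)
    ⟨μ₀, by rw [hc, ← h0]⟩
  rw [hc]
  have := key μ
  cases hr : r.isUpper <;> simp only [hr, Bool.not_true, Bool.not_false, optSign, if_true,
    Bool.false_eq_true, if_false] at * <;> linarith

theorem forall_next_iff (r : Cmp) (d : ℝ) (s : Fin M.nS) {f u : Conf M.toFrame C b → ℝ}
    (hf : ∀ c, (goal c.1 → f c = 1) ∧ (¬ goal c.1 → f c = 0))
    (hu : ∀ c, IsOpt r.isUpper ((opponentMDP M σ).avail c) ((opponentMDP M σ).ex f c) (u c)) :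
    (∀ μ : OpponentStrategy M.toFrame C b, r.Rel ((outcome M σ μ s).real
      {ω | (fun n => (ω n).1) ∈ {π : ℕ → Fin M.nS | goal (π 1)}}) d) ↔
      r.Rel (∑ q, startDist σ s q * u (s, q)) d := by
  classical
  have hf' : f = fun c => if goal c.1 then 1 else 0 := by
    funext c
    split_ifs with h
    exacts [(hf c).1 h, (hf c).2 h]
  have hu' : u = (opponentMDP M σ).opt r.isUpper (fun c => if goal c.1 then 1 else 0) := by
    funext c
    rw [← hf']
    exact (hu c).unique ((opponentMDP M σ).isOpt_opt _ f c)
  rw [hu']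
  exact forall_rel_iff r d _ _ r.isUpper (by cases r <;> rfl)
    (fun μ => prob_next_le M σ μ s _ fun c => goal c.1)
    (exists_prob_next_eq M σ s _ fun c => goal c.1)

end Opponents


/-! ## Building formulas -/

/-- The variables of the target sentences. -/
abbrev TVar : Type := Fin 3 × ℕ

abbrev TExpr : Type := PolyExpr TVar

abbrev TForm : Type := RealFormula TVar

namespace PolyExpr

def rename {V W : Type} (f : V → W) : PolyExpr V → PolyExpr W
  | const c => const c
  | var v => var (f v)
  | add e e' => add (e.rename f) (e'.rename f)
  | mul e e' => mul (e.rename f) (e'.rename f)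

def sub {V : Type} (e f : PolyExpr V) : PolyExpr V := add e (mul (const (-1)) f)

def listSum {V : Type} (l : List (PolyExpr V)) : PolyExpr V := l.foldr add (const 0)

def listProd {V : Type} (l : List (PolyExpr V)) : PolyExpr V := l.foldr mul (const 1)

section eval

variable {V W : Type} (x : V → ℝ)

@[simp]
theorem eval_const (c : ℚ) : (const c : PolyExpr V).eval x = c := by
  simp [eval, toMvPolynomial]

@[simp]
theorem eval_var (v : V) : (var v).eval x = x v := by simp [eval, toMvPolynomial]

@[simp]
theorem eval_add (e f : PolyExpr V) : (add e f).eval x = e.eval x + f.eval x := by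
  simp [eval, toMvPolynomial]

@[simp]
theorem eval_mul (e f : PolyExpr V) : (mul e f).eval x = e.eval x * f.eval x := by
  simp [eval, toMvPolynomial]

@[simp]
theorem eval_sub (e f : PolyExpr V) : (sub e f).eval x = e.eval x - f.eval x := by
  simp [sub]; ring

@[simp]
theorem eval_listSum (l : List (PolyExpr V)) : (listSum l).eval x = (l.map (eval x)).sum := by
  unfold listSum
  induction l with
  | nil => simp
  | cons e l ih => simp [ih]

@[simp]
theorem eval_listProd (l : List (PolyExpr V)) : (listProd l).eval x = (l.map (eval x)).prod := by
  unfold listProd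
  induction l with
  | nil => simp
  | cons e l ih => simp [ih]

theorem eval_rename (f : W → V) (e : PolyExpr W) :
    (e.rename f).eval x = e.eval (fun w => x (f w)) := by
  induction e with
  | const c => simp [rename]
  | var v => simp [rename]
  | add e f ih ih' => simp [rename, ih, ih']
  | mul e f ih ih' => simp [rename, ih, ih']

end eval

end PolyExpr

namespace RealFormula

variable {V : Type}

def tt : RealFormula V := nonneg (.const 0)

def ff : RealFormula V := pos (.const 0)

def le (e f : PolyExpr V) : RealFormula V := nonneg (f.sub e)

def lt (e f : PolyExpr V) : RealFormula V := pos (f.sub e)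

def eq (e f : PolyExpr V) : RealFormula V := and (le e f) (le f e)

def imp (φ ψ : RealFormula V) : RealFormula V := or (not φ) ψ

def iff (φ ψ : RealFormula V) : RealFormula V := and (imp φ ψ) (imp ψ φ)

def conj (l : List (RealFormula V)) : RealFormula V := l.foldr and tt

def disj (l : List (RealFormula V)) : RealFormula V := l.foldr or ff

/-- The expressions form a probability distribution. -/
def dist (l : List (PolyExpr V)) : RealFormula V :=
  and (conj (l.map nonneg)) (eq (.listSum l) (.const 1))

variable (x : V → ℝ)

@[simp]
theorem holds_nonneg (e : PolyExpr V) : (nonneg e).Holds x ↔ 0 ≤ e.eval x := Iff.rfl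

@[simp]
theorem holds_pos (e : PolyExpr V) : (pos e).Holds x ↔ 0 < e.eval x := Iff.rfl

@[simp]
theorem holds_not (φ : RealFormula V) : (not φ).Holds x ↔ ¬ φ.Holds x := Iff.rfl

@[simp]
theorem holds_and (φ ψ : RealFormula V) : (and φ ψ).Holds x ↔ φ.Holds x ∧ ψ.Holds x := Iff.rfl

@[simp]
theorem holds_or (φ ψ : RealFormula V) : (or φ ψ).Holds x ↔ φ.Holds x ∨ ψ.Holds x := Iff.rfl

@[simp]
theorem holds_tt : (tt : RealFormula V).Holds x := by simp [tt]

@[simp]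
theorem holds_ff : ¬ (ff : RealFormula V).Holds x := by simp [ff]

@[simp]
theorem holds_le (e f : PolyExpr V) : (le e f).Holds x ↔ e.eval x ≤ f.eval x := by simp [le]

@[simp]
theorem holds_lt (e f : PolyExpr V) : (lt e f).Holds x ↔ e.eval x < f.eval x := by simp [lt]

@[simp]
theorem holds_eq (e f : PolyExpr V) : (eq e f).Holds x ↔ e.eval x = f.eval x := by
  simp [eq, le_antisymm_iff]

@[simp]
theorem holds_imp (φ ψ : RealFormula V) : (imp φ ψ).Holds x ↔ (φ.Holds x → ψ.Holds x) := by
  simp [imp, imp_iff_not_or]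

@[simp]
theorem holds_iff (φ ψ : RealFormula V) : (iff φ ψ).Holds x ↔ (φ.Holds x ↔ ψ.Holds x) := by
  simp [iff, iff_def]

@[simp]
theorem holds_conj (l : List (RealFormula V)) : (conj l).Holds x ↔ ∀ φ ∈ l, φ.Holds x := by
  unfold conj
  induction l with
  | nil => simp
  | cons φ l ih => simp [ih]

@[simp]
theorem holds_disj (l : List (RealFormula V)) : (disj l).Holds x ↔ ∃ φ ∈ l, φ.Holds x := by
  unfold disj
  induction l with
  | nil => simp
  | cons φ l ih => simp [ih]

@[simp]
theorem holds_dist (l : List (PolyExpr V)) : (dist l).Holds x ↔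
    (∀ e ∈ l, 0 ≤ e.eval x) ∧ (l.map (PolyExpr.eval x)).sum = 1 := by
  simp [dist]

end RealFormula

namespace PolyTime

variable {α V : Type} [Coded α] [Coded V]

@[fun_prop]
theorem polyExpr_const {f : α → ℚ} (hf : PolyTime f) :
    PolyTime (fun a => (PolyExpr.const (f a) : PolyExpr V)) :=
  of_cenc ((const (0 : ℕ)).prodMk hf) fun _ => rfl

@[fun_prop]
theorem polyExpr_var {f : α → V} (hf : PolyTime f) : PolyTime (fun a => PolyExpr.var (f a)) :=
  of_cenc ((const (1 : ℕ)).prodMk hf) fun _ => rfl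

@[fun_prop]
theorem polyExpr_add {f g : α → PolyExpr V} (hf : PolyTime f) (hg : PolyTime g) :
    PolyTime (fun a => PolyExpr.add (f a) (g a)) :=
  of_cenc ((const (2 : ℕ)).prodMk (hf.prodMk hg)) fun _ => rfl

@[fun_prop]
theorem polyExpr_mul {f g : α → PolyExpr V} (hf : PolyTime f) (hg : PolyTime g) :
    PolyTime (fun a => PolyExpr.mul (f a) (g a)) :=
  of_cenc ((const (3 : ℕ)).prodMk (hf.prodMk hg)) fun _ => rfl

@[fun_prop]
theorem polyExpr_sub {f g : α → PolyExpr V} (hf : PolyTime f) (hg : PolyTime g) :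
    PolyTime (fun a => PolyExpr.sub (f a) (g a)) := by
  unfold PolyExpr.sub; fun_prop

@[fun_prop]
theorem polyExpr_listSum {l : α → List (PolyExpr V)} (hl : PolyTime l) :
    PolyTime (fun a => PolyExpr.listSum (l a)) :=
  foldr_of_le_add (g := fun _ => PolyExpr.add) hl (by fun_prop) (by fun_prop)
    ⟨Polynomial.X + 10, fun a c d => by
      change csize (2, c, d) ≤ _
      simp only [csize_pair, csize_nat, Polynomial.eval_add, Polynomial.eval_X,
        Polynomial.eval_ofNat]
      omega⟩

@[fun_prop]
theorem polyExpr_listProd {l : α → List (PolyExpr V)} (hl : PolyTime l) :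
    PolyTime (fun a => PolyExpr.listProd (l a)) :=
  foldr_of_le_add (g := fun _ => PolyExpr.mul) hl (by fun_prop) (by fun_prop)
    ⟨Polynomial.X + 10, fun a c d => by
      change csize (3, c, d) ≤ _
      simp only [csize_pair, csize_nat, Polynomial.eval_add, Polynomial.eval_X,
        Polynomial.eval_ofNat]
      omega⟩

@[fun_prop]
theorem form_nonneg {f : α → PolyExpr V} (hf : PolyTime f) :
    PolyTime (fun a => RealFormula.nonneg (f a)) :=
  of_cenc ((const (0 : ℕ)).prodMk hf) fun _ => rfl

@[fun_prop]
theorem form_pos {f : α → PolyExpr V} (hf : PolyTime f) :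
    PolyTime (fun a => RealFormula.pos (f a)) :=
  of_cenc ((const (1 : ℕ)).prodMk hf) fun _ => rfl

@[fun_prop]
theorem form_not {f : α → RealFormula V} (hf : PolyTime f) :
    PolyTime (fun a => RealFormula.not (f a)) :=
  of_cenc ((const (2 : ℕ)).prodMk hf) fun _ => rfl

@[fun_prop]
theorem form_and {f g : α → RealFormula V} (hf : PolyTime f) (hg : PolyTime g) :
    PolyTime (fun a => RealFormula.and (f a) (g a)) :=
  of_cenc ((const (3 : ℕ)).prodMk (hf.prodMk hg)) fun _ => rfl

@[fun_prop]
theorem form_or {f g : α → RealFormula V} (hf : PolyTime f) (hg : PolyTime g) :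
    PolyTime (fun a => RealFormula.or (f a) (g a)) :=
  of_cenc ((const (4 : ℕ)).prodMk (hf.prodMk hg)) fun _ => rfl

@[fun_prop]
theorem form_le {f g : α → PolyExpr V} (hf : PolyTime f) (hg : PolyTime g) :
    PolyTime (fun a => RealFormula.le (f a) (g a)) := by
  unfold RealFormula.le; fun_prop

@[fun_prop]
theorem form_lt {f g : α → PolyExpr V} (hf : PolyTime f) (hg : PolyTime g) :
    PolyTime (fun a => RealFormula.lt (f a) (g a)) := by
  unfold RealFormula.lt; fun_prop

@[fun_prop]
theorem form_eq {f g : α → PolyExpr V} (hf : PolyTime f) (hg : PolyTime g) :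
    PolyTime (fun a => RealFormula.eq (f a) (g a)) := by
  unfold RealFormula.eq; fun_prop

@[fun_prop]
theorem form_imp {f g : α → RealFormula V} (hf : PolyTime f) (hg : PolyTime g) :
    PolyTime (fun a => RealFormula.imp (f a) (g a)) := by
  unfold RealFormula.imp; fun_prop

@[fun_prop]
theorem form_iff {f g : α → RealFormula V} (hf : PolyTime f) (hg : PolyTime g) :
    PolyTime (fun a => RealFormula.iff (f a) (g a)) := by
  unfold RealFormula.iff; fun_prop

@[fun_prop]
theorem form_conj {l : α → List (RealFormula V)} (hl : PolyTime l) :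
    PolyTime (fun a => RealFormula.conj (l a)) :=
  foldr_of_le_add (g := fun _ => RealFormula.and) hl (by fun_prop) (by fun_prop)
    ⟨Polynomial.X + 10, fun a c d => by
      change csize (3, c, d) ≤ _
      simp only [csize_pair, csize_nat, Polynomial.eval_add, Polynomial.eval_X,
        Polynomial.eval_ofNat]
      omega⟩

@[fun_prop]
theorem form_disj {l : α → List (RealFormula V)} (hl : PolyTime l) :
    PolyTime (fun a => RealFormula.disj (l a)) :=
  foldr_of_le_add (g := fun _ => RealFormula.or) hl (by fun_prop) (by fun_prop)
    ⟨Polynomial.X + 10, fun a c d => by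
      change csize (4, c, d) ≤ _
      simp only [csize_pair, csize_nat, Polynomial.eval_add, Polynomial.eval_X,
        Polynomial.eval_ofNat]
      omega⟩

@[fun_prop]
theorem form_dist {l : α → List (PolyExpr V)} (hl : PolyTime l) :
    PolyTime (fun a => RealFormula.dist (l a)) := by
  unfold RealFormula.dist; fun_prop

end PolyTime

/-! ### Numbering of the variables -/

/-- The number with the first `k` digits of `l` in base `N`. -/
def horner (N : ℕ) : ℕ → List ℕ → ℕ
  | 0, _ => 0
  | k + 1, l => l.headD 0 + N * horner N k l.tail

/-- The `i`-th digit in base `N`. -/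
def digit (N n i : ℕ) : ℕ := n / N ^ i % N

/-- The list of indices can be read off from the number, up to trailing zeros. Hence variables with
different indices get different numbers, and values can be assigned to them at will. -/
theorem digit_horner {N : ℕ} (hN : 0 < N) (k : ℕ) : ∀ (l : List ℕ) (i : ℕ), l.length ≤ k →
    (∀ m ∈ l, m < N) → digit N (horner N k l) i = l.getD i 0 := by
  induction k with
  | zero =>
    intro l i hl _
    obtain rfl : l = [] := List.length_eq_zero_iff.1 (by omega)
    simp [horner, digit]
  | succ k ih =>
    intro l i hl hlt
    cases l with
    | nil =>
      have h : ∀ k, horner N k [] = 0 := by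
        intro k
        induction k with
        | zero => rfl
        | succ k ih => simp [horner, ih]
      simp [h, digit]
    | cons m l =>
      have hm : m < N := hlt m (by simp)
      cases i with
      | zero => simp [horner, digit, Nat.mod_eq_of_lt hm]
      | succ i =>
        have := ih l i (by simpa using hl) fun m hm => hlt m (by simp [hm])
        rw [List.getD_cons_succ, ← this]
        simp only [digit, horner, List.headD_cons, List.tail_cons]
        rw [pow_succ', ← Nat.div_div_eq_div_mul, Nat.add_mul_div_left _ _ hN,
          Nat.div_eq_of_lt hm, zero_add]

/-- All lists whose `i`-th entry is taken from the `i`-th list, for `i < n`. -/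
def choices : ℕ → List (List ℕ) → List (List ℕ)
  | 0, _ => [[]]
  | n + 1, L => (L.headD []).flatMap fun a => (choices n L.tail).map (a :: ·)

namespace PolyTime

variable {α : Type} [Coded α]

-- The number of digits is a constant. This keeps the numbers polynomial in the base, so that they
-- can be written in unary.
@[fun_prop]
theorem horner {N : α → ℕ} {l : α → List ℕ} (k : ℕ) (hN : PolyTime N) (hl : PolyTime l) :
    PolyTime (fun a => _root_.horner (N a) k (l a)) := by
  induction k generalizing l with
  | zero => exact const 0
  | succ k ih =>
    have := ih hl.list_tail
    unfold _root_.horner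
    fun_prop

-- The length of the lists is a constant, so their number is polynomial although it is exponential
-- in that length.
@[fun_prop]
theorem choices {L : α → List (List ℕ)} (n : ℕ) (hL : PolyTime L) :
    PolyTime (fun a => _root_.choices n (L a)) := by
  induction n generalizing L with
  | zero => exact const [[]]
  | succ n ih =>
    obtain ⟨G, hG, h⟩ : ∃ G, PolyTime G ∧ ∀ a, G a = _root_.choices n (L a).tail :=
      ⟨_, ih hL.list_tail, fun _ => rfl⟩
    unfold _root_.choices
    simp only [← h]
    fun_prop

end PolyTime


/-! ## The sentence that expresses an instance -/

/-- A subformula in a list of subformulas: its kind, coalition, comparison, bound, and an offset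
that gives the position of its first argument (for atoms, the number of the atom). -/
abbrev Node : Type := ℕ × List Bool × ℕ × ℚ × ℕ

/-- Instances, as nested lists. -/
abbrev RawSystem : Type := ℕ × ℕ × List ℕ × List (List (List Bool)) × List (List Bool) ×
  List (List ℕ) × List (List (List (PolyExpr ℕ × PolyExpr ℕ))) ×
  List (PolyExpr ℕ × ℕ × PolyExpr ℕ) × ℕ × ℕ

/-- A raw instance together with the list of the subformulas of its formula. -/
abbrev Env : Type := RawSystem × List Node

namespace Env

def nS (e : Env) : ℕ := e.1.1
def nX (e : Env) : ℕ := e.1.2.1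
def nO (e : Env) (a : ℕ) : ℕ := e.1.2.2.1.getD a 0
def legal (e : Env) (s a x : ℕ) : Bool := ((e.1.2.2.2.1.getD s []).getD a []).getD x false
def label (e : Env) (s p : ℕ) : Bool := (e.1.2.2.2.2.1.getD s []).getD p false
def obs (e : Env) (a s : ℕ) : ℕ := (e.1.2.2.2.2.2.1.getD a []).getD s 0
def trans (e : Env) (s i s' : ℕ) : PolyExpr ℕ × PolyExpr ℕ :=
  ((e.1.2.2.2.2.2.2.1.getD s []).getD i []).getD s' (.const 0, .const 0)
def constraints (e : Env) : List (PolyExpr ℕ × ℕ × PolyExpr ℕ) := e.1.2.2.2.2.2.2.2.1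
def state (e : Env) : ℕ := e.1.2.2.2.2.2.2.2.2.1
def bound (e : Env) : ℕ := e.1.2.2.2.2.2.2.2.2.2
def nodes (e : Env) : List Node := e.2
def node (e : Env) (k : ℕ) : Node := e.2.getD k (0, [], 0, 0, 0)
def kind (e : Env) (k : ℕ) : ℕ := (e.node k).1
def mem (e : Env) (k a : ℕ) : Bool := (e.node k).2.1.getD a false
def cmp (e : Env) (k : ℕ) : ℕ := (e.node k).2.2.1
def thr (e : Env) (k : ℕ) : ℚ := (e.node k).2.2.2.1
def off (e : Env) (k : ℕ) : ℕ := (e.node k).2.2.2.2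

/-- All components of indices of variables are smaller than `e.base nAg nAct`. -/
def base (nAg nAct : ℕ) (e : Env) : ℕ :=
  -- Strict bounds, in turn, for states, subformulas, observations, modes, the seven tags, agents,
  -- actions and the numbers of profiles.
  e.nS + e.nodes.length + e.1.2.2.1.sum + e.bound + (7 + nAg + nAct + nAct ^ nAg)

/-- The variable with index `l` in the quantifier block `j`. -/
def var (nAg nAct : ℕ) (e : Env) (j : Fin 3) (l : List ℕ) : TExpr :=
  -- The first `nX` numbers are left to the parameters. Index lists have at most seven entries, or
  -- two entries and one mode for each agent, so `nAg + 8` digits are enough.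
  .var (j, e.nX + horner (e.base nAg nAct) (nAg + 8) l)

/-- The parameters are the first variables of the second block. -/
def param (f : PolyExpr ℕ) : TExpr := f.rename fun i => (1, i)

section

variable (nAg nAct : ℕ) (e : Env)

def transVar (s i s' : ℕ) : TExpr := e.var nAg nAct 1 [0, s, i, s']
def truthVar (k s : ℕ) : TExpr := e.var nAg nAct 1 [1, k, s]
def startVar (j : Fin 3) (k s a o q : ℕ) : TExpr := e.var nAg nAct j [2, k, s, a, o, q]
def nextVar (j : Fin 3) (k s a q o q' : ℕ) : TExpr := e.var nAg nAct j [3, k, s, a, q, o, q']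
def actVar (j : Fin 3) (k s a q o x : ℕ) : TExpr := e.var nAg nAct j [4, k, s, a, q, o, x]
-- No subformula or state of the table enters the index: only one entry of the table is refuted at a
-- time, so all entries can share the variables of the certificate.
def valVar (c : ℕ × List ℕ) : TExpr := e.var nAg nAct 2 (5 :: c.1 :: c.2)
def rankVar (c : ℕ × List ℕ) : TExpr := e.var nAg nAct 2 (6 :: c.1 :: c.2)

/-- All action profiles, with their numbers. -/
def profiles : List (ℕ × List ℕ) :=
  List.ofFn fun i : Fin (nAct ^ nAg) =>
    (i.val, List.ofFn fun a : Fin nAg => (finFunctionFinEquiv.symm i a).val)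

def listAll (l : List Bool) : Bool := l.foldr Bool.and true

def legalProfile (s : ℕ) (p : List ℕ) : Bool :=
  listAll ((List.range nAg).map fun a => e.legal s a (p.getD a 0))

/-- The transition variables have the values that the parameters prescribe. -/
def transForm : TForm :=
  .conj ((List.range e.nS).map fun s => .conj ((profiles nAg nAct).map fun p =>
    bif e.legalProfile nAg s p.2 then
      .and (.conj ((List.range e.nS).map fun s' =>
        .and (.not (.eq (param (e.trans s p.1 s').2) (.const 0)))
          -- Polynomial expressions have no division, so the quotient is cleared of its denominator,
          -- which is required to be non-zero.
          (.eq (.mul (e.transVar nAg nAct s p.1 s') (param (e.trans s p.1 s').2))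
            (param (e.trans s p.1 s').1))))
        (.dist ((List.range e.nS).map fun s' => e.transVar nAg nAct s p.1 s'))
    else .tt))

def constraintForm (c : PolyExpr ℕ × ℕ × PolyExpr ℕ) : TForm :=
  bif Nat.beq c.2.1 0 then .lt (param c.1) (param c.2.2)
  else bif Nat.beq c.2.1 1 then .lt (param c.2.2) (param c.1)
  else bif Nat.beq c.2.1 2 then .le (param c.1) (param c.2.2)
  else bif Nat.beq c.2.1 3 then .le (param c.2.2) (param c.1)
  else .eq (param c.1) (param c.2.2)

/-- The truth table is claimed to be true at `(k, s)`. -/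
def isTrue (k s : ℕ) : TForm := .pos (e.truthVar nAg nAct k s)

/-- Positions of the last and of the first argument of a subformula. -/
def argLast (k : ℕ) : ℕ := k - 1
def argFirst (k : ℕ) : ℕ := k - 1 - e.off k

/-- Entries for atoms and Boolean connectives are checked right here. Entries for coalition
operators are only required to be `0` or `1`, since an objection to them needs the last quantifier
block. -/
def tableEntryForm (k s : ℕ) : TForm :=
  .and (.or (.eq (e.truthVar nAg nAct k s) (.const 0)) (.eq (e.truthVar nAg nAct k s) (.const 1)))
    (bif Nat.beq (e.kind k) 0 then
      bif e.label s (e.off k) then e.isTrue nAg nAct k s else .not (e.isTrue nAg nAct k s)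
    else bif Nat.beq (e.kind k) 1 then
      .iff (e.isTrue nAg nAct k s)
        (.or (e.isTrue nAg nAct (e.argFirst k) s) (e.isTrue nAg nAct (argLast k) s))
    else bif Nat.beq (e.kind k) 2 then
      .iff (e.isTrue nAg nAct k s) (.not (e.isTrue nAg nAct (argLast k) s))
    else .tt)

/-- The part of the sentence on the universally quantified parameters and on the truth table. -/
def premise : TForm :=
  .and (e.transForm nAg nAct) (.and (.conj (e.constraints.map constraintForm))
    (.conj ((List.range e.nodes.length).map fun k =>
      .conj ((List.range e.nS).map fun s => e.tableEntryForm nAg nAct k s))))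

/-- The variables of block `j` with index `(k, s)` are a scheduler of agent `a`. -/
def schedulerForm (j : Fin 3) (k s a : ℕ) : TForm :=
  .and (.conj ((List.range (e.nO a)).map fun o =>
    .and (.dist ((List.range e.bound).map fun q => e.startVar nAg nAct j k s a o q))
      (.conj ((List.range e.bound).map fun q =>
        .and (.dist ((List.range e.bound).map fun q' => e.nextVar nAg nAct j k s a q o q'))
          (.dist ((List.range nAct).map fun x => e.actVar nAg nAct j k s a q o x))))))
    (.conj ((List.range e.nS).map fun s' => .conj ((List.range e.bound).map fun q =>
      .conj ((List.range nAct).map fun x => bif e.legal s' a x then .tt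
        else .eq (e.actVar nAg nAct j k s a q (e.obs a s') x) (.const 0)))))

def strategyForm (j : Fin 3) (k s : ℕ) : TForm :=
  .conj ((List.range nAg).map fun a =>
    bif e.mem k a then e.schedulerForm nAg nAct j k s a else .tt)

/-- The modes of the coalition of the `k`-th subformula; agents outside have mode `0`. -/
def modes (k : ℕ) : List (List ℕ) :=
  choices nAg ((List.range nAg).map fun a => bif e.mem k a then List.range e.bound else [0])

def confs (k : ℕ) : List (ℕ × List ℕ) :=
  (List.range e.nS).flatMap fun s => (e.modes nAg k).map fun q => (s, q)

def moves (s : ℕ) : List (List ℕ) :=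
  (profiles nAg nAct).flatMap fun p => bif e.legalProfile nAg s p.2 then [p.2] else []

def playExpr (j : Fin 3) (k s : ℕ) (c : ℕ × List ℕ) (β α : List ℕ) (a : ℕ) : TExpr :=
  bif e.mem k a then e.actVar nAg nAct j k s a (c.2.getD a 0) (e.obs a c.1) (α.getD a 0)
  else bif Nat.beq (α.getD a 0) (β.getD a 0) then .const 1 else .const 0

def modeExpr (j : Fin 3) (k s : ℕ) (c : ℕ × List ℕ) (q' : List ℕ) (a : ℕ) : TExpr :=
  bif e.mem k a then e.nextVar nAg nAct j k s a (c.2.getD a 0) (e.obs a c.1) (q'.getD a 0)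
  else .const 1

def moveExpr (j : Fin 3) (k s : ℕ) (c : ℕ × List ℕ) (β : List ℕ) (c' : ℕ × List ℕ) : TExpr :=
  .mul (.listSum ((profiles nAg nAct).map fun p =>
      .mul (.listProd ((List.range nAg).map fun a => e.playExpr nAg nAct j k s c β p.2 a))
        (e.transVar nAg nAct c.1 p.1 c'.1)))
    (.listProd ((List.range nAg).map fun a => e.modeExpr nAg nAct j k s c c'.2 a))

/-- The value that is collected at the next configuration. -/
def rewardExpr (k : ℕ) (c : ℕ × List ℕ) : TExpr :=
  bif Nat.beq (e.kind k) 3 then e.truthVar nAg nAct (argLast k) c.1 else e.valVar nAg nAct c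

def expectExpr (j : Fin 3) (k s : ℕ) (c : ℕ × List ℕ) (β : List ℕ) : TExpr :=
  .listSum ((e.confs nAg k).map fun c' =>
    .mul (e.moveExpr nAg nAct j k s c β c') (e.rewardExpr nAg nAct k c'))

/-- Whether the opponents maximize the probability. -/
def isMax (k : ℕ) : Bool :=
  -- For release formulas the value variables describe the complementary until event, so the
  -- direction is reversed.
  bif Nat.beq (e.kind k) 5 then !(Nat.ble (e.cmp k) 1) else Nat.ble (e.cmp k) 1

def optForm (j : Fin 3) (k s : ℕ) (c : ℕ × List ℕ) : TForm :=
  bif e.isMax k then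
    .and (.conj ((e.moves nAg nAct c.1).map fun β =>
        .le (e.expectExpr nAg nAct j k s c β) (e.valVar nAg nAct c)))
      (.disj ((e.moves nAg nAct c.1).map fun β =>
        .le (e.valVar nAg nAct c) (e.expectExpr nAg nAct j k s c β)))
  else
    .and (.conj ((e.moves nAg nAct c.1).map fun β =>
        .le (e.valVar nAg nAct c) (e.expectExpr nAg nAct j k s c β)))
      (.disj ((e.moves nAg nAct c.1).map fun β =>
        .le (e.expectExpr nAg nAct j k s c β) (e.valVar nAg nAct c)))

def descentForm (j : Fin 3) (k s : ℕ) (c : ℕ × List ℕ) (β : List ℕ) : TForm :=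
  .disj ((e.confs nAg k).map fun c' => .and (.pos (e.moveExpr nAg nAct j k s c β c'))
    (.lt (e.rankVar nAg nAct c') (e.rankVar nAg nAct c)))

def progressForm (j : Fin 3) (k s : ℕ) (c : ℕ × List ℕ) : TForm :=
  bif e.isMax k then
    .disj ((e.moves nAg nAct c.1).map fun β =>
      .and (.le (e.valVar nAg nAct c) (e.expectExpr nAg nAct j k s c β))
        (e.descentForm nAg nAct j k s c β))
  else .conj ((e.moves nAg nAct c.1).map fun β => e.descentForm nAg nAct j k s c β)

/-- The argument at position `i` holds in `s`, or fails if the `k`-th subformula is a release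
formula. -/
def argForm (k i s : ℕ) : TForm :=
  bif Nat.beq (e.kind k) 5 then .not (e.isTrue nAg nAct i s) else e.isTrue nAg nAct i s

/-- The conditions of `FinMDP.Cert` at one configuration, with the last argument as goal and the
first argument as the condition on the way. -/
def confForm (j : Fin 3) (k s : ℕ) (c : ℕ × List ℕ) : TForm :=
  .and (.nonneg (e.valVar nAg nAct c))
    (.and (.imp (e.argForm nAg nAct k (argLast k) c.1) (.eq (e.valVar nAg nAct c) (.const 1)))
      (.imp (.not (e.argForm nAg nAct k (argLast k) c.1))
        (.and (.imp (.not (e.argForm nAg nAct k (e.argFirst k) c.1))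
            (.eq (e.valVar nAg nAct c) (.const 0)))
          (.imp (e.argForm nAg nAct k (e.argFirst k) c.1)
            (.and (e.optForm nAg nAct j k s c)
              (.imp (.pos (e.valVar nAg nAct c)) (e.progressForm nAg nAct j k s c)))))))

/-- The value variables are the optimal probabilities of the opponents. -/
def certForm (j : Fin 3) (k s : ℕ) : TForm :=
  .conj ((e.confs nAg k).map fun c =>
    bif Nat.beq (e.kind k) 3 then e.optForm nAg nAct j k s c else e.confForm nAg nAct j k s c)

def startExpr (j : Fin 3) (k s : ℕ) (q : List ℕ) (a : ℕ) : TExpr :=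
  bif e.mem k a then e.startVar nAg nAct j k s a (e.obs a s) (q.getD a 0) else .const 1

def probExpr (j : Fin 3) (k s : ℕ) : TExpr :=
  .listSum ((e.modes nAg k).map fun q =>
    .mul (.listProd ((List.range nAg).map fun a => e.startExpr nAg nAct j k s q a))
      (e.valVar nAg nAct (s, q)))

def boundedExpr (j : Fin 3) (k s : ℕ) : TExpr :=
  bif Nat.beq (e.kind k) 5 then .sub (.const 1) (e.probExpr nAg nAct j k s)
  else e.probExpr nAg nAct j k s

def cmpForm (j : Fin 3) (k s : ℕ) : TForm :=
  bif Nat.beq (e.cmp k) 0 then .le (e.boundedExpr nAg nAct j k s) (.const (e.thr k))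
  else bif Nat.beq (e.cmp k) 1 then .lt (e.boundedExpr nAg nAct j k s) (.const (e.thr k))
  else bif Nat.beq (e.cmp k) 2 then .lt (.const (e.thr k)) (e.boundedExpr nAg nAct j k s)
  else .le (.const (e.thr k)) (e.boundedExpr nAg nAct j k s)

/-- The truth table is wrong at `(k, s)`, where `k` is the position of a coalition formula. -/
def refuteForm (k s : ℕ) : TForm :=
  -- In both alternatives the certificate is asserted positively, also when the failure of a
  -- strategy is claimed; this is sound because a certificate determines the value.
  .or (.and (e.isTrue nAg nAct k s) (.or (.not (e.strategyForm nAg nAct 1 k s))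
      (.and (e.certForm nAg nAct 1 k s) (.not (e.cmpForm nAg nAct 1 k s)))))
    (.and (.not (e.isTrue nAg nAct k s)) (.and (e.strategyForm nAg nAct 2 k s)
      (.and (e.certForm nAg nAct 2 k s) (e.cmpForm nAg nAct 2 k s))))

/-- The universal side loses if its data are inconsistent, if its table affirms the formula, or if
an entry of the table can be refuted. -/
def sentence : TForm :=
  .imp (e.premise nAg nAct) (.or (e.isTrue nAg nAct (e.nodes.length - 1) e.state)
    (.disj ((List.range e.nodes.length).map fun k => .disj ((List.range e.nS).map fun s =>
      bif Nat.ble 3 (e.kind k) then e.refuteForm nAg nAct k s else .ff))))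

end

end Env


namespace PolyTime

variable {α : Type} [Coded α] (nAg nAct : ℕ) {e : α → Env} {j : α → Fin 3}
  {k s a o q q' x i s' p : α → ℕ} {c c' : α → ℕ × List ℕ} {l β γ : α → List ℕ}

section

@[fun_prop]
theorem env_nS (he : PolyTime e) : PolyTime (fun z => (e z).nS) := by unfold Env.nS; fun_prop
@[fun_prop]
theorem env_nX (he : PolyTime e) : PolyTime (fun z => (e z).nX) := by unfold Env.nX; fun_prop
@[fun_prop]
theorem env_nO (he : PolyTime e) (ha : PolyTime a) : PolyTime (fun z => (e z).nO (a z)) := by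
  unfold Env.nO; fun_prop
@[fun_prop]
theorem env_legal (he : PolyTime e) (hs : PolyTime s) (ha : PolyTime a) (hx : PolyTime x) :
    PolyTime (fun z => (e z).legal (s z) (a z) (x z)) := by unfold Env.legal; fun_prop
@[fun_prop]
theorem env_label (he : PolyTime e) (hs : PolyTime s) (hp : PolyTime p) :
    PolyTime (fun z => (e z).label (s z) (p z)) := by unfold Env.label; fun_prop
@[fun_prop]
theorem env_obs (he : PolyTime e) (ha : PolyTime a) (hs : PolyTime s) :
    PolyTime (fun z => (e z).obs (a z) (s z)) := by unfold Env.obs; fun_prop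
@[fun_prop]
theorem env_trans (he : PolyTime e) (hs : PolyTime s) (hi : PolyTime i) (hs' : PolyTime s') :
    PolyTime (fun z => (e z).trans (s z) (i z) (s' z)) := by unfold Env.trans; fun_prop
@[fun_prop]
theorem env_constraints (he : PolyTime e) : PolyTime (fun z => (e z).constraints) := by
  unfold Env.constraints; fun_prop
@[fun_prop]
theorem env_state (he : PolyTime e) : PolyTime (fun z => (e z).state) := by
  unfold Env.state; fun_prop
@[fun_prop]
theorem env_bound (he : PolyTime e) : PolyTime (fun z => (e z).bound) := by
  unfold Env.bound; fun_prop
@[fun_prop]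
theorem env_nodes (he : PolyTime e) : PolyTime (fun z => (e z).nodes) := by
  unfold Env.nodes; fun_prop
@[fun_prop]
theorem env_node (he : PolyTime e) (hk : PolyTime k) : PolyTime (fun z => (e z).node (k z)) := by
  unfold Env.node; fun_prop
@[fun_prop]
theorem env_kind (he : PolyTime e) (hk : PolyTime k) : PolyTime (fun z => (e z).kind (k z)) := by
  unfold Env.kind; fun_prop
@[fun_prop]
theorem env_mem (he : PolyTime e) (hk : PolyTime k) (ha : PolyTime a) :
    PolyTime (fun z => (e z).mem (k z) (a z)) := by unfold Env.mem; fun_prop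
@[fun_prop]
theorem env_cmp (he : PolyTime e) (hk : PolyTime k) : PolyTime (fun z => (e z).cmp (k z)) := by
  unfold Env.cmp; fun_prop
@[fun_prop]
theorem env_thr (he : PolyTime e) (hk : PolyTime k) : PolyTime (fun z => (e z).thr (k z)) := by
  unfold Env.thr; fun_prop
@[fun_prop]
theorem env_off (he : PolyTime e) (hk : PolyTime k) : PolyTime (fun z => (e z).off (k z)) := by
  unfold Env.off; fun_prop
@[fun_prop]
theorem env_base (he : PolyTime e) : PolyTime (fun z => (e z).base nAg nAct) := by
  unfold Env.base; fun_prop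
@[fun_prop]
theorem env_var (he : PolyTime e) (hj : PolyTime j) (hl : PolyTime l) :
    PolyTime (fun z => (e z).var nAg nAct (j z) (l z)) := by unfold Env.var; fun_prop

end

/-! ### Renaming of the parameters -/

/-- On codes: a tree, the tree of the renamed expression, and the pair of the renamed components. -/
def renameData : Data → Data × Data × Data :=
  Data.cata (.nil, .nil, .nil) fun t u =>
    (.cons t.1 u.1,
      -- The tag of an expression is its first component in unary: zero for constants, one for
      -- variables, more for the two operations. A variable `i` becomes `(1, i)`, and `.cons .nil
      -- .nil` is the code of the block number `1`.
      (bif t.1.isNil then .cons t.1 u.1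
        else bif t.1.snd.isNil then .cons t.1 (.cons (.cons .nil .nil) u.1)
        else .cons t.1 u.2.2),
      .cons t.2.1 u.2.1)

theorem renameData_fst (x : Data) : (renameData x).1 = x := by
  induction x with
  | nil => rfl
  | cons x y hx hy =>
    change Data.cons (renameData x).1 (renameData y).1 = _
    rw [hx, hy]

theorem renameData_cons (x y : Data) : (renameData (.cons x y)).2 =
    (bif x.isNil then .cons x y
      else bif x.snd.isNil then .cons x (.cons (.cons .nil .nil) y)
      else .cons x (renameData y).2.2, .cons (renameData x).2.1 (renameData y).2.1) := by
  conv_rhs => rw [← renameData_fst x, ← renameData_fst y]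
  simp only [renameData_fst]
  conv_lhs => rw [renameData]
  simp only [Data.cata]
  change (bif (renameData x).1.isNil then _ else _, _) = _
  rw [renameData_fst]
  change (bif x.isNil then Data.cons (renameData x).1 (renameData y).1 else
    bif (renameData x).1.snd.isNil then Data.cons (renameData x).1
      (Data.cons (.cons .nil .nil) (renameData y).1)
    else Data.cons (renameData x).1 (renameData y).2.2, _) = _
  rw [renameData_fst, renameData_fst]
  rfl

/-- Each renamed variable grows by a constant. The bound is stated for all trees, as `cata` also
meets trees that are not codes of expressions. -/
theorem size_renameData (x : Data) :
    (renameData x).2.1.size ≤ 5 * x.size ∧ (renameData x).2.2.size ≤ 5 * x.size := by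
  induction x with
  | nil => simp [renameData, Data.cata, Data.size]
  | cons x y hx hy =>
    rw [renameData_cons]
    refine ⟨?_, ?_⟩
    · cases x.isNil <;> cases x.snd.isNil <;> simp only [cond_true, cond_false, Data.size] <;> omega
    · simp only [Data.size]; omega

theorem polyTime_renameData : PolyTime renameData := by
  refine cata (z := fun _ => ((.nil, .nil, .nil) : Data × Data × Data))
    (g := fun _ t u => (Data.cons t.1 u.1,
      (bif t.1.isNil then .cons t.1 u.1
        else bif t.1.snd.isNil then .cons t.1 (.cons (.cons .nil .nil) u.1)
        else .cons t.1 u.2.2),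
      .cons t.2.1 u.2.1)) (const _) (by fun_prop) id' ⟨11 * Polynomial.X + 2, fun a x => ?_⟩
  change csize (renameData x) ≤ _
  obtain ⟨h1, h2⟩ := size_renameData x
  have h3 := renameData_fst x
  have e : csize (renameData x) = (renameData x).1.size + ((renameData x).2.1.size +
    (renameData x).2.2.size + 1) + 1 := rfl
  have e' : csize (a, x) = a.size + x.size + 1 := rfl
  rw [e, e', h3]
  simp only [Polynomial.eval_add, Polynomial.eval_mul, Polynomial.eval_X, Polynomial.eval_ofNat]
  omega

theorem cenc_param (f : PolyExpr ℕ) : cenc (Env.param f) = (renameData (cenc f)).2.1 := by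
  induction f with
  | const c =>
    change _ = (renameData (.cons .nil (cenc c))).2.1
    rw [renameData_cons]
    rfl
  | var v =>
    change _ = (renameData (.cons (cenc 1) (cenc v))).2.1
    rw [renameData_cons]
    rfl
  | add f g hf hg =>
    change Data.cons (cenc 2) (.cons (cenc (Env.param f)) (cenc (Env.param g))) =
      (renameData (.cons (cenc 2) (.cons (cenc f) (cenc g)))).2.1
    rw [renameData_cons, renameData_cons, hf, hg]
    rfl
  | mul f g hf hg =>
    change Data.cons (cenc 3) (.cons (cenc (Env.param f)) (cenc (Env.param g))) =
      (renameData (.cons (cenc 3) (.cons (cenc f) (cenc g)))).2.1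
    rw [renameData_cons, renameData_cons, hf, hg]
    rfl

@[fun_prop]
theorem env_param {f : α → PolyExpr ℕ} (hf : PolyTime f) :
    PolyTime (fun z => Env.param (f z)) := by
  have h : PolyTime Env.param := of_data polyTime_renameData.snd.fst cenc_param
  exact h.comp hf

/-! ### The parts of the sentence -/

@[fun_prop]
theorem listAll {l : α → List Bool} (hl : PolyTime l) : PolyTime (fun z => Env.listAll (l z)) :=
  foldr_of_le_add (g := fun _ => Bool.and) hl (const true) (bool_and (by fun_prop) (by fun_prop))
    ⟨3, fun a c d => by
      have : ∀ b : Bool, csize b ≤ 3 := by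
        intro b; cases b <;> simp [csize, cenc_true, cenc_false, Data.size]
      have := this (Bool.and c d)
      simp only [Polynomial.eval_ofNat]
      omega⟩

@[fun_prop]
theorem env_transVar (he : PolyTime e) (hs : PolyTime s) (hi : PolyTime i) (hs' : PolyTime s') :
    PolyTime (fun z => (e z).transVar nAg nAct (s z) (i z) (s' z)) := by
  unfold Env.transVar; fun_prop

@[fun_prop]
theorem env_truthVar (he : PolyTime e) (hk : PolyTime k) (hs : PolyTime s) :
    PolyTime (fun z => (e z).truthVar nAg nAct (k z) (s z)) := by
  unfold Env.truthVar; fun_prop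

@[fun_prop]
theorem env_startVar (he : PolyTime e) (hj : PolyTime j) (hk : PolyTime k) (hs : PolyTime s)
    (ha : PolyTime a) (ho : PolyTime o) (hq : PolyTime q) :
    PolyTime (fun z => (e z).startVar nAg nAct (j z) (k z) (s z) (a z) (o z) (q z)) := by
  unfold Env.startVar; fun_prop

@[fun_prop]
theorem env_nextVar (he : PolyTime e) (hj : PolyTime j) (hk : PolyTime k) (hs : PolyTime s)
    (ha : PolyTime a) (hq : PolyTime q) (ho : PolyTime o) (hq' : PolyTime q') :
    PolyTime (fun z => (e z).nextVar nAg nAct (j z) (k z) (s z) (a z) (q z) (o z) (q' z)) := by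
  unfold Env.nextVar; fun_prop

@[fun_prop]
theorem env_actVar (he : PolyTime e) (hj : PolyTime j) (hk : PolyTime k) (hs : PolyTime s)
    (ha : PolyTime a) (hq : PolyTime q) (ho : PolyTime o) (hx : PolyTime x) :
    PolyTime (fun z => (e z).actVar nAg nAct (j z) (k z) (s z) (a z) (q z) (o z) (x z)) := by
  unfold Env.actVar; fun_prop

@[fun_prop]
theorem env_valVar (he : PolyTime e) (hc : PolyTime c) :
    PolyTime (fun z => (e z).valVar nAg nAct (c z)) := by
  unfold Env.valVar; fun_prop

@[fun_prop]
theorem env_rankVar (he : PolyTime e) (hc : PolyTime c) :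
    PolyTime (fun z => (e z).rankVar nAg nAct (c z)) := by
  unfold Env.rankVar; fun_prop

@[fun_prop]
theorem env_legalProfile {p : α → List ℕ} (he : PolyTime e) (hs : PolyTime s) (hp : PolyTime p) :
    PolyTime (fun z => (e z).legalProfile nAg (s z) (p z)) := by
  unfold Env.legalProfile; fun_prop

@[fun_prop]
theorem env_transForm (he : PolyTime e) :
    PolyTime (fun z => (e z).transForm nAg nAct) := by
  unfold Env.transForm; fun_prop

@[fun_prop]
theorem env_constraintForm {c : α → PolyExpr ℕ × ℕ × PolyExpr ℕ} (hc : PolyTime c) :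
    PolyTime (fun z => Env.constraintForm (c z)) := by
  unfold Env.constraintForm; fun_prop

@[fun_prop]
theorem env_isTrue (he : PolyTime e) (hk : PolyTime k) (hs : PolyTime s) :
    PolyTime (fun z => (e z).isTrue nAg nAct (k z) (s z)) := by
  unfold Env.isTrue; fun_prop

@[fun_prop]
theorem env_argLast (hk : PolyTime k) :
    PolyTime (fun z => Env.argLast (k z)) := by
  unfold Env.argLast; fun_prop

@[fun_prop]
theorem env_argFirst (he : PolyTime e) (hk : PolyTime k) :
    PolyTime (fun z => (e z).argFirst (k z)) := by
  unfold Env.argFirst; fun_prop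

@[fun_prop]
theorem env_tableEntryForm (he : PolyTime e) (hk : PolyTime k) (hs : PolyTime s) :
    PolyTime (fun z => (e z).tableEntryForm nAg nAct (k z) (s z)) := by
  unfold Env.tableEntryForm; fun_prop

@[fun_prop]
theorem env_premise (he : PolyTime e) :
    PolyTime (fun z => (e z).premise nAg nAct) := by
  unfold Env.premise; fun_prop

@[fun_prop]
theorem env_schedulerForm (he : PolyTime e) (hj : PolyTime j) (hk : PolyTime k) (hs : PolyTime s)
    (ha : PolyTime a) :
    PolyTime (fun z => (e z).schedulerForm nAg nAct (j z) (k z) (s z) (a z)) := by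
  unfold Env.schedulerForm; fun_prop

@[fun_prop]
theorem env_strategyForm (he : PolyTime e) (hj : PolyTime j) (hk : PolyTime k) (hs : PolyTime s) :
    PolyTime (fun z => (e z).strategyForm nAg nAct (j z) (k z) (s z)) := by
  unfold Env.strategyForm; fun_prop

@[fun_prop]
theorem env_modes (he : PolyTime e) (hk : PolyTime k) :
    PolyTime (fun z => (e z).modes nAg (k z)) := by
  unfold Env.modes; fun_prop

@[fun_prop]
theorem env_confs (he : PolyTime e) (hk : PolyTime k) :
    PolyTime (fun z => (e z).confs nAg (k z)) := by
  unfold Env.confs; fun_prop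

@[fun_prop]
theorem env_moves (he : PolyTime e) (hs : PolyTime s) :
    PolyTime (fun z => (e z).moves nAg nAct (s z)) := by
  unfold Env.moves; fun_prop

@[fun_prop]
theorem env_playExpr (he : PolyTime e) (hj : PolyTime j) (hk : PolyTime k) (hs : PolyTime s)
    (hc : PolyTime c) (hβ : PolyTime β) (hγ : PolyTime γ) (ha : PolyTime a) :
    PolyTime (fun z => (e z).playExpr nAg nAct (j z) (k z) (s z) (c z) (β z) (γ z) (a z)) := by
  unfold Env.playExpr; fun_prop

@[fun_prop]
theorem env_modeExpr {q' : α → List ℕ} (he : PolyTime e) (hj : PolyTime j) (hk : PolyTime k)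
    (hs : PolyTime s) (hc : PolyTime c) (hq' : PolyTime q') (ha : PolyTime a) :
    PolyTime (fun z => (e z).modeExpr nAg nAct (j z) (k z) (s z) (c z) (q' z) (a z)) := by
  unfold Env.modeExpr; fun_prop

@[fun_prop]
theorem env_moveExpr (he : PolyTime e) (hj : PolyTime j) (hk : PolyTime k) (hs : PolyTime s)
    (hc : PolyTime c) (hβ : PolyTime β) (hc' : PolyTime c') :
    PolyTime (fun z => (e z).moveExpr nAg nAct (j z) (k z) (s z) (c z) (β z) (c' z)) := by
  unfold Env.moveExpr; fun_prop

@[fun_prop]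
theorem env_rewardExpr (he : PolyTime e) (hk : PolyTime k) (hc : PolyTime c) :
    PolyTime (fun z => (e z).rewardExpr nAg nAct (k z) (c z)) := by
  unfold Env.rewardExpr; fun_prop

@[fun_prop]
theorem env_expectExpr (he : PolyTime e) (hj : PolyTime j) (hk : PolyTime k) (hs : PolyTime s)
    (hc : PolyTime c) (hβ : PolyTime β) :
    PolyTime (fun z => (e z).expectExpr nAg nAct (j z) (k z) (s z) (c z) (β z)) := by
  unfold Env.expectExpr; fun_prop

@[fun_prop]
theorem env_isMax (he : PolyTime e) (hk : PolyTime k) :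
    PolyTime (fun z => (e z).isMax (k z)) := by
  unfold Env.isMax; fun_prop

@[fun_prop]
theorem env_optForm (he : PolyTime e) (hj : PolyTime j) (hk : PolyTime k) (hs : PolyTime s)
    (hc : PolyTime c) :
    PolyTime (fun z => (e z).optForm nAg nAct (j z) (k z) (s z) (c z)) := by
  unfold Env.optForm; fun_prop

@[fun_prop]
theorem env_descentForm (he : PolyTime e) (hj : PolyTime j) (hk : PolyTime k) (hs : PolyTime s)
    (hc : PolyTime c) (hβ : PolyTime β) :
    PolyTime (fun z => (e z).descentForm nAg nAct (j z) (k z) (s z) (c z) (β z)) := by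
  unfold Env.descentForm; fun_prop

@[fun_prop]
theorem env_progressForm (he : PolyTime e) (hj : PolyTime j) (hk : PolyTime k) (hs : PolyTime s)
    (hc : PolyTime c) :
    PolyTime (fun z => (e z).progressForm nAg nAct (j z) (k z) (s z) (c z)) := by
  unfold Env.progressForm; fun_prop

@[fun_prop]
theorem env_argForm (he : PolyTime e) (hk : PolyTime k) (hi : PolyTime i) (hs : PolyTime s) :
    PolyTime (fun z => (e z).argForm nAg nAct (k z) (i z) (s z)) := by
  unfold Env.argForm; fun_prop

@[fun_prop]
theorem env_confForm (he : PolyTime e) (hj : PolyTime j) (hk : PolyTime k) (hs : PolyTime s)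
    (hc : PolyTime c) :
    PolyTime (fun z => (e z).confForm nAg nAct (j z) (k z) (s z) (c z)) := by
  unfold Env.confForm; fun_prop

@[fun_prop]
theorem env_certForm (he : PolyTime e) (hj : PolyTime j) (hk : PolyTime k) (hs : PolyTime s) :
    PolyTime (fun z => (e z).certForm nAg nAct (j z) (k z) (s z)) := by
  unfold Env.certForm; fun_prop

@[fun_prop]
theorem env_startExpr {q : α → List ℕ} (he : PolyTime e) (hj : PolyTime j) (hk : PolyTime k)
    (hs : PolyTime s) (hq : PolyTime q) (ha : PolyTime a) :
    PolyTime (fun z => (e z).startExpr nAg nAct (j z) (k z) (s z) (q z) (a z)) := by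
  unfold Env.startExpr; fun_prop

@[fun_prop]
theorem env_probExpr (he : PolyTime e) (hj : PolyTime j) (hk : PolyTime k) (hs : PolyTime s) :
    PolyTime (fun z => (e z).probExpr nAg nAct (j z) (k z) (s z)) := by
  unfold Env.probExpr; fun_prop

@[fun_prop]
theorem env_boundedExpr (he : PolyTime e) (hj : PolyTime j) (hk : PolyTime k) (hs : PolyTime s) :
    PolyTime (fun z => (e z).boundedExpr nAg nAct (j z) (k z) (s z)) := by
  unfold Env.boundedExpr; fun_prop

@[fun_prop]
theorem env_cmpForm (he : PolyTime e) (hj : PolyTime j) (hk : PolyTime k) (hs : PolyTime s) :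
    PolyTime (fun z => (e z).cmpForm nAg nAct (j z) (k z) (s z)) := by
  unfold Env.cmpForm; fun_prop

@[fun_prop]
theorem env_refuteForm (he : PolyTime e) (hk : PolyTime k) (hs : PolyTime s) :
    PolyTime (fun z => (e z).refuteForm nAg nAct (k z) (s z)) := by
  unfold Env.refuteForm; fun_prop

@[fun_prop]
theorem env_sentence (he : PolyTime e) :
    PolyTime (fun z => (e z).sentence nAg nAct) := by
  unfold Env.sentence; fun_prop

end PolyTime


/-! ## From instances to nested lists -/

/-- The membership bits of a coalition. -/
def memberBits {n : ℕ} (C : Finset (Fin n)) : List Bool := List.ofFn fun i => decide (i ∈ C)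

def Cmp.num : Cmp → ℕ
  | .le => 0
  | .lt => 1
  | .gt => 2
  | .ge => 3

def CmpEq.num : CmpEq → ℕ
  | .lt => 0
  | .gt => 1
  | .le => 2
  | .ge => 3
  | .eq => 4

/-- The subformulas, arguments first. -/
def PATL.flatten {nAg nAP : ℕ} : PATL nAg nAP → List Node
  | .atom p => [(0, [], 0, 0, p.val)]
  | .or φ ψ => φ.flatten ++ (ψ.flatten ++ [(1, [], 0, 0, ψ.flatten.length)])
  | .not φ => φ.flatten ++ [(2, [], 0, 0, 0)]
  | .next C r d φ => φ.flatten ++ [(3, memberBits C, r.num, d.1, 0)]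
  | .untl C r d φ ψ =>
    φ.flatten ++ (ψ.flatten ++ [(4, memberBits C, r.num, d.1, ψ.flatten.length)])
  | .release C r d φ ψ =>
    φ.flatten ++ (ψ.flatten ++ [(5, memberBits C, r.num, d.1, ψ.flatten.length)])

instance (nAg nAP : ℕ) : Coded (PATL nAg nAP) := ⟨Code.patl nAg nAP⟩

instance (nAg nAct nAP : ℕ) : Coded (ParamMCInstance nAg nAct nAP) :=
  ⟨Code.paramMCInstance nAg nAct nAP⟩

/-! ### Flattening formulas on the level of codes -/

namespace PolyTime

/-- The code of a node. -/
def nodeData (t C r d o : Data) : Data := .cons t (.cons C (.cons r (.cons d o)))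

/-- A tree, the nodes of the formula that it codes, and the same for the subtrees that may be
arguments of that formula. -/
abbrev FlatState : Type :=
  Data × List Data × List Data × List Data × List Data × List Data

/-- Depending on the tag, the arguments of a formula with body `y` are coded by `y.fst` and `y.snd`,
by `y`, by `y.snd`, or by `y.snd.fst` and `y.snd.snd`. Iteration along the tree yields results for
direct subtrees only, so the state also remembers those for subtrees at depth two. -/
def flatStep (t u : FlatState) : FlatState :=
  (.cons t.1 u.1,
    (bif t.1.isNil then [nodeData t.1 .nil .nil (cenc (0 : ℚ)) u.1]
    else bif t.1.snd.isNil then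
      u.2.2.1 ++ (u.2.2.2.1 ++ [nodeData t.1 .nil .nil (cenc (0 : ℚ)) (cenc u.2.2.2.1.length)])
    else bif t.1.snd.snd.isNil then u.2.1 ++ [nodeData t.1 .nil .nil (cenc (0 : ℚ)) .nil]
    else bif t.1.snd.snd.snd.isNil then
      u.2.2.2.1 ++ [nodeData t.1 u.1.fst.fst u.1.fst.snd.fst u.1.fst.snd.snd .nil]
    else u.2.2.2.2.1 ++ (u.2.2.2.2.2 ++ [nodeData t.1 u.1.fst.fst u.1.fst.snd.fst u.1.fst.snd.snd
      (cenc u.2.2.2.2.2.length)])),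
    t.2.1, u.2.1, u.2.2.1, u.2.2.2.1)

def flatState : Data → FlatState := Data.cata (.nil, [], [], [], [], []) flatStep

def flatData (x : Data) : List Data := (flatState x).2.1

theorem flatState_eq (x : Data) : flatState x = (x, flatData x, flatData x.fst, flatData x.snd,
    flatData x.snd.fst, flatData x.snd.snd) := by
  have h1 : ∀ x, (flatState x).1 = x := by
    intro x
    induction x with
    | nil => rfl
    | cons x y hx hy =>
      change Data.cons (flatState x).1 (flatState y).1 = _
      rw [hx, hy]
  have h2 : ∀ x, (flatState x).2.2.1 = flatData x.fst ∧
      (flatState x).2.2.2.1 = flatData x.snd := by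
    intro x; cases x <;> exact ⟨rfl, rfl⟩
  have h3 : (flatState x).2.2.2.2 = (flatData x.snd.fst, flatData x.snd.snd) := by
    cases x with
    | nil => rfl
    | cons x y =>
      change ((flatState y).2.2.1, (flatState y).2.2.2.1) = _
      rw [(h2 y).1, (h2 y).2]
      rfl
  refine Prod.ext (h1 x) (Prod.ext rfl (Prod.ext (h2 x).1 (Prod.ext (h2 x).2 h3)))

theorem flatData_cons (x y : Data) : flatData (.cons x y) =
    (bif x.isNil then [nodeData x .nil .nil (cenc (0 : ℚ)) y]
    else bif x.snd.isNil then flatData y.fst ++ (flatData y.snd ++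
      [nodeData x .nil .nil (cenc (0 : ℚ)) (cenc (flatData y.snd).length)])
    else bif x.snd.snd.isNil then flatData y ++ [nodeData x .nil .nil (cenc (0 : ℚ)) .nil]
    else bif x.snd.snd.snd.isNil then
      flatData y.snd ++ [nodeData x y.fst.fst y.fst.snd.fst y.fst.snd.snd .nil]
    else flatData y.snd.fst ++ (flatData y.snd.snd ++ [nodeData x y.fst.fst y.fst.snd.fst
      y.fst.snd.snd (cenc (flatData y.snd.snd).length)])) := by
  change (flatStep (flatState x) (flatState y)).2.1 = _
  rw [flatState_eq x, flatState_eq y]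
  rfl

theorem size_fst_add_snd (x : Data) : x.fst.size + x.snd.size ≤ x.size + 1 := by
  cases x
  · simp [Data.fst, Data.snd, Data.size]
  · simp only [Data.fst, Data.snd, Data.size]; omega

/-- Squares are superadditive, with a linear term to spare: quadratic bounds for two disjoint
subtrees leave room for one more node of linear size. -/
theorem sq_add_sq_add_le {a b x y : ℕ} (h : a + b ≤ y + 1) (hx : 0 < x) :
    a ^ 2 + b ^ 2 + (x + y) ≤ (x + y + 1) ^ 2 := by
  have h1 : a ^ 2 + b ^ 2 ≤ (y + 1) ^ 2 :=
    calc a ^ 2 + b ^ 2 ≤ (a + b) ^ 2 := by nlinarith [Nat.zero_le (a * b)]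
      _ ≤ _ := Nat.pow_le_pow_left h 2
  have h2 : (x + y + 1) ^ 2 = (y + 1) ^ 2 + (x * x + 2 * (x * (y + 1))) := by ring
  have h3 : y + 1 ≤ x * (y + 1) := Nat.le_mul_of_pos_left _ hx
  have h4 : x ≤ x * (y + 1) := Nat.le_mul_of_pos_right _ (by omega)
  omega

theorem length_flatData (x : Data) : (flatData x).length ≤ x.size := by
  induction hn : x.size using Nat.strong_induction_on generalizing x with
  | _ n ih =>
  subst hn
  cases x with
  | nil => simp [flatData, flatState, Data.cata]
  | cons x y =>
    have key : ∀ z : Data, z.size ≤ y.size → (flatData z).length ≤ z.size := fun z hz =>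
      ih z.size (by simp only [Data.size]; omega) z rfl
    have k0 := key y le_rfl
    have k1 := key y.fst y.size_fst_le
    have k2 := key y.snd y.size_snd_le
    have k3 := key y.snd.fst (y.snd.size_fst_le.trans y.size_snd_le)
    have k4 := key y.snd.snd (y.snd.size_snd_le.trans y.size_snd_le)
    have s1 := size_fst_add_snd y
    have s2 := size_fst_add_snd y.snd
    have s3 := y.size_snd_le
    have s4 := x.size_pos
    rw [flatData_cons]
    cases x.isNil
    · cases x.snd.isNil
      · cases x.snd.snd.isNil
        · cases x.snd.snd.snd.isNil <;>
            simp only [cond_true, cond_false, List.length_append, List.length_singleton,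
              Data.size] <;> omega
        · simp only [cond_true, cond_false, List.length_append, List.length_singleton,
            Data.size]; omega
      · simp only [cond_true, cond_false, List.length_append, List.length_singleton,
          Data.size]; omega
    · simp [Data.size]

/-- A node has linear size, including its offset in unary, and the arguments are disjoint parts of
the tree. So the total grows at most quadratically. -/
theorem csize_flatData : ∃ K : ℕ, ∀ x : Data, csize (flatData x) ≤ K * x.size ^ 2 := by
  refine ⟨csize (0 : ℚ) + 30, fun x => ?_⟩
  set K := csize (0 : ℚ) + 30 with hK
  induction hn : x.size using Nat.strong_induction_on generalizing x with
  | _ n ih =>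
  subst hn
  cases x with
  | nil =>
    change 1 ≤ K * 1 ^ 2
    omega
  | cons x y =>
    have key : ∀ z : Data, z.size ≤ y.size → csize (flatData z) ≤ K * z.size ^ 2 := fun z hz =>
      ih z.size (by simp only [Data.size]; omega) z rfl
    have k0 := key y le_rfl
    have k1 := key y.fst y.size_fst_le
    have k2 := key y.snd y.size_snd_le
    have k3 := key y.snd.fst (y.snd.size_fst_le.trans y.size_snd_le)
    have k4 := key y.snd.snd (y.snd.size_snd_le.trans y.size_snd_le)
    have s1 := size_fst_add_snd y
    have s2 := size_fst_add_snd y.snd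
    have s3 := y.size_snd_le
    have s4 := x.size_pos
    have s5 := y.size_pos
    -- the node itself is small
    have hnode : ∀ (C r d o : Data), C.size ≤ 2 * y.size → r.size ≤ 2 * y.size →
        d.size ≤ y.size + csize (0 : ℚ) → o.size ≤ 2 * y.size + 1 →
        csize [nodeData x C r d o] ≤ K * (x.size + y.size) := by
      intro C r d o h1 h2 h3 h4
      change (x.size + (C.size + (r.size + (d.size + o.size + 1) + 1) + 1) + 1) + 1 + 1 ≤ _
      have e : K * (x.size + y.size) = csize (0 : ℚ) * (x.size + y.size) +
        30 * (x.size + y.size) := by rw [hK]; ring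
      have : csize (0 : ℚ) * 1 ≤ csize (0 : ℚ) * (x.size + y.size) :=
        Nat.mul_le_mul_left _ (by omega)
      omega
    have hq : (cenc (0 : ℚ)).size = csize (0 : ℚ) := rfl
    have hnil : Data.nil.size = 1 := rfl
    have hl : ∀ z : Data, (cenc (flatData z).length).size ≤ 2 * z.size + 1 := by
      intro z
      have := length_flatData z
      change csize _ ≤ _
      rw [csize_nat]; omega
    -- two disjoint arguments and one node
    have two : ∀ (z w : Data) (v : Data), z.size + w.size ≤ y.size + 1 →
        csize (flatData z) ≤ K * z.size ^ 2 → csize (flatData w) ≤ K * w.size ^ 2 →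
        csize [v] ≤ K * (x.size + y.size) →
        csize (flatData z ++ (flatData w ++ [v])) ≤ K * (x.size + y.size + 1) ^ 2 := by
      intro z w v h1 h2 h3 h4
      have e1 := csize_append (flatData z) (flatData w ++ [v])
      have e2 := csize_append (flatData w) [v]
      have h5 := sq_add_sq_add_le (x := x.size) (y := y.size) h1 s4
      have h6 := Nat.mul_le_mul_left K h5
      rw [mul_add, mul_add] at h6
      omega
    have one : ∀ (z v : Data), z.size ≤ y.size → csize (flatData z) ≤ K * z.size ^ 2 →
        csize [v] ≤ K * (x.size + y.size) →
        csize (flatData z ++ [v]) ≤ K * (x.size + y.size + 1) ^ 2 := by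
      intro z v h1 h2 h4
      have e1 := csize_append (flatData z) [v]
      have h5 := sq_add_sq_add_le (a := z.size) (b := 0) (x := x.size) (y := y.size)
        (by omega) s4
      simp only [ne_eq, OfNat.ofNat_ne_zero, not_false_eq_true, zero_pow, add_zero] at h5
      have h6 := Nat.mul_le_mul_left K h5
      rw [mul_add] at h6
      omega
    have f1 := y.fst.size_fst_le
    have f2 := y.fst.snd.size_fst_le
    have f3 := y.fst.snd.size_snd_le
    have f4 := y.fst.size_snd_le
    have f5 := y.size_fst_le
    have f6 := y.snd.size_snd_le
    have l1 := hl y.snd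
    have l2 := hl y.snd.snd
    rw [flatData_cons]
    simp only [Data.size]
    cases x.isNil
    · cases x.snd.isNil
      · cases x.snd.snd.isNil
        · cases x.snd.snd.snd.isNil
          · exact two _ _ _ (by omega) k3 k4 (hnode _ _ _ _ (by omega) (by omega) (by omega)
              (by omega))
          · exact one _ _ s3 k2 (hnode _ _ _ _ (by omega) (by omega) (by omega) (by omega))
        · exact one _ _ le_rfl k0 (hnode _ _ _ _ (by omega) (by omega) (by omega) (by omega))
      · exact two _ _ _ s1 k1 k2 (hnode _ _ _ _ (by omega) (by omega) (by omega) (by omega))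
    · refine (hnode _ _ _ _ (by omega) (by omega) (by omega) (by omega)).trans ?_
      refine Nat.mul_le_mul_left K ?_
      have := sq_add_sq_add_le (a := 0) (b := 0) (x := x.size) (y := y.size) (by omega) s4
      omega

theorem polyTime_flatData : PolyTime flatData := by
  obtain ⟨K, hK⟩ := csize_flatData
  have h : PolyTime flatState := by
    refine cata (z := fun _ => ((.nil, [], [], [], [], []) : FlatState)) (g := fun _ => flatStep)
      (const _) ?_ id' ⟨Polynomial.X + 5 * (Polynomial.C K * Polynomial.X ^ 2) + 10,
        fun a x => ?_⟩
    · unfold flatStep nodeData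
      have hl : PolyTime (fun p : (Data × FlatState) × FlatState => cenc p.2.2.2.2.1.length) :=
        toData.comp (by fun_prop)
      have hl' : PolyTime (fun p : (Data × FlatState) × FlatState =>
          cenc p.2.2.2.2.2.2.length) := toData.comp (by fun_prop)
      refine prodMk (by fun_prop) (prodMk (cond (by fun_prop) (by fun_prop) (cond (by fun_prop)
        (list_append (by fun_prop) (list_append (by fun_prop) (list_cons ?_ (by fun_prop))))
        (cond (by fun_prop) (by fun_prop) (cond (by fun_prop) (by fun_prop)
          (list_append (by fun_prop) (list_append (by fun_prop) (list_cons ?_ (by fun_prop))))))))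
        (by fun_prop))
      · exact data_cons (by fun_prop) (data_cons (by fun_prop) (data_cons (by fun_prop)
          (data_cons (by fun_prop) hl)))
      · exact data_cons (by fun_prop) (data_cons (by fun_prop) (data_cons (by fun_prop)
          (data_cons (by fun_prop) hl')))
    · change csize (flatState x) ≤ _
      rw [flatState_eq]
      have key : ∀ z : Data, z.size ≤ x.size →
          csize (flatData z) ≤ K * (csize (a, x)) ^ 2 := by
        intro z hz
        refine (hK z).trans (Nat.mul_le_mul_left K (Nat.pow_le_pow_left ?_ 2))
        change _ ≤ csize a + x.size + 1
        omega
      have k0 := key x le_rfl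
      have k1 := key x.fst x.size_fst_le
      have k2 := key x.snd x.size_snd_le
      have k3 := key x.snd.fst (x.snd.size_fst_le.trans x.size_snd_le)
      have k4 := key x.snd.snd (x.snd.size_snd_le.trans x.size_snd_le)
      have hx : csize x + csize a + 1 = csize (a, x) := by rw [csize_pair]; omega
      simp only [csize_pair x, csize_pair (flatData _), Polynomial.eval_add, Polynomial.eval_mul,
        Polynomial.eval_X, Polynomial.eval_ofNat, Polynomial.eval_C, Polynomial.eval_pow]
      omega
  unfold flatData
  fun_prop

theorem cenc_map_cenc {α : Type} [Coded α] (l : List α) : cenc (l.map cenc) = cenc l := by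
  induction l with
  | nil => rfl
  | cons a l ih => rw [List.map_cons, cenc_cons, ih]; rfl

theorem flatData_cenc {nAg nAP : ℕ} (φ : PATL nAg nAP) :
    flatData (cenc φ) = φ.flatten.map cenc := by
  induction φ with
  | atom p => change flatData (.cons (cenc 0) (cenc p.val)) = _; rw [flatData_cons]; rfl
  | or φ ψ h1 h2 =>
    change flatData (.cons (cenc 1) (.cons (cenc φ) (cenc ψ))) = _
    rw [flatData_cons]
    simp only [Data.fst, Data.snd, h1, h2, List.length_map, PATL.flatten, List.map_append]
    rfl
  | not φ h =>
    change flatData (.cons (cenc 2) (cenc φ)) = _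
    rw [flatData_cons]
    simp only [h, PATL.flatten, List.map_append]
    rfl
  | next C r d φ h =>
    change flatData (.cons (cenc 3) (.cons ((Code.coalitionOp nAg).enc (C, r, d)) (cenc φ))) = _
    rw [flatData_cons]
    simp only [Data.snd, h, PATL.flatten, List.map_append]
    cases r <;> rfl
  | untl C r d φ ψ h1 h2 =>
    change flatData (.cons (cenc 4) (.cons ((Code.coalitionOp nAg).enc (C, r, d))
      (.cons (cenc φ) (cenc ψ)))) = _
    rw [flatData_cons]
    simp only [Data.fst, Data.snd, h1, h2, List.length_map, PATL.flatten, List.map_append]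
    cases r <;> rfl
  | release C r d φ ψ h1 h2 =>
    change flatData (.cons (cenc 5) (.cons ((Code.coalitionOp nAg).enc (C, r, d))
      (.cons (cenc φ) (cenc ψ)))) = _
    rw [flatData_cons]
    simp only [Data.fst, Data.snd, h1, h2, List.length_map, PATL.flatten, List.map_append]
    cases r <;> rfl

theorem flatten {nAg nAP : ℕ} : PolyTime (PATL.flatten (nAg := nAg) (nAP := nAP)) :=
  of_cenc (g := fun φ : PATL nAg nAP => flatData (cenc φ)) (polyTime_flatData.comp toData)
    fun φ => by
      rw [flatData_cenc, cenc_map_cenc]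

end PolyTime

/-! ### Codes of instances -/

section Instances

variable {nAg nAct nAP : ℕ}

/-- The part of an instance without the formula, as nested lists. -/
def ParamMCInstance.raw (I : ParamMCInstance nAg nAct nAP) : RawSystem :=
  (I.sys.nS, I.sys.nX, List.ofFn I.sys.nO,
    List.ofFn fun s => List.ofFn fun a => memberBits (I.sys.legal s a),
    List.ofFn fun s => memberBits (I.sys.label s),
    List.ofFn fun a => List.ofFn fun s => (I.sys.obs a s : ℕ),
    List.ofFn fun s => List.ofFn fun i : Fin (nAct ^ nAg) => List.ofFn fun s' =>
      ((I.sys.trans s (finFunctionFinEquiv.symm i) s').num.rename Fin.val,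
        (I.sys.trans s (finFunctionFinEquiv.symm i) s').den.rename Fin.val),
    I.sys.constraints.map fun c => (c.lhs.rename Fin.val, c.rel.num, c.rhs.rename Fin.val),
    I.state, I.bound)

def ParamMCInstance.env (I : ParamMCInstance nAg nAct nAP) : Env := (I.raw, I.formula.flatten)

theorem cenc_rename {n : ℕ} (f : PolyExpr (Fin n)) :
    (PolyExpr.code (Code.fin n)).enc f = cenc (f.rename Fin.val) := by
  induction f with
  | const c => rfl
  | var v => rfl
  | add f g hf hg =>
    change Data.cons _ (.cons ((PolyExpr.code (Code.fin n)).enc f)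
      ((PolyExpr.code (Code.fin n)).enc g)) = _
    rw [hf, hg]; rfl
  | mul f g hf hg =>
    change Data.cons _ (.cons ((PolyExpr.code (Code.fin n)).enc f)
      ((PolyExpr.code (Code.fin n)).enc g)) = _
    rw [hf, hg]; rfl

theorem encList_congr {α β : Type} {f : α → Data} {g : β → Data} {h : α → β}
    (H : ∀ a, f a = g (h a)) (l : List α) : Code.encList f l = Code.encList g (l.map h) := by
  induction l with
  | nil => rfl
  | cons a l ih => simp only [Code.encList, List.map_cons, H, ih]

theorem encList_ofFn {α β : Type} {n : ℕ} {f : α → Data} {g : β → Data} {u : Fin n → α}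
    {v : Fin n → β} (H : ∀ i, f (u i) = g (v i)) :
    Code.encList f (List.ofFn u) = Code.encList g (List.ofFn v) := by
  induction n with
  | zero => simp [Code.encList]
  | succ n ih =>
    rw [List.ofFn_succ, List.ofFn_succ]
    simp only [Code.encList]
    rw [H 0, ih fun i => H i.succ]

/-- Typed instances and nested lists over the natural numbers have the same codes, so passing from
one to the other is the identity on trees. Only the formula must really be transformed. -/
theorem cenc_instance (I : ParamMCInstance nAg nAct nAP) : cenc I =
    cenc (I.raw.1, I.raw.2.1, I.raw.2.2.1, I.raw.2.2.2.1, I.raw.2.2.2.2.1, I.raw.2.2.2.2.2.1,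
      I.raw.2.2.2.2.2.2.1, I.raw.2.2.2.2.2.2.2.1, I.raw.2.2.2.2.2.2.2.2.1,
      I.raw.2.2.2.2.2.2.2.2.2, I.formula) := by
  have h1 : (Code.finFun _ (Code.finFun nAg (Code.finset nAct))).enc I.sys.legal =
      cenc (List.ofFn fun s => List.ofFn fun a => memberBits (I.sys.legal s a)) :=
    encList_ofFn fun s => encList_ofFn fun a => rfl
  have h2 : (Code.finFun _ (Code.finset nAP)).enc I.sys.label =
      cenc (List.ofFn fun s => memberBits (I.sys.label s)) := encList_ofFn fun s => rfl
  have h3 : (Code.finFun nAg (Code.finFun _ Code.unary)).enc (fun a s => (I.sys.obs a s : ℕ)) =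
      cenc (List.ofFn fun a => List.ofFn fun s => (I.sys.obs a s : ℕ)) :=
    encList_ofFn fun a => rfl
  have h4 : (Code.finFun _ (Code.profileFun nAg nAct (Code.finFun _ (Code.ratFun _)))).enc
      I.sys.trans = cenc (List.ofFn fun s => List.ofFn fun i : Fin (nAct ^ nAg) =>
        List.ofFn fun s' =>
        ((I.sys.trans s (finFunctionFinEquiv.symm i) s').num.rename Fin.val,
          (I.sys.trans s (finFunctionFinEquiv.symm i) s').den.rename Fin.val)) := by
    refine encList_ofFn fun s => encList_ofFn fun i => encList_ofFn fun s' => ?_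
    change Data.cons ((PolyExpr.code _).enc _) ((PolyExpr.code _).enc _) = _
    rw [cenc_rename, cenc_rename]
    rfl
  have h5 : (Code.polyConstraint _).list.enc I.sys.constraints =
      cenc (I.sys.constraints.map fun c =>
        (c.lhs.rename Fin.val, c.rel.num, c.rhs.rename Fin.val)) := by
    refine encList_congr (fun c => ?_) _
    change Data.cons ((PolyExpr.code _).enc _)
      (Data.cons (Code.cmpEq.enc c.rel) ((PolyExpr.code _).enc _)) = _
    rw [cenc_rename, cenc_rename]
    cases c.rel <;> rfl
  change Data.cons _ (.cons _ (.cons _ (.cons _ (.cons _ (.cons _ (.cons _ (.cons _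
    (.cons _ (.cons _ _))))))))) = _
  rw [h1, h2, h3, h4, h5]
  rfl

theorem PolyTime.sentence : PolyTime (fun I : ParamMCInstance nAg nAct nAP =>
    I.env.sentence nAg nAct) := by
  have h : PolyTime (fun t : ℕ × ℕ × List ℕ × List (List (List Bool)) × List (List Bool) ×
      List (List ℕ) × List (List (List (PolyExpr ℕ × PolyExpr ℕ))) ×
      List (PolyExpr ℕ × ℕ × PolyExpr ℕ) × ℕ × ℕ × PATL nAg nAP =>
      ((t.1, t.2.1, t.2.2.1, t.2.2.2.1, t.2.2.2.2.1, t.2.2.2.2.2.1, t.2.2.2.2.2.2.1,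
        t.2.2.2.2.2.2.2.1, t.2.2.2.2.2.2.2.2.1, t.2.2.2.2.2.2.2.2.2.1),
        t.2.2.2.2.2.2.2.2.2.2.flatten)) :=
    prodMk (by fun_prop) (flatten.comp (by fun_prop))
  have hI : PolyTime (fun I : ParamMCInstance nAg nAct nAP => (I.raw.1, I.raw.2.1, I.raw.2.2.1,
      I.raw.2.2.2.1, I.raw.2.2.2.2.1, I.raw.2.2.2.2.2.1, I.raw.2.2.2.2.2.2.1,
      I.raw.2.2.2.2.2.2.2.1, I.raw.2.2.2.2.2.2.2.2.1, I.raw.2.2.2.2.2.2.2.2.2, I.formula)) :=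
    of_cenc id' fun I => (cenc_instance I).symm
  exact env_sentence nAg nAct (h.comp hI)

end Instances


/-! ## The meaning of the parts of the sentence -/

section Lists

theorem getD_ofFn {α : Type} {n : ℕ} (f : Fin n → α) (i : Fin n) (d : α) :
    (List.ofFn f).getD i d = f i := by
  simp [List.getD_eq_getElem?_getD]

theorem forall_mem_range {n : ℕ} {Q : ℕ → Prop} :
    (∀ i ∈ List.range n, Q i) ↔ ∀ i : Fin n, Q i :=
  ⟨fun h i => h i (List.mem_range.2 i.2), fun h i hi => h ⟨i, List.mem_range.1 hi⟩⟩

theorem exists_mem_range {n : ℕ} {Q : ℕ → Prop} :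
    (∃ i ∈ List.range n, Q i) ↔ ∃ i : Fin n, Q i :=
  ⟨fun ⟨i, hi, h⟩ => ⟨⟨i, List.mem_range.1 hi⟩, h⟩, fun ⟨i, h⟩ => ⟨i, List.mem_range.2 i.2, h⟩⟩

theorem sum_map_range (n : ℕ) (f : ℕ → ℝ) : ((List.range n).map f).sum = ∑ i : Fin n, f i := by
  rw [← Finset.sum_range f]; rfl

theorem prod_map_range (n : ℕ) (f : ℕ → ℝ) :
    ((List.range n).map f).prod = ∏ i : Fin n, f i := by
  rw [← Finset.prod_range f]; rfl

theorem mem_choices {n : ℕ} : ∀ {L : List (List ℕ)} {l : List ℕ},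
    l ∈ choices n L ↔ l.length = n ∧ ∀ i < n, l.getD i 0 ∈ L.getD i [] := by
  induction n with
  | zero => intro L l; simp [choices, List.length_eq_zero_iff]
  | succ n ih =>
    intro L l
    simp only [choices, List.mem_flatMap, List.mem_map, ih]
    constructor
    · rintro ⟨a, ha, l', ⟨h1, h2⟩, rfl⟩
      refine ⟨by simp [h1], fun i hi => ?_⟩
      cases i with
      | zero => cases L <;> simpa using ha
      | succ i =>
        have := h2 i (by omega)
        cases L <;> simpa using this
    · rintro ⟨h1, h2⟩
      cases l with
      | nil => simp at h1
      | cons a l =>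
        refine ⟨a, ?_, l, ⟨by simpa using h1, fun i hi => ?_⟩, rfl⟩
        · have := h2 0 (by omega)
          cases L <;> simpa using this
        · have := h2 (i + 1) (by omega)
          cases L <;> simpa using this

theorem nodup_choices {n : ℕ} : ∀ {L : List (List ℕ)}, (∀ i < n, (L.getD i []).Nodup) →
    (choices n L).Nodup := by
  induction n with
  | zero => intro L _; simp [choices]
  | succ n ih =>
    intro L h
    have h0 : (L.headD []).Nodup := by
      have := h 0 (by omega)
      cases L <;> simpa using this
    have h1 : (choices n L.tail).Nodup := ih fun i hi => by
      have := h (i + 1) (by omega)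
      cases L <;> simpa using this
    unfold choices
    rw [List.nodup_flatMap]
    refine ⟨fun a _ => h1.map (List.cons_injective), ?_⟩
    refine h0.imp fun {a b} hab => ?_
    rw [Function.onFun, List.disjoint_left]
    intro l hl hl'
    obtain ⟨_, _, rfl⟩ := List.mem_map.1 hl
    obtain ⟨_, _, h⟩ := List.mem_map.1 hl'
    simp only [List.cons.injEq] at h
    exact hab h.1.symm

/-- Turns sums over the lists from which the sentence is built into sums over the finite types of
the semantics. -/
theorem perm_map_univ {α β : Type} [Fintype α] {f : α → β} (hf : Function.Injective f)
    {l : List β} (hl : l.Nodup) (h : ∀ b, b ∈ l ↔ ∃ a, f a = b) :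
    l.Perm ((Finset.univ : Finset α).toList.map f) := by
  rw [List.perm_ext_iff_of_nodup hl ((Finset.nodup_toList _).map hf)]
  intro b
  simp [h]

theorem sum_map_of_perm {α β : Type} [Fintype α] {f : α → β} {l : List β}
    (h : l.Perm ((Finset.univ : Finset α).toList.map f)) (g : β → ℝ) :
    (l.map g).sum = ∑ a, g (f a) := by
  rw [(h.map g).sum_eq, List.map_map]
  exact Finset.sum_map_toList _ _

end Lists

section Semantics

variable {nAg nAct nAP : ℕ}

/-- A profile as a list. -/
def rawProfile (α : Fin nAg → Fin nAct) : List ℕ := List.ofFn fun a => (α a).val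

theorem rawProfile_getD (α : Fin nAg → Fin nAct) (a : Fin nAg) (d : ℕ) :
    (rawProfile α).getD a d = α a := getD_ofFn _ a d

theorem profiles_eq : Env.profiles nAg nAct = List.ofFn fun i : Fin (nAct ^ nAg) =>
    (i.val, rawProfile (finFunctionFinEquiv.symm i)) := rfl

theorem sum_map_profiles (f : ℕ × List ℕ → ℝ) : ((Env.profiles nAg nAct).map f).sum =
    ∑ α : Fin nAg → Fin nAct, f (finFunctionFinEquiv α, rawProfile α) := by
  rw [profiles_eq, List.map_ofFn, List.sum_ofFn, ← Equiv.sum_comp finFunctionFinEquiv]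
  simp

theorem forall_mem_profiles {Q : ℕ × List ℕ → Prop} : (∀ p ∈ Env.profiles nAg nAct, Q p) ↔
    ∀ α : Fin nAg → Fin nAct, Q (finFunctionFinEquiv α, rawProfile α) := by
  rw [profiles_eq]
  simp only [List.forall_mem_ofFn_iff]
  constructor
  · intro h α
    simpa using h (finFunctionFinEquiv α)
  · intro h i
    simpa using h (finFunctionFinEquiv.symm i)

variable (I : ParamMCInstance nAg nAct nAP)

theorem env_nO_eq (a : Fin nAg) : I.env.nO a = I.sys.nO a := getD_ofFn _ a _

theorem env_legal_eq (s : Fin I.sys.nS) (a : Fin nAg) (x : Fin nAct) :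
    I.env.legal s a x = decide (x ∈ I.sys.legal s a) := by
  change (((List.ofFn _).getD (s : ℕ) []).getD (a : ℕ) []).getD (x : ℕ) false = _
  rw [getD_ofFn, getD_ofFn, memberBits, getD_ofFn]

theorem env_label_eq (s : Fin I.sys.nS) (p : Fin nAP) :
    I.env.label s p = decide (p ∈ I.sys.label s) := by
  change ((List.ofFn _).getD (s : ℕ) []).getD (p : ℕ) false = _
  rw [getD_ofFn, memberBits, getD_ofFn]

theorem env_obs_eq (a : Fin nAg) (s : Fin I.sys.nS) : I.env.obs a s = I.sys.obs a s := by
  change ((List.ofFn _).getD (a : ℕ) []).getD (s : ℕ) 0 = _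
  rw [getD_ofFn, getD_ofFn]

theorem env_trans_eq (s : Fin I.sys.nS) (α : Fin nAg → Fin nAct) (s' : Fin I.sys.nS) :
    I.env.trans s (finFunctionFinEquiv α) s' =
      ((I.sys.trans s α s').num.rename Fin.val, (I.sys.trans s α s').den.rename Fin.val) := by
  change (((List.ofFn _).getD (s : ℕ) []).getD ((finFunctionFinEquiv α : Fin _) : ℕ) []).getD
    (s' : ℕ) _ = _
  rw [getD_ofFn, getD_ofFn, getD_ofFn, Equiv.symm_apply_apply]

theorem listAll_iff (l : List Bool) : Env.listAll l = true ↔ ∀ x ∈ l, x = true := by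
  unfold Env.listAll
  induction l with
  | nil => simp
  | cons x l ih => simp only [List.foldr_cons, List.forall_mem_cons, ← ih]; cases x <;> simp

theorem legalProfile_iff (s : Fin I.sys.nS) (α : Fin nAg → Fin nAct) :
    I.env.legalProfile nAg s (rawProfile α) = true ↔ I.sys.toFrame.LegalProfile s α := by
  rw [Env.legalProfile, listAll_iff]
  simp only [List.forall_mem_map, forall_mem_range, rawProfile_getD, env_legal_eq,
    decide_eq_true_eq]
  rfl

theorem forall_mem_moves {Q : List ℕ → Prop} (s : Fin I.sys.nS) :
    (∀ β ∈ I.env.moves nAg nAct s, Q β) ↔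
      ∀ β : Fin nAg → Fin nAct, I.sys.toFrame.LegalProfile s β → Q (rawProfile β) := by
  unfold Env.moves
  simp only [List.mem_flatMap, forall_exists_index, and_imp]
  rw [forall_comm]
  simp only [forall_comm (α := List ℕ), forall_mem_profiles]
  refine forall_congr' fun α => ?_
  by_cases h : I.sys.toFrame.LegalProfile s α
  · simp [(legalProfile_iff I s α).2 h, h]
  · have : I.env.legalProfile nAg s (rawProfile α) = false := by
      rw [← Bool.not_eq_true, legalProfile_iff]; exact h
    simp [this, h]

theorem exists_mem_moves {Q : List ℕ → Prop} (s : Fin I.sys.nS) :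
    (∃ β ∈ I.env.moves nAg nAct s, Q β) ↔
      ∃ β : Fin nAg → Fin nAct, I.sys.toFrame.LegalProfile s β ∧ Q (rawProfile β) := by
  have h := not_congr (forall_mem_moves I (Q := fun β => ¬ Q β) s)
  push Not at h
  exact h

/-! ### Configurations -/

variable {C : Finset (Fin nAg)} {b : ℕ}

/-- The modes of a coalition as a list; agents outside have mode `0`. -/
def rawModes (q : C → Fin b) : List ℕ :=
  List.ofFn fun a : Fin nAg => if h : a ∈ C then (q ⟨a, h⟩).val else 0

theorem rawModes_getD (q : C → Fin b) (a : C) (d : ℕ) :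
    (rawModes q).getD (a : Fin nAg) d = q a := by
  rw [rawModes, getD_ofFn, dif_pos a.2]

theorem rawModes_injective : Function.Injective (rawModes (C := C) (b := b)) := by
  intro q q' h
  funext a
  apply Fin.ext
  rw [← rawModes_getD q a 0, ← rawModes_getD q' a 0, h]

def rawConf {n : ℕ} (c : Fin n × (C → Fin b)) : ℕ × List ℕ := (c.1, rawModes c.2)

theorem rawConf_injective {n : ℕ} : Function.Injective (rawConf (C := C) (b := b) (n := n)) := by
  rintro ⟨s, q⟩ ⟨s', q'⟩ h
  simp only [rawConf, Prod.mk.injEq] at h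
  rw [Fin.ext h.1, rawModes_injective h.2]

variable {I} {k : ℕ}

/-- An agent outside the coalition has the single dummy mode `0`, so lists of length `nAg`
correspond to the mode vectors of the coalition. -/
theorem modes_perm (hC : ∀ a : Fin nAg, I.env.mem k a = decide (a ∈ C)) :
    (I.env.modes nAg k).Perm
      ((Finset.univ : Finset (C → Fin I.bound)).toList.map rawModes) := by
  have hget : ∀ a : Fin nAg, ((List.range nAg).map fun a =>
      bif I.env.mem k a then List.range I.env.bound else [0]).getD a [] =
      if a ∈ C then List.range I.bound else [0] := by
    intro a
    rw [List.getD_eq_getElem?_getD, List.getElem?_map, List.getElem?_range a.2]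
    simp only [Option.map_some, Option.getD_some, hC]
    by_cases h : a ∈ C
    · simp [h]; rfl
    · simp [h]
  refine perm_map_univ rawModes_injective (nodup_choices fun i hi => ?_) fun l => ?_
  · rw [hget ⟨i, hi⟩]
    split_ifs
    · exact List.nodup_range
    · simp
  · unfold Env.modes
    rw [mem_choices]
    constructor
    · rintro ⟨h1, h2⟩
      have h3 : ∀ a : C, l.getD (a : Fin nAg) 0 < I.bound := by
        intro a
        have := h2 (a : Fin nAg) a.1.2
        rw [hget, if_pos a.2] at this
        exact List.mem_range.1 this
      refine ⟨fun a => ⟨l.getD (a : Fin nAg) 0, h3 a⟩, ?_⟩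
      refine List.ext_getElem (by simp [rawModes, h1]) fun i hi hi' => ?_
      have hi2 : i < nAg := by rw [← h1]; exact hi'
      have h4 := h2 i hi2
      rw [hget ⟨i, hi2⟩] at h4
      simp only [rawModes, List.getElem_ofFn]
      split_ifs with h
      · simp [List.getD_eq_getElem?_getD, hi']
      · rw [if_neg h] at h4
        simp only [List.getD_eq_getElem?_getD, List.getElem?_eq_getElem hi',
          Option.getD_some, List.mem_singleton] at h4
        exact h4.symm
    · rintro ⟨q, rfl⟩
      refine ⟨by simp [rawModes], fun i hi => ?_⟩
      rw [hget ⟨i, hi⟩]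
      have := getD_ofFn (fun a : Fin nAg => if h : a ∈ C then (q ⟨a, h⟩).val else 0) ⟨i, hi⟩ 0
      simp only at this
      rw [rawModes, this]
      split_ifs
      · exact List.mem_range.2 (Fin.is_lt _)
      · simp

theorem mem_modes (hC : ∀ a : Fin nAg, I.env.mem k a = decide (a ∈ C)) (l : List ℕ) :
    l ∈ I.env.modes nAg k ↔ ∃ q : C → Fin I.bound, rawModes q = l := by
  rw [(modes_perm hC).mem_iff]; simp

theorem confs_perm (hC : ∀ a : Fin nAg, I.env.mem k a = decide (a ∈ C)) :
    (I.env.confs nAg k).Perm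
      ((Finset.univ : Finset (Fin I.sys.nS × (C → Fin I.bound))).toList.map rawConf) := by
  have hm := (modes_perm hC).nodup_iff.2 ((Finset.nodup_toList _).map rawModes_injective)
  refine perm_map_univ rawConf_injective ?_ fun c => ?_
  · unfold Env.confs
    rw [List.nodup_flatMap]
    refine ⟨fun s _ => hm.map (Prod.mk_right_injective s), ?_⟩
    refine List.nodup_range.imp fun {s s'} h => ?_
    rw [Function.onFun, List.disjoint_left]
    intro c hc hc'
    obtain ⟨_, _, rfl⟩ := List.mem_map.1 hc
    obtain ⟨_, _, h'⟩ := List.mem_map.1 hc'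
    simp only [Prod.mk.injEq] at h'
    exact h h'.1.symm
  · unfold Env.confs
    simp only [List.mem_flatMap, List.mem_map, mem_modes hC, List.mem_range]
    constructor
    · rintro ⟨s, hs, l, ⟨q, rfl⟩, rfl⟩
      exact ⟨(⟨s, hs⟩, q), rfl⟩
    · rintro ⟨⟨s, q⟩, rfl⟩
      exact ⟨s, s.2, _, ⟨q, rfl⟩, rfl⟩

theorem mem_confs (hC : ∀ a : Fin nAg, I.env.mem k a = decide (a ∈ C)) (c : ℕ × List ℕ) :
    c ∈ I.env.confs nAg k ↔ ∃ c' : Fin I.sys.nS × (C → Fin I.bound), rawConf c' = c := by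
  rw [(confs_perm hC).mem_iff, List.mem_map]
  simp only [Finset.mem_toList, Finset.mem_univ, true_and]

theorem forall_mem_confs (hC : ∀ a : Fin nAg, I.env.mem k a = decide (a ∈ C))
    {Q : ℕ × List ℕ → Prop} : (∀ c ∈ I.env.confs nAg k, Q c) ↔
      ∀ c : Fin I.sys.nS × (C → Fin I.bound), Q (rawConf c) := by
  simp only [mem_confs hC]
  exact ⟨fun h c => h _ ⟨c, rfl⟩, fun h c ⟨c', hc⟩ => hc ▸ h c'⟩

theorem exists_mem_confs (hC : ∀ a : Fin nAg, I.env.mem k a = decide (a ∈ C))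
    {Q : ℕ × List ℕ → Prop} : (∃ c ∈ I.env.confs nAg k, Q c) ↔
      ∃ c : Fin I.sys.nS × (C → Fin I.bound), Q (rawConf c) := by
  simp only [mem_confs hC]
  exact ⟨fun ⟨c, ⟨c', hc⟩, h⟩ => ⟨c', hc ▸ h⟩, fun ⟨c, h⟩ => ⟨_, ⟨c, rfl⟩, h⟩⟩

end Semantics


section Meaning

variable {nAg nAct nAP : ℕ} (I : ParamMCInstance nAg nAct nAP)

theorem env_nS_eq : I.env.nS = I.sys.nS := rfl

theorem env_nX_eq : I.env.nX = I.sys.nX := rfl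

theorem env_bound_eq : I.env.bound = I.bound := rfl

theorem env_state_eq : I.env.state = I.state := rfl

theorem beq_val {n : ℕ} (x y : Fin n) : Nat.beq x y = decide (x = y) := by
  rw [Bool.eq_iff_iff, Nat.beq_eq, decide_eq_true_eq, Fin.ext_iff]

theorem beq_eq_false {m n : ℕ} (h : m ≠ n) : Nat.beq m n = false := by
  rw [← Bool.not_eq_true, Nat.beq_eq]; exact h

theorem beq_self_true (n : ℕ) : Nat.beq n n = true := by rw [Nat.beq_eq]

theorem exists_mem_map_iff {α β : Type} {f : α → β} {l : List α} {Q : β → Prop} :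
    (∃ b ∈ l.map f, Q b) ↔ ∃ a ∈ l, Q (f a) := by
  simp

theorem holds_dist_range (v : TVar → ℝ) (n : ℕ) (f : ℕ → TExpr) :
    (RealFormula.dist ((List.range n).map f)).Holds v ↔
      (fun i : Fin n => (f i).eval v) ∈ stdSimplex ℝ (Fin n) := by
  rw [RealFormula.holds_dist, List.forall_mem_map, forall_mem_range, List.map_map,
    sum_map_range]
  rfl

variable {I} (v : TVar → ℝ)

/-! ### Strategies -/

/-- The variables of block `j` with index `(k, s)` are the scheduler `S`. -/
structure SchedulerReads (I : ParamMCInstance nAg nAct nAP) (j : Fin 3) (k s : ℕ) {a : Fin nAg}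
    (S : Scheduler I.sys.toFrame I.bound a) : Prop where
  start : ∀ (o : Fin (I.sys.nO a)) (q : Fin I.bound),
    (I.env.startVar nAg nAct j k s a o q).eval v = S.start o q
  next : ∀ (q : Fin I.bound) (o : Fin (I.sys.nO a)) (q' : Fin I.bound),
    (I.env.nextVar nAg nAct j k s a q o q').eval v = S.next q o q'
  act : ∀ (q : Fin I.bound) (o : Fin (I.sys.nO a)) (x : Fin nAct),
    (I.env.actVar nAg nAct j k s a q o x).eval v = S.act q o x

theorem schedulerForm_iff (j : Fin 3) (k s : ℕ) (a : Fin nAg) :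
    (I.env.schedulerForm nAg nAct j k s a).Holds v ↔
      ∃ S : Scheduler I.sys.toFrame I.bound a, SchedulerReads v I j k s S := by
  unfold Env.schedulerForm
  simp only [RealFormula.holds_and, RealFormula.holds_conj, List.forall_mem_map, env_nO_eq,
    env_bound_eq, env_nS_eq, forall_mem_range, holds_dist_range, env_legal_eq, env_obs_eq]
  constructor
  · rintro ⟨h1, h2⟩
    refine ⟨⟨fun o => ⟨_, (h1 o).1⟩, fun q o => ⟨_, ((h1 o).2 q).1⟩,
      fun q o => ⟨_, ((h1 o).2 q).2⟩, fun q t x hx => ?_⟩, ⟨fun _ _ => rfl, fun _ _ _ => rfl,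
      fun _ _ _ => rfl⟩⟩
    have := h2 t q x
    simp only [decide_eq_false hx, cond_false, RealFormula.holds_eq, PolyExpr.eval_const,
      Rat.cast_zero] at this
    exact this
  · rintro ⟨S, h1, h2, h3⟩
    refine ⟨fun o => ⟨?_, fun q => ⟨?_, ?_⟩⟩, fun t q x => ?_⟩
    · simp only [h1]; exact (S.start o).2
    · simp only [h2]; exact (S.next q o).2
    · simp only [h3]; exact (S.act q o).2
    · by_cases hx : x ∈ I.sys.legal t a
      · simp [hx]
      · simp only [hx, decide_false, cond_false, RealFormula.holds_eq, h3,
          PolyExpr.eval_const, Rat.cast_zero]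
        exact S.act_legal q t x hx

variable {C : Finset (Fin nAg)} {j : Fin 3} {k : ℕ}

/-- The variables of block `j` with index `(k, s)` are the strategy `σ`. -/
def StrategyReads (j : Fin 3) (k s : ℕ) (σ : CoalitionStrategy I.sys.toFrame C I.bound) : Prop :=
  ∀ a : C, SchedulerReads v I j k s (σ a)

theorem strategyForm_iff (hC : ∀ a : Fin nAg, I.env.mem k a = decide (a ∈ C)) (s : ℕ) :
    (I.env.strategyForm nAg nAct j k s).Holds v ↔
      ∃ σ : CoalitionStrategy I.sys.toFrame C I.bound, StrategyReads v j k s σ := by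
  unfold Env.strategyForm
  simp only [RealFormula.holds_conj, List.forall_mem_map, forall_mem_range, hC]
  constructor
  · intro h
    have h' : ∀ a : C, ∃ S : Scheduler I.sys.toFrame I.bound a, SchedulerReads v I j k s S :=
      fun a => by
        rw [← schedulerForm_iff]
        simpa [a.2] using h a
    choose σ hσ using h'
    exact ⟨σ, hσ⟩
  · rintro ⟨σ, hσ⟩ a
    by_cases ha : a ∈ C
    · simpa [ha] using (schedulerForm_iff v j k s a).2 ⟨σ ⟨a, ha⟩, hσ ⟨a, ha⟩⟩
    · simp [ha]

/-! ### Transition probabilities -/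

variable {v}
variable {tr : Fin I.sys.nS → (Fin nAg → Fin nAct) → Fin I.sys.nS → ℝ}
  (htr : ∀ s α, I.sys.toFrame.LegalProfile s α → tr s α ∈ stdSimplex ℝ (Fin I.sys.nS))

variable (v tr) in
/-- The transition variables have the values `tr`. -/
def TransReads : Prop :=
  ∀ (s : Fin I.sys.nS) α (s' : Fin I.sys.nS), I.sys.toFrame.LegalProfile s α →
    (I.env.transVar nAg nAct s (finFunctionFinEquiv α) s').eval v = tr s α s'

/-- The system with the transition probabilities `tr`. -/
abbrev ParamMCInstance.withTrans (I : ParamMCInstance nAg nAct nAP)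
    (tr : Fin I.sys.nS → (Fin nAg → Fin nAct) → Fin I.sys.nS → ℝ)
    (htr : ∀ s α, I.sys.toFrame.LegalProfile s α → tr s α ∈ stdSimplex ℝ (Fin I.sys.nS)) :
    StochSystem nAg nAct nAP :=
  ⟨I.sys.toFrame, tr, htr⟩

variable {σ : CoalitionStrategy I.sys.toFrame C I.bound} {s : ℕ}
variable (hC : ∀ a : Fin nAg, I.env.mem k a = decide (a ∈ C))

theorem prod_coalition (f : C → ℝ) (g : Fin nAg → ℝ) (h : ∀ a : C, g a = f a)
    (h' : ∀ a, a ∉ C → g a = 1) : ∏ a, g a = ∏ a, f a := by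
  rw [← Finset.prod_subset (Finset.subset_univ C) fun a _ ha => h' a ha,
    ← Finset.prod_coe_sort C g]
  exact Finset.prod_congr rfl fun a _ => h a

include hC in
theorem eval_playExpr (hσ : StrategyReads v j k s σ) (c : Conf I.sys.toFrame C I.bound)
    (β α : Fin nAg → Fin nAct) (a : Fin nAg) :
    (I.env.playExpr nAg nAct j k s (rawConf c) (rawProfile β) (rawProfile α) a).eval v =
      playProb σ c β a (α a) := by
  unfold Env.playExpr playProb
  rw [hC, rawProfile_getD, rawProfile_getD, beq_val]
  by_cases ha : a ∈ C
  · have := rawModes_getD c.2 ⟨a, ha⟩ 0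
    simp only at this
    simp only [ha, decide_true, cond_true, dif_pos, rawConf, env_obs_eq, this]
    exact (hσ ⟨a, ha⟩).act _ _ _
  · by_cases h : α a = β a <;> simp [ha, h]

include hC in
theorem eval_modes (hσ : StrategyReads v j k s σ) (c : Conf I.sys.toFrame C I.bound)
    (q : C → Fin I.bound) :
    ((PolyExpr.listProd ((List.range nAg).map fun a =>
      I.env.modeExpr nAg nAct j k s (rawConf c) (rawModes q) a)).eval v) = modeDist σ c q := by
  rw [PolyExpr.eval_listProd, List.map_map, prod_map_range]
  refine prod_coalition _ _ (fun a => ?_) fun a ha => ?_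
  · simp only [Function.comp_apply, Env.modeExpr, hC, a.2, decide_true, cond_true, rawConf,
      env_obs_eq, rawModes_getD]
    exact (hσ a).next _ _ _
  · simp [Env.modeExpr, hC, ha]

include hC in
theorem eval_start (hσ : StrategyReads v j k s σ) (t : Fin I.sys.nS) (ht : s = t)
    (q : C → Fin I.bound) :
    ((PolyExpr.listProd ((List.range nAg).map fun a =>
      I.env.startExpr nAg nAct j k s (rawModes q) a)).eval v) = startDist σ t q := by
  subst ht
  rw [PolyExpr.eval_listProd, List.map_map, prod_map_range]
  refine prod_coalition _ _ (fun a => ?_) fun a ha => ?_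
  · simp only [Function.comp_apply, Env.startExpr, hC, a.2, decide_true, cond_true,
      env_obs_eq, rawModes_getD]
    exact (hσ a).start _ _
  · simp [Env.startExpr, hC, ha]

/-- The transition variables are unconstrained at illegal profiles. Since such profiles have weight
zero, the values of these variables do not matter. -/
theorem prod_playProb_eq_zero (c : Conf I.sys.toFrame C I.bound) {β α : Fin nAg → Fin nAct}
    (hβ : I.sys.toFrame.LegalProfile c.1 β) (hα : ¬ I.sys.toFrame.LegalProfile c.1 α) :
    ∏ a, playProb σ c β a (α a) = 0 := by
  simp only [Frame.LegalProfile, not_forall] at hα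
  obtain ⟨a, ha⟩ := hα
  refine Finset.prod_eq_zero (Finset.mem_univ a) ?_
  unfold playProb
  split_ifs with h1 h2
  · exact (σ ⟨a, h1⟩).act_legal _ _ _ ha
  · exact absurd (h2 ▸ hβ a) ha
  · rfl

include hC in
theorem eval_moveExpr (hσ : StrategyReads v j k s σ) (ht : TransReads v tr)
    (c c' : Conf I.sys.toFrame C I.bound) {β : Fin nAg → Fin nAct}
    (hβ : I.sys.toFrame.LegalProfile c.1 β) :
    (I.env.moveExpr nAg nAct j k s (rawConf c) (rawProfile β) (rawConf c')).eval v =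
      moveProb (I.withTrans tr htr) σ c β c' := by
  unfold Env.moveExpr moveProb
  rw [PolyExpr.eval_mul, PolyExpr.eval_listSum, List.map_map, sum_map_profiles]
  congr 1
  · refine Finset.sum_congr rfl fun α _ => ?_
    have h : ∏ a : Fin nAg, (I.env.playExpr nAg nAct j k s (rawConf c) (rawProfile β)
        (rawProfile α) a).eval v = ∏ a, playProb σ c β a (α a) :=
      Finset.prod_congr rfl fun a _ => eval_playExpr hC hσ c β α a
    simp only [Function.comp_apply, PolyExpr.eval_mul, PolyExpr.eval_listProd, List.map_map,
      prod_map_range, h]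
    by_cases hα : I.sys.toFrame.LegalProfile c.1 α
    · congr 1
      exact ht _ _ _ hα
    · rw [prod_playProb_eq_zero c hβ hα, zero_mul, zero_mul]
  · exact eval_modes hC hσ c c'.2

/-! ### Optimality -/

variable (v) in
/-- The values of the value variables. -/
noncomputable def valueOf (I : ParamMCInstance nAg nAct nAP) {C : Finset (Fin nAg)}
    (c : Conf I.sys.toFrame C I.bound) : ℝ :=
  (I.env.valVar nAg nAct (rawConf c)).eval v

variable (v) in
/-- The values of the rank variables. -/
noncomputable def rankOf (I : ParamMCInstance nAg nAct nAP) {C : Finset (Fin nAg)}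
    (c : Conf I.sys.toFrame C I.bound) : ℝ :=
  (I.env.rankVar nAg nAct (rawConf c)).eval v

variable (v) in
noncomputable def rewardOf (I : ParamMCInstance nAg nAct nAP) (k : ℕ) {C : Finset (Fin nAg)}
    (c : Conf I.sys.toFrame C I.bound) : ℝ :=
  (I.env.rewardExpr nAg nAct k (rawConf c)).eval v

include hC in
theorem eval_expectExpr (hσ : StrategyReads v j k s σ) (ht : TransReads v tr)
    (c : Conf I.sys.toFrame C I.bound) {β : Fin nAg → Fin nAct}
    (hβ : I.sys.toFrame.LegalProfile c.1 β) :
    (I.env.expectExpr nAg nAct j k s (rawConf c) (rawProfile β)).eval v =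
      (opponentMDP (I.withTrans tr htr) σ).ex (rewardOf v I k) c β := by
  unfold Env.expectExpr FinMDP.ex
  rw [PolyExpr.eval_listSum, List.map_map, sum_map_of_perm (confs_perm hC)]
  refine Finset.sum_congr rfl fun c' _ => ?_
  simp only [Function.comp_apply, PolyExpr.eval_mul]
  rw [eval_moveExpr htr hC hσ ht c c' hβ]
  rfl

include hC in
theorem optForm_iff (hσ : StrategyReads v j k s σ) (ht : TransReads v tr)
    (c : Conf I.sys.toFrame C I.bound) :
    (I.env.optForm nAg nAct j k s (rawConf c)).Holds v ↔
      IsOpt (I.env.isMax k) ((opponentMDP (I.withTrans tr htr) σ).avail c)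
        ((opponentMDP (I.withTrans tr htr) σ).ex (rewardOf v I k) c) (valueOf v I c) := by
  have key := fun β hβ => eval_expectExpr htr hC hσ ht c (β := β) hβ
  unfold Env.optForm IsOpt
  simp only [mem_opponentMDP_avail]
  cases I.env.isMax k <;>
  · simp only [cond_true, cond_false, if_true, Bool.false_eq_true, if_false,
      RealFormula.holds_and, RealFormula.holds_conj, RealFormula.holds_disj,
      List.forall_mem_map, exists_mem_map_iff, RealFormula.holds_le]
    refine and_congr ((forall_mem_moves I c.1).trans (forall₂_congr fun β hβ => ?_))
      ((exists_mem_moves I c.1).trans (exists_congr fun β => and_congr_right fun hβ => ?_))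
    · rw [key β hβ]; rfl
    · rw [key β hβ]; rfl

theorem rewardOf_eq (hk : I.env.kind k ≠ 3) :
    rewardOf v I k = valueOf (C := C) v I := by
  funext c
  unfold rewardOf Env.rewardExpr
  rw [beq_eq_false hk]
  rfl

include hC in
theorem descentForm_iff (hσ : StrategyReads v j k s σ) (ht : TransReads v tr)
    (c : Conf I.sys.toFrame C I.bound) {β : Fin nAg → Fin nAct}
    (hβ : I.sys.toFrame.LegalProfile c.1 β) :
    (I.env.descentForm nAg nAct j k s (rawConf c) (rawProfile β)).Holds v ↔
      ∃ c', 0 < (opponentMDP (I.withTrans tr htr) σ).P c β c' ∧ rankOf v I c' < rankOf v I c := by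
  unfold Env.descentForm
  simp only [RealFormula.holds_disj, exists_mem_map_iff, exists_mem_confs hC,
    RealFormula.holds_and, RealFormula.holds_pos, RealFormula.holds_lt]
  refine exists_congr fun c' => and_congr_left fun _ => ?_
  rw [eval_moveExpr htr hC hσ ht c c' hβ]
  rfl

include hC in
theorem progressForm_iff (hσ : StrategyReads v j k s σ) (ht : TransReads v tr)
    (hk : I.env.kind k ≠ 3) (c : Conf I.sys.toFrame C I.bound) :
    (I.env.progressForm nAg nAct j k s (rawConf c)).Holds v ↔
      (opponentMDP (I.withTrans tr htr) σ).Progress (I.env.isMax k) (valueOf v I)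
        (fun c' => rankOf v I c' < rankOf v I c) c := by
  have key := fun β hβ => eval_expectExpr htr hC hσ ht c (β := β) hβ
  rw [rewardOf_eq hk] at key
  unfold Env.progressForm FinMDP.Progress
  simp only [mem_opponentMDP_avail]
  cases I.env.isMax k
  · simp only [cond_false, Bool.false_eq_true, if_false, RealFormula.holds_conj,
      List.forall_mem_map]
    exact (forall_mem_moves I c.1).trans (forall₂_congr fun β hβ =>
      descentForm_iff htr hC hσ ht c hβ)
  · simp only [cond_true, if_true, RealFormula.holds_disj, exists_mem_map_iff,
      RealFormula.holds_and, RealFormula.holds_le]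
    refine (exists_mem_moves I c.1).trans (exists_congr fun β => and_congr_right fun hβ => ?_)
    rw [key β hβ, descentForm_iff htr hC hσ ht c hβ]
    rfl

include hC in
theorem certForm_iff (hσ : StrategyReads v j k s σ) (ht : TransReads v tr)
    (hk : I.env.kind k ≠ 3) : (I.env.certForm nAg nAct j k s).Holds v ↔
      (opponentMDP (I.withTrans tr htr) σ).Cert (I.env.isMax k)
        (fun c => (I.env.argForm nAg nAct k (Env.argLast k) c.1).Holds v)
        (fun c => (I.env.argForm nAg nAct k (I.env.argFirst k) c.1).Holds v)
        (valueOf v I) (rankOf v I) := by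
  have ho := optForm_iff htr hC hσ ht
  rw [rewardOf_eq hk] at ho
  unfold Env.certForm
  rw [beq_eq_false hk]
  simp only [RealFormula.holds_conj, List.forall_mem_map, cond_false, forall_mem_confs hC,
    Env.confForm, RealFormula.holds_and, RealFormula.holds_nonneg, RealFormula.holds_imp,
    RealFormula.holds_not, RealFormula.holds_eq, RealFormula.holds_pos, PolyExpr.eval_const,
    Rat.cast_one, Rat.cast_zero, ho, progressForm_iff htr hC hσ ht hk]
  constructor
  · exact fun h => ⟨fun c => (h c).1, fun c => (h c).2.1, fun c h1 => ((h c).2.2 h1).1,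
      fun c h1 h2 => (((h c).2.2 h1).2 h2).1, fun c h1 h2 => (((h c).2.2 h1).2 h2).2⟩
  · exact fun h c => ⟨h.nonneg c, h.eq_one c, fun h1 => ⟨h.eq_zero c h1,
      fun h2 => ⟨h.isOpt c h1 h2, h.rank c h1 h2⟩⟩⟩

include hC in
theorem certForm_next_iff (hσ : StrategyReads v j k s σ) (ht : TransReads v tr)
    (hk : I.env.kind k = 3) : (I.env.certForm nAg nAct j k s).Holds v ↔
      ∀ c, IsOpt (I.env.isMax k) ((opponentMDP (I.withTrans tr htr) σ).avail c)
        ((opponentMDP (I.withTrans tr htr) σ).ex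
          (fun c => (I.env.truthVar nAg nAct (Env.argLast k) c.1).eval v) c) (valueOf v I c) := by
  have ho := optForm_iff htr hC hσ ht
  have hr : rewardOf (C := C) v I k =
      fun c => (I.env.truthVar nAg nAct (Env.argLast k) c.1).eval v := by
    funext c
    unfold rewardOf Env.rewardExpr
    rw [hk]
    rfl
  rw [hr] at ho
  unfold Env.certForm
  rw [hk]
  simp only [RealFormula.holds_conj, List.forall_mem_map, beq_self_true, cond_true,
    forall_mem_confs hC, ho]

include hC in
theorem eval_probExpr (hσ : StrategyReads v j k s σ) (t : Fin I.sys.nS) (ht : s = t) :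
    (I.env.probExpr nAg nAct j k s).eval v = ∑ q, startDist σ t q * valueOf v I (t, q) := by
  unfold Env.probExpr
  rw [PolyExpr.eval_listSum, List.map_map, sum_map_of_perm (modes_perm hC)]
  refine Finset.sum_congr rfl fun q _ => ?_
  simp only [Function.comp_apply, PolyExpr.eval_mul]
  rw [eval_start hC hσ t ht]
  subst ht
  rfl

theorem cmpForm_iff {r : Cmp} (hr : I.env.cmp k = r.num) :
    (I.env.cmpForm nAg nAct j k s).Holds v ↔
      r.Rel ((I.env.boundedExpr nAg nAct j k s).eval v) (I.env.thr k) := by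
  unfold Env.cmpForm
  rw [hr]
  cases r <;> simp [Cmp.num, Cmp.Rel, Nat.beq]

theorem isMax_eq {r : Cmp} (hr : I.env.cmp k = r.num) :
    I.env.isMax k = if I.env.kind k = 5 then !r.isUpper else r.isUpper := by
  unfold Env.isMax
  rw [hr]
  by_cases h : I.env.kind k = 5
  · rw [h]; cases r <;> rfl
  · rw [if_neg h, beq_eq_false h]; cases r <;> rfl

/-! ### Coalition formulas -/

/-- The plays that satisfy a temporal formula of the given kind, where `goal` and `ok` are the
states that satisfy its last and its first argument. -/
def playSet {n : ℕ} (kind : ℕ) (goal ok : Fin n → Prop) : Set (ℕ → Fin n) :=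
  if kind = 3 then {π | goal (π 1)}
  else if kind = 4 then {π | ∃ i, goal (π i) ∧ ∀ j < i, ok (π j)}
  else {π | ∀ i, goal (π i) ∨ ∃ j < i, ok (π j)}

variable (v) in
/-- The truth table is the predicate `p` at position `i`. -/
def TruthReads (I : ParamMCInstance nAg nAct nAP) (i : ℕ) (p : Fin I.sys.nS → Prop) : Prop :=
  ∀ t : Fin I.sys.nS, (p t → (I.env.truthVar nAg nAct i t).eval v = 1) ∧
    (¬ p t → (I.env.truthVar nAg nAct i t).eval v = 0)

theorem TruthReads.isTrue_iff {i : ℕ} {p : Fin I.sys.nS → Prop} (h : TruthReads v I i p)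
    (t : Fin I.sys.nS) : (I.env.isTrue nAg nAct i t).Holds v ↔ p t := by
  unfold Env.isTrue
  by_cases ht : p t
  · simp [(h t).1 ht, ht]
  · simp [(h t).2 ht, ht]

variable {goal ok : Fin I.sys.nS → Prop} {r : Cmp}

-- Given a certificate, the value variables have no freedom left, so comparing one number with the
-- threshold decides the claim about all opponents.
include hC in
theorem cmpForm_iff_of_certForm (hσ : StrategyReads v j k s σ) (ht : TransReads v tr)
    (hk : I.env.kind k = 3 ∨ I.env.kind k = 4 ∨ I.env.kind k = 5) (hr : I.env.cmp k = r.num)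
    (hgoal : TruthReads v I (Env.argLast k) goal)
    (hok : I.env.kind k ≠ 3 → TruthReads v I (I.env.argFirst k) ok)
    (t : Fin I.sys.nS) (hs : s = t) (h : (I.env.certForm nAg nAct j k s).Holds v) :
    (I.env.cmpForm nAg nAct j k s).Holds v ↔
      ∀ μ : OpponentStrategy I.sys.toFrame C I.bound,
        r.Rel ((outcome (I.withTrans tr htr) σ μ t).real
          {ω | (fun n => (ω n).1) ∈ playSet (I.env.kind k) goal ok}) (I.env.thr k) := by
  rw [cmpForm_iff hr]
  have hm := isMax_eq hr
  rcases hk with hk | hk | hk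
  · rw [certForm_next_iff htr hC hσ ht hk] at h
    unfold playSet Env.boundedExpr
    simp only [hk, Nat.reduceEqDiff, if_true, if_false] at hm ⊢
    rw [hm] at h
    rw [beq_eq_false (by omega), cond_false, eval_probExpr hC hσ t hs]
    exact (forall_next_iff (I.withTrans tr htr) σ goal r _ t (fun c => hgoal c.1) h).symm
  · have hok := hok (by omega)
    rw [certForm_iff htr hC hσ ht (by omega)] at h
    simp only [Env.argForm, hk, beq_eq_false (show (4 : ℕ) ≠ 5 by omega), cond_false,
      hgoal.isTrue_iff, hok.isTrue_iff] at h
    unfold playSet Env.boundedExpr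
    simp only [hk, Nat.reduceEqDiff, if_true, if_false] at hm ⊢
    rw [hm] at h
    rw [beq_eq_false (by omega), cond_false, eval_probExpr hC hσ t hs]
    exact (forall_until_iff (I.withTrans tr htr) σ goal ok r _ t h).symm
  · have hok := hok (by omega)
    rw [certForm_iff htr hC hσ ht (by omega)] at h
    simp only [Env.argForm, hk, beq_self_true, cond_true, RealFormula.holds_not,
      hgoal.isTrue_iff, hok.isTrue_iff] at h
    unfold playSet Env.boundedExpr
    simp only [hk, Nat.reduceEqDiff, if_true, if_false] at hm ⊢
    rw [hm] at h
    rw [beq_self_true, cond_true, PolyExpr.eval_sub, eval_probExpr hC hσ t hs,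
      PolyExpr.eval_const, Rat.cast_one]
    exact (forall_release_iff (I.withTrans tr htr) σ goal ok r _ t h).symm

include hC htr in
/-- Certificates exist. -/
theorem exists_certForm (σ : CoalitionStrategy I.sys.toFrame C I.bound)
    (goal ok : Fin I.sys.nS → Prop)
    (hk : I.env.kind k = 3 ∨ I.env.kind k = 4 ∨ I.env.kind k = 5) :
    ∃ u rk : Conf I.sys.toFrame C I.bound → ℝ, ∀ (v : TVar → ℝ) (j : Fin 3) (s : ℕ),
      StrategyReads v j k s σ → TransReads v tr → TruthReads v I (Env.argLast k) goal →
      (I.env.kind k ≠ 3 → TruthReads v I (I.env.argFirst k) ok) →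
      valueOf v I = u → rankOf v I = rk → (I.env.certForm nAg nAct j k s).Holds v := by
  classical
  -- Values and ranks depend only on the strategy, the transition probabilities and the truth of the
  -- arguments. They are fixed before the valuation `v` of the variables, because the last block of
  -- `v` will be built from them.
  set D := opponentMDP (I.withTrans tr htr) σ
  rcases hk with hk | hk | hk
  · refine ⟨D.opt (I.env.isMax k) (fun c => if goal c.1 then 1 else 0), fun _ => 0, ?_⟩
    intro v j s hσ ht hgoal _ hu _
    have : (fun c : Conf I.sys.toFrame C I.bound =>
        (I.env.truthVar nAg nAct (Env.argLast k) c.1).eval v) =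
        fun c => if goal c.1 then 1 else 0 := by
      funext c
      split_ifs with h
      exacts [(hgoal c.1).1 h, (hgoal c.1).2 h]
    rw [certForm_next_iff htr hC hσ ht hk, this, hu]
    exact fun c => D.isOpt_opt _ _ c
  · obtain ⟨u, rk, h⟩ : ∃ u rk, D.Cert (I.env.isMax k) (fun c => goal c.1)
        (fun c => ok c.1) u rk := ⟨_, D.exists_cert⟩
    refine ⟨u, rk, ?_⟩
    intro v j s hσ ht hgoal hok hu hrk
    have hok := hok (by omega)
    rw [certForm_iff htr hC hσ ht (by omega)]
    simp only [Env.argForm, hk, beq_eq_false (show (4 : ℕ) ≠ 5 by omega), cond_false,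
      hgoal.isTrue_iff, hok.isTrue_iff]
    rw [hu, hrk]
    exact h
  · obtain ⟨u, rk, h⟩ : ∃ u rk, D.Cert (I.env.isMax k) (fun c => ¬ goal c.1)
        (fun c => ¬ ok c.1) u rk := ⟨_, D.exists_cert⟩
    refine ⟨u, rk, ?_⟩
    intro v j s hσ ht hgoal hok hu hrk
    have hok := hok (by omega)
    rw [certForm_iff htr hC hσ ht (by omega)]
    simp only [Env.argForm, hk, beq_self_true, cond_true, RealFormula.holds_not,
      hgoal.isTrue_iff, hok.isTrue_iff]
    rw [hu, hrk]
    exact h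

end Meaning


/-! ## The list of subformulas -/

namespace PATL

variable {nAg nAP : ℕ}

/-- The subformulas, arguments first. -/
def subs : PATL nAg nAP → List (PATL nAg nAP)
  | .atom p => [.atom p]
  | .or φ ψ => φ.subs ++ ψ.subs ++ [.or φ ψ]
  | .not φ => φ.subs ++ [.not φ]
  | .next C r d φ => φ.subs ++ [.next C r d φ]
  | .untl C r d φ ψ => φ.subs ++ ψ.subs ++ [.untl C r d φ ψ]
  | .release C r d φ ψ => φ.subs ++ ψ.subs ++ [.release C r d φ ψ]

def toNode : PATL nAg nAP → Node
  | .atom p => (0, [], 0, 0, p.val)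
  | .or _ ψ => (1, [], 0, 0, ψ.subs.length)
  | .not _ => (2, [], 0, 0, 0)
  | .next C r d _ => (3, memberBits C, r.num, d.1, 0)
  | .untl C r d _ ψ => (4, memberBits C, r.num, d.1, ψ.subs.length)
  | .release C r d _ ψ => (5, memberBits C, r.num, d.1, ψ.subs.length)

/-- The direct subformulas. -/
def args : PATL nAg nAP → List (PATL nAg nAP)
  | .atom _ => []
  | .or φ ψ => [φ, ψ]
  | .not φ => [φ]
  | .next _ _ _ φ => [φ]
  | .untl _ _ _ φ ψ => [φ, ψ]
  | .release _ _ _ φ ψ => [φ, ψ]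

theorem flatten_eq (φ : PATL nAg nAP) : φ.flatten = φ.subs.map toNode := by
  induction φ <;> simp_all [flatten, subs, toNode]

theorem exists_subs_eq (φ : PATL nAg nAP) : ∃ l, φ.subs = l ++ [φ] := by
  cases φ with
  | atom p => exact ⟨[], rfl⟩
  | _ => exact ⟨_, rfl⟩

theorem subs_length_pos (φ : PATL nAg nAP) : 0 < φ.subs.length := by
  obtain ⟨l, h⟩ := φ.exists_subs_eq
  simp [h]

theorem getElem?_subs_last (φ : PATL nAg nAP) : φ.subs[φ.subs.length - 1]? = some φ := by
  obtain ⟨l, h⟩ := φ.exists_subs_eq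
  simp [h]

/-- The list `S` holds the given arguments at the positions that the offsets of a subformula at
position `k` prescribe. -/
def ArgsAt (S : List (PATL nAg nAP)) (k : ℕ) : List (PATL nAg nAP) → Prop
  | [] => True
  | [φ] => 1 ≤ k ∧ S[k - 1]? = some φ
  | φ :: ψ :: _ => ψ.subs.length + 1 ≤ k ∧ S[k - 1]? = some ψ ∧
      S[k - 1 - ψ.subs.length]? = some φ

theorem getElem?_append_of_some {α : Type} {S : List α} {i : ℕ} {a : α} (h : S[i]? = some a)
    (T : List α) : (S ++ T)[i]? = some a := by
  rw [List.getElem?_append_left (List.getElem?_eq_some_iff.1 h).1, h]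

theorem ArgsAt.append {S : List (PATL nAg nAP)} {k : ℕ} {l : List (PATL nAg nAP)}
    (h : ArgsAt S k l) (T : List (PATL nAg nAP)) : ArgsAt (S ++ T) k l := by
  match l, h with
  | [], _ => trivial
  | [_], h => exact ⟨h.1, getElem?_append_of_some h.2 T⟩
  | _ :: _ :: _, h =>
    exact ⟨h.1, getElem?_append_of_some h.2.1 T, getElem?_append_of_some h.2.2 T⟩

/-- Offsets are relative, so a list of subformulas may be moved. The lower bounds on `k` in `ArgsAt`
keep the truncated subtractions exact. -/
theorem ArgsAt.prepend {S : List (PATL nAg nAP)} {k : ℕ} {l : List (PATL nAg nAP)}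
    (h : ArgsAt S k l) (T : List (PATL nAg nAP)) : ArgsAt (T ++ S) (T.length + k) l := by
  have key : ∀ i j, j = T.length + i → (T ++ S)[j]? = S[i]? := by
    rintro i j rfl
    rw [List.getElem?_append_right (by omega), Nat.add_sub_cancel_left]
  match l, h with
  | [], _ => trivial
  | [_], h =>
    have := h.1
    exact ⟨by omega, by rw [key (k - 1) _ (by omega)]; exact h.2⟩
  | _ :: ψ :: _, h =>
    have := h.1
    exact ⟨by omega, by rw [key (k - 1) _ (by omega)]; exact h.2.1,
      by rw [key (k - 1 - ψ.subs.length) _ (by omega)]; exact h.2.2⟩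

/-- Every member of the list is preceded by its arguments. -/
def ArgsFirst (S : List (PATL nAg nAP)) : Prop :=
  ∀ k χ, S[k]? = some χ → ArgsAt S k χ.args

theorem ArgsFirst.append {S T : List (PATL nAg nAP)} (hS : ArgsFirst S) (hT : ArgsFirst T) :
    ArgsFirst (S ++ T) := by
  intro k χ h
  rw [List.getElem?_append] at h
  split_ifs at h with hk
  · exact (hS k χ h).append T
  · have := (hT _ χ h).prepend S
    rwa [Nat.add_sub_cancel' (not_lt.1 hk)] at this

theorem ArgsFirst.concat {S : List (PATL nAg nAP)} (hS : ArgsFirst S) {χ : PATL nAg nAP}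
    (h : ArgsAt S S.length χ.args) : ArgsFirst (S ++ [χ]) := by
  intro k ξ hk
  rw [List.getElem?_append] at hk
  split_ifs at hk with hlt
  · exact (hS k ξ hk).append _
  · obtain ⟨h0, rfl⟩ : k = S.length ∧ χ = ξ := by
      rw [List.getElem?_singleton] at hk
      split_ifs at hk with h0
      exact ⟨by omega, by simpa using hk⟩
    rw [h0]
    exact h.append _

theorem argsAt_singleton (φ : PATL nAg nAP) : ArgsAt φ.subs φ.subs.length [φ] :=
  ⟨φ.subs_length_pos, φ.getElem?_subs_last⟩

theorem argsAt_pair (φ ψ : PATL nAg nAP) :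
    ArgsAt (φ.subs ++ ψ.subs) (φ.subs ++ ψ.subs).length [φ, ψ] := by
  have h1 := φ.subs_length_pos
  have h2 := ψ.subs_length_pos
  refine ⟨by rw [List.length_append]; omega, ?_, ?_⟩
  · rw [List.length_append, List.getElem?_append_right (by omega), ← ψ.getElem?_subs_last]
    congr 1
    omega
  · rw [List.length_append, show φ.subs.length + ψ.subs.length - 1 - ψ.subs.length =
      φ.subs.length - 1 by omega]
    exact getElem?_append_of_some φ.getElem?_subs_last _

theorem argsFirst_subs (φ : PATL nAg nAP) : ArgsFirst φ.subs := by
  induction φ with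
  | atom p =>
    intro k χ h
    simp only [subs, List.getElem?_singleton] at h
    split_ifs at h
    obtain rfl := Option.some.inj h
    trivial
  | or φ ψ h1 h2 => exact (h1.append h2).concat (argsAt_pair φ ψ)
  | not φ h => exact h.concat (argsAt_singleton φ)
  | next C r d φ h => exact h.concat (argsAt_singleton φ)
  | untl C r d φ ψ h1 h2 => exact (h1.append h2).concat (argsAt_pair φ ψ)
  | release C r d φ ψ h1 h2 => exact (h1.append h2).concat (argsAt_pair φ ψ)

/-- The coalition of a coalition formula. -/
def coalition : PATL nAg nAP → Finset (Fin nAg)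
  | .next C _ _ _ | .untl C _ _ _ _ | .release C _ _ _ _ => C
  | _ => ∅

/-- The comparison of a coalition formula. -/
def rel : PATL nAg nAP → Cmp
  | .next _ r _ _ | .untl _ r _ _ _ | .release _ r _ _ _ => r
  | _ => .le

def lastArg : PATL nAg nAP → PATL nAg nAP
  | .not φ | .next _ _ _ φ => φ
  | .or _ ψ | .untl _ _ _ _ ψ | .release _ _ _ _ ψ => ψ
  | φ => φ

def firstArg : PATL nAg nAP → PATL nAg nAP
  | .not φ | .next _ _ _ φ => φ
  | .or φ _ | .untl _ _ _ φ _ | .release _ _ _ φ _ => φ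
  | φ => φ

theorem sat_iff_enforces {nAct : ℕ} (M : StochSystem nAg nAct nAP) (b : ℕ) (χ : PATL nAg nAP)
    (h : 3 ≤ χ.toNode.1) (s : Fin M.nS) :
    χ.Sat M b s ↔ Enforces M b χ.coalition χ.rel χ.toNode.2.2.2.1 s
      (playSet χ.toNode.1 (χ.lastArg.Sat M b) (χ.firstArg.Sat M b)) := by
  cases χ with
  | next C r d φ => exact Iff.rfl
  | untl C r d φ ψ => exact Iff.rfl
  | release C r d φ ψ => exact Iff.rfl
  | _ => simp [toNode] at h

end PATL

section Nodes

variable {nAg nAct nAP : ℕ} {I : ParamMCInstance nAg nAct nAP} {k : ℕ} {χ : PATL nAg nAP}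

theorem env_nodes_length (I : ParamMCInstance nAg nAct nAP) :
    I.env.nodes.length = I.formula.subs.length := by
  change I.formula.flatten.length = _
  rw [PATL.flatten_eq, List.length_map]

variable (h : I.formula.subs[k]? = some χ)

include h

theorem env_node_eq : I.env.node k = χ.toNode := by
  change I.formula.flatten.getD k _ = _
  rw [PATL.flatten_eq, List.getD_eq_getElem?_getD, List.getElem?_map, h]
  rfl

theorem env_kind_eq : I.env.kind k = χ.toNode.1 := by rw [Env.kind, env_node_eq h]

theorem env_thr_eq : I.env.thr k = χ.toNode.2.2.2.1 := by rw [Env.thr, env_node_eq h]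

theorem env_off_eq : I.env.off k = χ.toNode.2.2.2.2 := by rw [Env.off, env_node_eq h]

theorem env_mem_eq (h3 : 3 ≤ I.env.kind k) (a : Fin nAg) :
    I.env.mem k a = decide (a ∈ χ.coalition) := by
  rw [env_kind_eq h] at h3
  rw [Env.mem, env_node_eq h]
  cases χ with
  | next C r d φ => exact getD_ofFn _ a _
  | untl C r d φ ψ => exact getD_ofFn _ a _
  | release C r d φ ψ => exact getD_ofFn _ a _
  | _ => simp [PATL.toNode] at h3

theorem env_cmp_eq (h3 : 3 ≤ I.env.kind k) : I.env.cmp k = χ.rel.num := by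
  rw [env_kind_eq h] at h3
  rw [Env.cmp, env_node_eq h]
  cases χ with
  | next C r d φ => rfl
  | untl C r d φ ψ => rfl
  | release C r d φ ψ => rfl
  | _ => simp [PATL.toNode] at h3

theorem env_kind_cases (h3 : 3 ≤ I.env.kind k) :
    I.env.kind k = 3 ∨ I.env.kind k = 4 ∨ I.env.kind k = 5 := by
  rw [env_kind_eq h] at *
  cases χ <;> simp [PATL.toNode] at *

theorem getElem?_argLast (h1 : I.env.kind k ≠ 0) :
    Env.argLast k < k ∧ I.formula.subs[Env.argLast k]? = some χ.lastArg := by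
  have key := I.formula.argsFirst_subs k χ h
  rw [env_kind_eq h] at h1
  unfold Env.argLast
  cases χ with
  | atom p => exact absurd rfl h1
  | not φ => exact ⟨by have := key.1; omega, key.2⟩
  | next C r d φ => exact ⟨by have := key.1; omega, key.2⟩
  | or φ ψ => exact ⟨by have := key.1; omega, key.2.1⟩
  | untl C r d φ ψ => exact ⟨by have := key.1; omega, key.2.1⟩
  | release C r d φ ψ => exact ⟨by have := key.1; omega, key.2.1⟩

theorem getElem?_argFirst (h1 : I.env.kind k = 1 ∨ 3 < I.env.kind k) :
    I.env.argFirst k < k ∧ I.formula.subs[I.env.argFirst k]? = some χ.firstArg := by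
  have key := I.formula.argsFirst_subs k χ h
  rw [env_kind_eq h] at h1
  unfold Env.argFirst
  rw [env_off_eq h]
  cases χ with
  | or φ ψ => exact ⟨by have := key.1; omega, key.2.2⟩
  | untl C r d φ ψ => exact ⟨by have := key.1; omega, key.2.2⟩
  | release C r d φ ψ => exact ⟨by have := key.1; omega, key.2.2⟩
  | _ => simp [PATL.toNode] at h1

/-! ### The truth table -/

variable {v : TVar → ℝ}
  {tr : Fin I.sys.nS → (Fin nAg → Fin nAct) → Fin I.sys.nS → ℝ}
  {htr : ∀ s α, I.sys.toFrame.LegalProfile s α → tr s α ∈ stdSimplex ℝ (Fin I.sys.nS)}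

/-- The entries of the truth table for propositional formulas are right if those for their
arguments are. -/
theorem tableEntryForm_iff (hlt : ∀ i < k, ∀ ξ, I.formula.subs[i]? = some ξ →
      TruthReads v I i (ξ.Sat (I.withTrans tr htr) I.bound)) (h3 : I.env.kind k < 3)
    (t : Fin I.sys.nS) : (I.env.tableEntryForm nAg nAct k t).Holds v ↔
      ((I.env.truthVar nAg nAct k t).eval v = 0 ∨ (I.env.truthVar nAg nAct k t).eval v = 1) ∧
        ((I.env.isTrue nAg nAct k t).Holds v ↔ χ.Sat (I.withTrans tr htr) I.bound t) := by
  have hl := fun h1 => let h2 := getElem?_argLast h h1; (hlt _ h2.1 _ h2.2).isTrue_iff t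
  have hf := fun h1 => let h2 := getElem?_argFirst h h1; (hlt _ h2.1 _ h2.2).isTrue_iff t
  unfold Env.tableEntryForm
  rw [RealFormula.holds_and, RealFormula.holds_or, RealFormula.holds_eq, RealFormula.holds_eq,
    PolyExpr.eval_const, PolyExpr.eval_const, Rat.cast_zero, Rat.cast_one]
  refine and_congr_right fun _ => ?_
  have hkind := env_kind_eq h
  have hoff := env_off_eq h
  cases χ with
  | atom p =>
    simp only [PATL.toNode] at hkind hoff
    rw [hkind, hoff, env_label_eq, beq_self_true, cond_true]
    by_cases hp : p ∈ I.sys.label t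
    · simp only [hp, decide_true, cond_true]
      exact (iff_true_right hp).symm
    · simp only [hp, decide_false, cond_false, RealFormula.holds_not]
      exact (iff_false_right hp).symm
  | or φ ψ =>
    simp only [PATL.toNode] at hkind
    have hl := hl (by omega)
    have hf := hf (by omega)
    rw [hkind, beq_eq_false (by omega), cond_false, beq_self_true, cond_true,
      RealFormula.holds_iff, RealFormula.holds_or, hl, hf]
    exact Iff.rfl
  | not φ =>
    simp only [PATL.toNode] at hkind
    have hl := hl (by omega)
    rw [hkind, beq_eq_false (by omega), cond_false, beq_eq_false (by omega), cond_false,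
      beq_self_true, cond_true, RealFormula.holds_iff, RealFormula.holds_not, hl]
    exact Iff.rfl
  | _ => simp [PATL.toNode] at hkind; omega

omit h in
theorem tableEntryForm_iff_of_le (h3 : 3 ≤ I.env.kind k) (t : ℕ) :
    (I.env.tableEntryForm nAg nAct k t).Holds v ↔
      (I.env.truthVar nAg nAct k t).eval v = 0 ∨ (I.env.truthVar nAg nAct k t).eval v = 1 := by
  unfold Env.tableEntryForm
  rw [beq_eq_false (by omega), beq_eq_false (by omega), beq_eq_false (by omega)]
  simp

end Nodes

/-! ## Well-defined valuations -/

section Premise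

variable {nAg nAct nAP : ℕ} {I : ParamMCInstance nAg nAct nAP} {v : TVar → ℝ}
  {x : Fin I.sys.nX → ℝ}

theorem eval_param (hv : ∀ i : Fin I.sys.nX, v (1, i) = x i) (f : PolyExpr (Fin I.sys.nX)) :
    (Env.param (f.rename Fin.val)).eval v = f.eval x := by
  rw [Env.param, PolyExpr.eval_rename, PolyExpr.eval_rename]
  simp only [hv]

theorem transForm_iff (hv : ∀ i : Fin I.sys.nX, v (1, i) = x i) :
    (I.env.transForm nAg nAct).Holds v ↔ ∀ s α, I.sys.toFrame.LegalProfile s α →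
      (∀ s', (I.sys.trans s α s').den.eval x ≠ 0 ∧
        (I.env.transVar nAg nAct s (finFunctionFinEquiv α) s').eval v =
          (I.sys.trans s α s').eval x) ∧
      (fun s' : Fin I.sys.nS => (I.env.transVar nAg nAct s (finFunctionFinEquiv α) s').eval v) ∈
        stdSimplex ℝ (Fin I.sys.nS) := by
  unfold Env.transForm
  simp only [RealFormula.holds_conj, List.forall_mem_map, env_nS_eq, forall_mem_range,
    forall_mem_profiles]
  refine forall_congr' fun s => forall_congr' fun α => ?_
  by_cases hα : I.sys.toFrame.LegalProfile s α
  · rw [(legalProfile_iff I s α).2 hα]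
    simp only [cond_true, RealFormula.holds_and, RealFormula.holds_conj, List.forall_mem_map,
      forall_mem_range, RealFormula.holds_not, RealFormula.holds_eq, env_trans_eq,
      eval_param hv, PolyExpr.eval_mul, PolyExpr.eval_const, Rat.cast_zero, hα, forall_true_left,
      holds_dist_range]
    refine and_congr (forall_congr' fun s' => and_congr_right fun h => ?_) Iff.rfl
    rw [RatFun.eval, eq_div_iff h]
  · have h : I.env.legalProfile nAg s (rawProfile α) = false := by
      rw [← Bool.not_eq_true, legalProfile_iff]; exact hα
    simp [h, hα]

theorem constraintForm_iff (hv : ∀ i : Fin I.sys.nX, v (1, i) = x i)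
    (c : PolyConstraint I.sys.nX) :
    (Env.constraintForm (c.lhs.rename Fin.val, c.rel.num, c.rhs.rename Fin.val)).Holds v ↔
      c.rel.Rel (c.lhs.eval x) (c.rhs.eval x) := by
  unfold Env.constraintForm
  cases h : c.rel <;> simp [CmpEq.num, CmpEq.Rel, Nat.beq, eval_param hv]

/-- The formulas on the parameters say that the valuation is well-defined and that the transition
variables are the resulting transition probabilities. -/
theorem parameters_iff (hv : ∀ i : Fin I.sys.nX, v (1, i) = x i) :
    ((I.env.transForm nAg nAct).Holds v ∧
      (RealFormula.conj (I.env.constraints.map Env.constraintForm)).Holds v) ↔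
      I.sys.WellDefined x ∧ TransReads v fun s α s' => (I.sys.trans s α s').eval x := by
  have hc : (RealFormula.conj (I.env.constraints.map Env.constraintForm)).Holds v ↔
      ∀ c ∈ I.sys.constraints, c.rel.Rel (c.lhs.eval x) (c.rhs.eval x) := by
    have : I.env.constraints = I.sys.constraints.map fun c =>
      (c.lhs.rename Fin.val, c.rel.num, c.rhs.rename Fin.val) := rfl
    rw [this]
    simp only [RealFormula.holds_conj, List.forall_mem_map, constraintForm_iff hv]
  rw [transForm_iff hv, hc]
  constructor
  · rintro ⟨h1, h2⟩
    refine ⟨⟨fun s α hα s' => ((h1 s α hα).1 s').1, fun s α hα s' => ?_, fun s α hα => ?_, h2⟩,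
      fun s α s' hα => ((h1 s α hα).1 s').2⟩
    · rw [← ((h1 s α hα).1 s').2]
      exact (h1 s α hα).2.1 s'
    · simp only [← ((h1 s α hα).1 _).2]
      exact (h1 s α hα).2.2
  · rintro ⟨h1, h2⟩
    refine ⟨fun s α hα => ⟨fun s' => ⟨h1.den_ne_zero s α hα s', h2 s α s' hα⟩, ?_⟩,
      h1.constraints⟩
    simp only [h2 s α _ hα]
    exact ⟨h1.nonneg s α hα, h1.sum_eq_one s α hα⟩

end Premise


/-! ## Valuations of the variables -/

/-- The maps of the schedulers of a coalition, on natural numbers. -/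
structure RawStrategy where
  start : ℕ → ℕ → ℕ → ℝ
  next : ℕ → ℕ → ℕ → ℕ → ℝ
  act : ℕ → ℕ → ℕ → ℕ → ℝ

section Valuations

variable {nAg nAct nAP : ℕ} {I : ParamMCInstance nAg nAct nAP} {C : Finset (Fin nAg)}

structure RawStrategy.Reads (R : RawStrategy)
    (σ : CoalitionStrategy I.sys.toFrame C I.bound) : Prop where
  start : ∀ (a : C) (o : Fin (I.sys.nO a)) (q : Fin I.bound),
    R.start (a : Fin nAg) o q = (σ a).start o q
  next : ∀ (a : C) (q : Fin I.bound) (o : Fin (I.sys.nO a)) (q' : Fin I.bound),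
    R.next (a : Fin nAg) q o q' = (σ a).next q o q'
  act : ∀ (a : C) (q : Fin I.bound) (o : Fin (I.sys.nO a)) (x : Fin nAct),
    R.act (a : Fin nAg) q o x = (σ a).act q o x

/-- Extension by zero to all natural numbers; the values out of range are never read. -/
theorem exists_rawStrategy (σ : CoalitionStrategy I.sys.toFrame C I.bound) :
    ∃ R : RawStrategy, R.Reads σ := by
  refine ⟨⟨fun a o q =>
    if ha : ∃ ha : a < nAg, (⟨a, ha⟩ : Fin nAg) ∈ C then
      if h : o < I.sys.nO ⟨a, ha.1⟩ ∧ q < I.bound then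
        (σ ⟨⟨a, ha.1⟩, ha.2⟩).start ⟨o, h.1⟩ ⟨q, h.2⟩ else 0 else 0,
    fun a q o q' => if ha : ∃ ha : a < nAg, (⟨a, ha⟩ : Fin nAg) ∈ C then
      if h : q < I.bound ∧ o < I.sys.nO ⟨a, ha.1⟩ ∧ q' < I.bound then
        (σ ⟨⟨a, ha.1⟩, ha.2⟩).next ⟨q, h.1⟩ ⟨o, h.2.1⟩ ⟨q', h.2.2⟩ else 0 else 0,
    fun a q o x => if ha : ∃ ha : a < nAg, (⟨a, ha⟩ : Fin nAg) ∈ C then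
      if h : q < I.bound ∧ o < I.sys.nO ⟨a, ha.1⟩ ∧ x < nAct then
        (σ ⟨⟨a, ha.1⟩, ha.2⟩).act ⟨q, h.1⟩ ⟨o, h.2.1⟩ ⟨x, h.2.2⟩ else 0 else 0⟩, ?_, ?_, ?_⟩
  · intro a o q
    have h : ∃ ha : (a : Fin nAg).val < nAg, (⟨(a : Fin nAg).val, ha⟩ : Fin nAg) ∈ C :=
      ⟨a.1.2, a.2⟩
    simp only
    rw [dif_pos h, dif_pos ⟨o.2, q.2⟩]
  · intro a q o q'
    have h : ∃ ha : (a : Fin nAg).val < nAg, (⟨(a : Fin nAg).val, ha⟩ : Fin nAg) ∈ C :=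
      ⟨a.1.2, a.2⟩
    simp only
    rw [dif_pos h, dif_pos ⟨q.2, o.2, q'.2⟩]
  · intro a q o x
    have h : ∃ ha : (a : Fin nAg).val < nAg, (⟨(a : Fin nAg).val, ha⟩ : Fin nAg) ∈ C :=
      ⟨a.1.2, a.2⟩
    simp only
    rw [dif_pos h, dif_pos ⟨q.2, o.2, x.2⟩]

/-- Modes are determined by the entries of their list. -/
theorem exists_raw_of_conf (u : Conf I.sys.toFrame C I.bound → ℝ) :
    ∃ U : ℕ → (ℕ → ℕ) → ℝ, ∀ c, U c.1 (fun i => (rawModes c.2).getD i 0) = u c := by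
  have hinj : Function.Injective fun c : Conf I.sys.toFrame C I.bound =>
      ((c.1 : ℕ), fun i => (rawModes c.2).getD i 0) := by
    rintro ⟨s, q⟩ ⟨s', q'⟩ h
    simp only [Prod.mk.injEq] at h
    refine Prod.ext (Fin.ext h.1) (funext fun a => Fin.ext ?_)
    have := congrFun h.2 (a : Fin nAg)
    rwa [rawModes_getD, rawModes_getD] at this
  refine ⟨fun s q => Function.extend (fun c : Conf I.sys.toFrame C I.bound =>
    ((c.1 : ℕ), fun i => (rawModes c.2).getD i 0)) u 0 (s, q), fun c => hinj.extend_apply u 0 c⟩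

/-- The values of all variables of a quantifier block. -/
structure BlockValues where
  param : ℕ → ℝ
  trans : ℕ → ℕ → ℕ → ℝ
  truth : ℕ → ℕ → ℝ
  strategy : ℕ → ℕ → RawStrategy
  value : ℕ → (ℕ → ℕ) → ℝ
  rank : ℕ → (ℕ → ℕ) → ℝ

/-- The value of the variable with the digits `d`. -/
def BlockValues.ofDigits (B : BlockValues) (d : ℕ → ℕ) : ℝ :=
  match d 0 with
  | 0 => B.trans (d 1) (d 2) (d 3)
  | 1 => B.truth (d 1) (d 2)
  | 2 => (B.strategy (d 1) (d 2)).start (d 3) (d 4) (d 5)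
  | 3 => (B.strategy (d 1) (d 2)).next (d 3) (d 4) (d 5) (d 6)
  | 4 => (B.strategy (d 1) (d 2)).act (d 3) (d 4) (d 5) (d 6)
  | 5 => B.value (d 1) fun i => d (i + 2)
  | _ => B.rank (d 1) fun i => d (i + 2)

/-- The block as a sequence of real numbers. -/
def BlockValues.toSeq (nAg nAct : ℕ) (e : Env) (B : BlockValues) (n : ℕ) : ℝ :=
  if n < e.nX then B.param n else B.ofDigits (digit (e.base nAg nAct) (n - e.nX))

/-- The number of the variable lies beyond the parameters, and its digits recover the index list, so
the variable takes the value that was prescribed for this index. -/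
theorem eval_var_toSeq {e : Env} {B : BlockValues} {v : TVar → ℝ} {j : Fin 3}
    (hv : ∀ n, v (j, n) = B.toSeq nAg nAct e n) (l : List ℕ) (hl : l.length ≤ nAg + 8)
    (hlt : ∀ m ∈ l, m < e.base nAg nAct) :
    (e.var nAg nAct j l).eval v = B.ofDigits fun i => l.getD i 0 := by
  rw [Env.var, PolyExpr.eval_var, hv, BlockValues.toSeq, if_neg (by omega),
    Nat.add_sub_cancel_left]
  congr 1
  funext i
  exact digit_horner (by unfold Env.base; omega) _ l i hl hlt

theorem nO_le_sum (I : ParamMCInstance nAg nAct nAP) (a : Fin nAg) :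
    I.sys.nO a ≤ (List.ofFn I.sys.nO).sum := by
  rw [List.sum_ofFn]
  exact Finset.single_le_sum (fun _ _ => Nat.zero_le _) (Finset.mem_univ a)

theorem env_base_eq (I : ParamMCInstance nAg nAct nAP) : I.env.base nAg nAct =
    I.sys.nS + I.formula.subs.length + (List.ofFn I.sys.nO).sum + I.bound +
      (7 + nAg + nAct + nAct ^ nAg) := by
  rw [← env_nodes_length]
  rfl

variable {B : BlockValues} {v : TVar → ℝ} {j : Fin 3}
  (hv : ∀ n, v (j, n) = B.toSeq nAg nAct I.env n)

include hv

theorem eval_transVar_toSeq (hj : j = 1) (s : Fin I.sys.nS) (α : Fin nAg → Fin nAct)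
    (s' : Fin I.sys.nS) : (I.env.transVar nAg nAct s (finFunctionFinEquiv α) s').eval v =
      B.trans s (finFunctionFinEquiv α) s' := by
  subst hj
  rw [Env.transVar, eval_var_toSeq hv]
  · rfl
  · simp
  · have := (finFunctionFinEquiv α).2
    simp only [List.mem_cons, List.not_mem_nil, or_false, forall_eq_or_imp, forall_eq,
      env_base_eq]
    omega

theorem eval_truthVar_toSeq (hj : j = 1) {k : ℕ} (hk : k < I.formula.subs.length)
    (s : Fin I.sys.nS) : (I.env.truthVar nAg nAct k s).eval v = B.truth k s := by
  subst hj
  rw [Env.truthVar, eval_var_toSeq hv]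
  · rfl
  · simp
  · simp only [List.mem_cons, List.not_mem_nil, or_false, forall_eq_or_imp, forall_eq,
      env_base_eq]
    omega

theorem strategyReads_toSeq {k : ℕ} (hk : k < I.formula.subs.length) (s : Fin I.sys.nS)
    {σ : CoalitionStrategy I.sys.toFrame C I.bound} (h : (B.strategy k s).Reads σ) :
    StrategyReads v j k s σ := by
  intro a
  have hO := nO_le_sum I (a : Fin nAg)
  refine ⟨fun o q => ?_, fun q o q' => ?_, fun q o x => ?_⟩
  · rw [Env.startVar, eval_var_toSeq hv]
    · exact h.start a o q
    · simp
    · simp only [List.mem_cons, List.not_mem_nil, or_false, forall_eq_or_imp, forall_eq,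
        env_base_eq]
      omega
  · rw [Env.nextVar, eval_var_toSeq hv]
    · exact h.next a q o q'
    · simp
    · simp only [List.mem_cons, List.not_mem_nil, or_false, forall_eq_or_imp, forall_eq,
        env_base_eq]
      omega
  · rw [Env.actVar, eval_var_toSeq hv]
    · exact h.act a q o x
    · simp
    · simp only [List.mem_cons, List.not_mem_nil, or_false, forall_eq_or_imp, forall_eq,
        env_base_eq]
      omega

theorem eval_conf_toSeq (m : ℕ) (hm : m < 7) (c : Conf I.sys.toFrame C I.bound) :
    (I.env.var nAg nAct j (m :: (rawConf c).1 :: (rawConf c).2)).eval v =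
      B.ofDigits fun i => (m :: (c.1 : ℕ) :: rawModes c.2).getD i 0 := by
  refine eval_var_toSeq hv _ (by simp [rawConf, rawModes]) ?_
  simp only [List.mem_cons, forall_eq_or_imp, env_base_eq, rawConf]
  refine ⟨by omega, by omega, fun i hi => ?_⟩
  obtain ⟨a, rfl⟩ := (List.mem_ofFn).1 hi
  have := I.bound.pos
  split_ifs <;> omega

theorem valueOf_toSeq (hj : j = 2) {u : Conf I.sys.toFrame C I.bound → ℝ}
    (h : ∀ c, B.value c.1 (fun i => (rawModes c.2).getD i 0) = u c) : valueOf v I = u := by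
  subst hj
  funext c
  rw [valueOf, Env.valVar, eval_conf_toSeq hv 5 (by omega)]
  exact h c

theorem rankOf_toSeq (hj : j = 2) {u : Conf I.sys.toFrame C I.bound → ℝ}
    (h : ∀ c, B.rank c.1 (fun i => (rawModes c.2).getD i 0) = u c) : rankOf v I = u := by
  subst hj
  funext c
  rw [rankOf, Env.rankVar, eval_conf_toSeq hv 6 (by omega)]
  exact h c

end Valuations

/-! ## The reduction -/

section Reduction

variable {nAg nAct nAP : ℕ} (I : ParamMCInstance nAg nAct nAP)

/-- The valuation that is given by the three quantifier blocks. -/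
def blocks (x y z : ℕ → ℝ) : TVar → ℝ := fun w => ![x, y, z] w.1 w.2

/-- What the universal block claims is not affected by a change of the last block; this allows the
answer `z` to be chosen after inspection of the table. -/
theorem eval_var_one (x y z z' : ℕ → ℝ) (e : Env) (l : List ℕ) :
    (e.var nAg nAct 1 l).eval (blocks x y z) = (e.var nAg nAct 1 l).eval (blocks x y z') := by
  rw [Env.var, PolyExpr.eval_var, PolyExpr.eval_var]
  rfl

/-- The last block can be chosen to be a given strategy, with given values and ranks. -/
theorem exists_last_block {C : Finset (Fin nAg)} {k : ℕ} (hk : k < I.formula.subs.length)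
    (s : Fin I.sys.nS) (σ : CoalitionStrategy I.sys.toFrame C I.bound)
    (u rk : Conf I.sys.toFrame C I.bound → ℝ) : ∃ z : ℕ → ℝ, ∀ x y,
      StrategyReads (blocks x y z) 2 k s σ ∧ valueOf (blocks x y z) I = u ∧
        rankOf (blocks x y z) I = rk := by
  obtain ⟨R, hR⟩ := exists_rawStrategy σ
  obtain ⟨U, hU⟩ := exists_raw_of_conf u
  obtain ⟨K, hK⟩ := exists_raw_of_conf rk
  -- The same strategy is stored under all indices, since only the one at `(k, s)` will be read. In
  -- this block only strategies, values and ranks occur in the sentence.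
  let B : BlockValues := ⟨0, 0, 0, fun _ _ => R, U, K⟩
  refine ⟨B.toSeq nAg nAct I.env, fun x y => ?_⟩
  have hv : ∀ n, blocks x y (B.toSeq nAg nAct I.env) (2, n) = B.toSeq nAg nAct I.env n :=
    fun _ => rfl
  exact ⟨strategyReads_toSeq hv hk s hR, valueOf_toSeq hv rfl hU, rankOf_toSeq hv rfl hK⟩

theorem sentence_iff (v : TVar → ℝ) : (I.env.sentence nAg nAct).Holds v ↔
    ((I.env.premise nAg nAct).Holds v →
      (I.env.isTrue nAg nAct (I.formula.subs.length - 1) I.state).Holds v ∨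
      ∃ (k : Fin I.formula.subs.length) (s : Fin I.sys.nS), 3 ≤ I.env.kind k ∧
        (I.env.refuteForm nAg nAct k s).Holds v) := by
  unfold Env.sentence
  simp only [RealFormula.holds_imp, RealFormula.holds_or, RealFormula.holds_disj,
    exists_mem_map_iff, env_nodes_length, env_nS_eq, exists_mem_range, env_state_eq]
  refine imp_congr_right fun _ => or_congr_right (exists₂_congr fun k s => ?_)
  by_cases h : 3 ≤ I.env.kind k
  · simp [Nat.ble_eq_true_of_le h, h]
  · have : Nat.ble 3 (I.env.kind k) = false := by
      rw [← Bool.not_eq_true, Nat.ble_eq]; exact h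
    simp [this, h]

theorem premise_iff (v : TVar → ℝ) : (I.env.premise nAg nAct).Holds v ↔
    ((I.env.transForm nAg nAct).Holds v ∧
      (RealFormula.conj (I.env.constraints.map Env.constraintForm)).Holds v) ∧
    ∀ (k : Fin I.formula.subs.length) (s : Fin I.sys.nS),
      (I.env.tableEntryForm nAg nAct k s).Holds v := by
  unfold Env.premise
  simp only [RealFormula.holds_and, RealFormula.holds_conj, List.forall_mem_map,
    env_nodes_length, env_nS_eq, forall_mem_range, and_assoc]

theorem refuteForm_iff (k s : ℕ) (v : TVar → ℝ) : (I.env.refuteForm nAg nAct k s).Holds v ↔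
    ((I.env.isTrue nAg nAct k s).Holds v ∧ (¬ (I.env.strategyForm nAg nAct 1 k s).Holds v ∨
      (I.env.certForm nAg nAct 1 k s).Holds v ∧ ¬ (I.env.cmpForm nAg nAct 1 k s).Holds v)) ∨
    (¬ (I.env.isTrue nAg nAct k s).Holds v ∧ (I.env.strategyForm nAg nAct 2 k s).Holds v ∧
      (I.env.certForm nAg nAct 2 k s).Holds v ∧ (I.env.cmpForm nAg nAct 2 k s).Holds v) :=
  Iff.rfl

variable {I}

theorem truthReads_of_isTrue_iff {v : TVar → ℝ} {i : ℕ} {p : Fin I.sys.nS → Prop}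
    (h : ∀ t : Fin I.sys.nS, (I.env.truthVar nAg nAct i t).eval v = 0 ∨
      (I.env.truthVar nAg nAct i t).eval v = 1)
    (h' : ∀ t : Fin I.sys.nS, (I.env.isTrue nAg nAct i t).Holds v ↔ p t) :
    TruthReads v I i p := by
  intro t
  have h' := h' t
  unfold Env.isTrue at h'
  rw [RealFormula.holds_pos] at h'
  rcases h t with h0 | h0
  · rw [h0] at h' ⊢
    simp only [lt_self_iff_false, false_iff] at h'
    exact ⟨fun h => absurd h h', fun _ => rfl⟩
  · rw [h0] at h' ⊢
    simp only [zero_lt_one, true_iff] at h'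
    exact ⟨fun _ => rfl, fun h => absurd h' h⟩

/-- The strategy `σ` of the coalition of `χ` enforces `χ` from the state `s`. -/
def PATL.Wins (M : StochSystem nAg nAct nAP) (b : ℕ) (χ : PATL nAg nAP)
    (σ : CoalitionStrategy M.toFrame χ.coalition b) (s : Fin M.nS) : Prop :=
  ∀ μ : OpponentStrategy M.toFrame χ.coalition b, χ.rel.Rel ((outcome M σ μ s).real
    {ω | (fun n => (ω n).1) ∈
      playSet χ.toNode.1 (χ.lastArg.Sat M b) (χ.firstArg.Sat M b)}) χ.toNode.2.2.2.1

theorem PATL.sat_iff_exists_wins (M : StochSystem nAg nAct nAP) (b : ℕ) {χ : PATL nAg nAP}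
    (h : 3 ≤ χ.toNode.1) (s : Fin M.nS) : χ.Sat M b s ↔ ∃ σ, χ.Wins M b σ s :=
  χ.sat_iff_enforces M b h s

section Coalition

variable {v : TVar → ℝ} {tr : Fin I.sys.nS → (Fin nAg → Fin nAct) → Fin I.sys.nS → ℝ}
  (htr : ∀ s α, I.sys.toFrame.LegalProfile s α → tr s α ∈ stdSimplex ℝ (Fin I.sys.nS))
  {k : ℕ} {χ : PATL nAg nAP} (h : I.formula.subs[k]? = some χ) (h3 : 3 ≤ I.env.kind k)

include h h3

theorem cmpForm_iff_wins (hlt : ∀ i < k, ∀ ξ, I.formula.subs[i]? = some ξ →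
      TruthReads v I i (ξ.Sat (I.withTrans tr htr) I.bound))
    (ht : TransReads v tr) {j : Fin 3} (s : Fin I.sys.nS)
    {σ : CoalitionStrategy I.sys.toFrame χ.coalition I.bound} (hσ : StrategyReads v j k s σ)
    (hc : (I.env.certForm nAg nAct j k s).Holds v) :
    (I.env.cmpForm nAg nAct j k s).Holds v ↔ χ.Wins (I.withTrans tr htr) I.bound σ s := by
  have hl := getElem?_argLast h (by omega)
  have key := cmpForm_iff_of_certForm htr (env_mem_eq h h3) hσ ht (env_kind_cases h h3)
    (env_cmp_eq h h3) (hlt _ hl.1 _ hl.2)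
    (fun hne => let hf := getElem?_argFirst h (by omega); hlt _ hf.1 _ hf.2) s rfl hc
  rw [env_kind_eq h, env_thr_eq h] at key
  exact key

theorem exists_certForm_of_strategy
    (σ : CoalitionStrategy I.sys.toFrame χ.coalition I.bound) :
    ∃ u rk : Conf I.sys.toFrame χ.coalition I.bound → ℝ, ∀ (v : TVar → ℝ) (j : Fin 3) (s : ℕ),
      (∀ i < k, ∀ ξ, I.formula.subs[i]? = some ξ →
        TruthReads v I i (ξ.Sat (I.withTrans tr htr) I.bound)) →
      StrategyReads v j k s σ → TransReads v tr →
      valueOf v I = u → rankOf v I = rk → (I.env.certForm nAg nAct j k s).Holds v := by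
  obtain ⟨u, rk, hu⟩ := exists_certForm htr (env_mem_eq h h3) σ
    (χ.lastArg.Sat (I.withTrans tr htr) I.bound)
    (χ.firstArg.Sat (I.withTrans tr htr) I.bound) (env_kind_cases h h3)
  have hl := getElem?_argLast h (by omega)
  exact ⟨u, rk, fun v j s hlt hσ ht => hu v j s hσ ht (hlt _ hl.1 _ hl.2)
    fun hne => let hf := getElem?_argFirst h (by omega); hlt _ hf.1 _ hf.2⟩

end Coalition

/-! ### Correctness of the reduction -/

/-- If no choice of the last block satisfies the sentence, the table is the truth table. -/
theorem truthReads_of_forall_not {x y : ℕ → ℝ}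
    (hno : ∀ z, ¬ (I.env.sentence nAg nAct).Holds (blocks x y z))
    {tr : Fin I.sys.nS → (Fin nAg → Fin nAct) → Fin I.sys.nS → ℝ}
    (htr : ∀ s α, I.sys.toFrame.LegalProfile s α → tr s α ∈ stdSimplex ℝ (Fin I.sys.nS))
    (ht : ∀ z, TransReads (blocks x y z) tr) (k : ℕ) :
    ∀ χ, I.formula.subs[k]? = some χ → ∀ z,
      TruthReads (blocks x y z) I k (χ.Sat (I.withTrans tr htr) I.bound) := by
  have hno' : ∀ z, (∀ (k : Fin I.formula.subs.length) (s : Fin I.sys.nS),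
      (I.env.tableEntryForm nAg nAct k s).Holds (blocks x y z)) ∧
      ∀ (k : Fin I.formula.subs.length) (s : Fin I.sys.nS), 3 ≤ I.env.kind k →
        ¬ (I.env.refuteForm nAg nAct k s).Holds (blocks x y z) := by
    intro z
    have := hno z
    rw [sentence_iff, premise_iff] at this
    push Not at this
    exact ⟨this.1.2, this.2.2⟩
  -- Arguments precede the formulas that contain them, so their entries are already known to be
  -- right.
  induction k using Nat.strong_induction_on with
  | _ k ih =>
  intro χ h z
  have hk : k < I.formula.subs.length := (List.getElem?_eq_some_iff.1 h).1
  have hentry := fun z t => (hno' z).1 ⟨k, hk⟩ t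
  by_cases h3 : I.env.kind k < 3
  · have := fun t => (tableEntryForm_iff h (fun i hi ξ hξ => ih i hi ξ hξ z) h3 t).1 (hentry z t)
    exact truthReads_of_isTrue_iff (fun t => (this t).1) fun t => (this t).2
  · have h3 : 3 ≤ I.env.kind k := not_lt.1 h3
    have h3' : 3 ≤ χ.toNode.1 := by rwa [← env_kind_eq h]
    refine truthReads_of_isTrue_iff (fun t => (tableEntryForm_iff_of_le h3 t).1 (hentry z t))
      fun t => ?_
    have htrue : ∀ z', (I.env.isTrue nAg nAct k t).Holds (blocks x y z) ↔
        (I.env.isTrue nAg nAct k t).Holds (blocks x y z') := by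
      intro z'
      unfold Env.isTrue Env.truthVar
      rw [RealFormula.holds_pos, RealFormula.holds_pos, eval_var_one x y z z']
    have href : ∀ z', ¬ (I.env.refuteForm nAg nAct k t).Holds (blocks x y z') :=
      fun z' => (hno' z').2 ⟨k, hk⟩ t h3
    rw [PATL.sat_iff_exists_wins _ _ h3']
    constructor
    -- An entry marked true: the universal block must contain a strategy. A new last block `z'`
    -- carries the certificate of this strategy, and if its value violated the bound, the entry
    -- would be refuted.
    · intro hT
      have hs : (I.env.strategyForm nAg nAct 1 k t).Holds (blocks x y z) := by
        by_contra hs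
        exact href z ((refuteForm_iff I k t _).2 (.inl ⟨hT, .inl hs⟩))
      obtain ⟨σ, hσ⟩ := (strategyForm_iff _ (env_mem_eq h h3) t).1 hs
      obtain ⟨u, rk, hu⟩ := exists_certForm_of_strategy htr h h3 σ
      obtain ⟨z', hz'⟩ := exists_last_block I hk t σ u rk
      have hσ' : StrategyReads (blocks x y z') 1 k t σ := by
        intro a
        refine ⟨fun o q => ?_, fun q o q' => ?_, fun q o w => ?_⟩
        · rw [← (hσ a).start]; exact eval_var_one ..
        · rw [← (hσ a).next]; exact eval_var_one ..
        · rw [← (hσ a).act]; exact eval_var_one ..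
      have hlt := fun i hi ξ hξ => ih i hi ξ hξ z'
      have hcert := hu _ 1 t hlt hσ' (ht z') (hz' x y).2.1 (hz' x y).2.2
      refine ⟨σ, (cmpForm_iff_wins htr h h3 hlt (ht z') t hσ' hcert).1 ?_⟩
      by_contra hcmp
      exact href z' ((refuteForm_iff I k t _).2 (.inl ⟨(htrue z').1 hT, .inr ⟨hcert, hcmp⟩⟩))
    -- If the formula holds but the entry is false, the winning strategy and its certificate,
    -- written into the last block, refute the entry.
    · rintro ⟨σ, hσ⟩
      by_contra hT
      obtain ⟨u, rk, hu⟩ := exists_certForm_of_strategy htr h h3 σ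
      obtain ⟨z', hz'⟩ := exists_last_block I hk t σ u rk
      have hσ' := (hz' x y).1
      have hlt := fun i hi ξ hξ => ih i hi ξ hξ z'
      have hcert := hu _ 2 t hlt hσ' (ht z') (hz' x y).2.1 (hz' x y).2.2
      exact href z' ((refuteForm_iff I k t _).2 (.inr ⟨fun hT' => hT ((htrue z').2 hT'),
        (strategyForm_iff _ (env_mem_eq h h3) t).2 ⟨σ, hσ'⟩, hcert,
        (cmpForm_iff_wins htr h h3 hlt (ht z') t hσ' hcert).2 hσ⟩))

/-- If no `z` worked, the premise would hold and the table would be correct. Then it would affirm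
the formula, which holds by assumption, and the sentence would be true after all. -/
theorem exists_holds_of_yes (hI : (paramModelChecking nAg nAct nAP).Yes I) (x y : ℕ → ℝ) :
    ∃ z, (I.env.sentence nAg nAct).Holds (blocks x y z) := by
  by_contra hno
  push Not at hno
  have hpre : ∀ z, (I.env.premise nAg nAct).Holds (blocks x y z) := by
    intro z
    have := hno z
    rw [sentence_iff] at this
    push Not at this
    exact this.1
  have hp : ∀ z, I.sys.WellDefined (fun i => y i) ∧
      TransReads (blocks x y z) fun s α s' => (I.sys.trans s α s').eval fun i => y i :=
    fun z => (parameters_iff fun _ => rfl).1 ((premise_iff I _).1 (hpre z)).1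
  have hx := (hp 0).1
  have key := truthReads_of_forall_not hno (I.sys.instantiate _ hx).trans_mem
    (fun z => (hp z).2) _ _ I.formula.getElem?_subs_last 0
  refine hno 0 ((sentence_iff I _).2 fun _ => .inl ((key.isTrue_iff I.state).2 ?_))
  exact hI _ hx

/-- Under a well-defined valuation, the second block can be chosen to be this valuation, the
transition probabilities, the truth table and enforcing strategies. -/
theorem exists_second_block (x : Fin I.sys.nX → ℝ)
    {tr : Fin I.sys.nS → (Fin nAg → Fin nAct) → Fin I.sys.nS → ℝ}
    (htr : ∀ s α, I.sys.toFrame.LegalProfile s α → tr s α ∈ stdSimplex ℝ (Fin I.sys.nS)) :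
    ∃ y : ℕ → ℝ, (∀ i : Fin I.sys.nX, y i = x i) ∧ ∀ x₀ z, TransReads (blocks x₀ y z) tr ∧
      ∀ k χ, I.formula.subs[k]? = some χ →
        TruthReads (blocks x₀ y z) I k (χ.Sat (I.withTrans tr htr) I.bound) ∧
        (3 ≤ I.env.kind k → ∀ s : Fin I.sys.nS, χ.Sat (I.withTrans tr htr) I.bound s →
          ∃ σ, StrategyReads (blocks x₀ y z) 1 k s σ ∧
            χ.Wins (I.withTrans tr htr) I.bound σ s) := by
  classical
  -- One winning strategy for each correct coalition entry, indexed by natural numbers as the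
  -- variables are. Entries that are false get the zero assignment, which is never consulted.
  have hR : ∀ k s : ℕ, ∃ R : RawStrategy, ∀ χ, I.formula.subs[k]? = some χ →
      3 ≤ I.env.kind k → ∀ t : Fin I.sys.nS, (t : ℕ) = s →
      χ.Sat (I.withTrans tr htr) I.bound t →
      ∃ σ : CoalitionStrategy I.sys.toFrame χ.coalition I.bound, R.Reads σ ∧
        χ.Wins (I.withTrans tr htr) I.bound σ t := by
    intro k s
    by_cases h : ∃ χ, I.formula.subs[k]? = some χ ∧ 3 ≤ I.env.kind k ∧
      ∃ t : Fin I.sys.nS, (t : ℕ) = s ∧ χ.Sat (I.withTrans tr htr) I.bound t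
    · obtain ⟨χ, h, h3, t, rfl, hs⟩ := h
      obtain ⟨σ, hσ⟩ := (PATL.sat_iff_exists_wins (I.withTrans _ htr) I.bound
        (by rwa [← env_kind_eq h]) t).1 hs
      obtain ⟨R, hR⟩ := exists_rawStrategy σ
      refine ⟨R, fun χ' h' _ t' ht' _ => ?_⟩
      obtain rfl : χ = χ' := Option.some.inj (h.symm.trans h')
      obtain rfl : t' = t := Fin.ext ht'
      exact ⟨σ, hR, hσ⟩
    · exact ⟨⟨0, 0, 0⟩, fun χ h1 h2 t h4 h5 => absurd ⟨χ, h1, h2, t, h4, h5⟩ h⟩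
  choose R hR using hR
  let B : BlockValues := {
    param := fun n => if h : n < I.sys.nX then x ⟨n, h⟩ else 0
    trans := fun s i s' => if h : s < I.sys.nS ∧ i < nAct ^ nAg ∧ s' < I.sys.nS then
      tr ⟨s, h.1⟩ (finFunctionFinEquiv.symm ⟨i, h.2.1⟩) ⟨s', h.2.2⟩ else 0
    truth := fun k s => if ∃ χ, I.formula.subs[k]? = some χ ∧ ∃ t : Fin I.sys.nS,
      (t : ℕ) = s ∧ χ.Sat (I.withTrans tr htr) I.bound t then 1 else 0
    strategy := R
    value := 0
    rank := 0 }
  refine ⟨B.toSeq nAg nAct I.env, fun i => ?_, fun x₀ z => ?_⟩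
  · rw [BlockValues.toSeq, env_nX_eq, if_pos i.2]
    exact dif_pos i.2
  · have hv : ∀ n, blocks x₀ (B.toSeq nAg nAct I.env) z (1, n) = B.toSeq nAg nAct I.env n :=
      fun _ => rfl
    refine ⟨fun s α s' _ => ?_, fun k χ h => ?_⟩
    · rw [eval_transVar_toSeq hv rfl]
      exact (dif_pos ⟨s.2, (finFunctionFinEquiv α).2, s'.2⟩).trans
        (congrArg (fun β => tr s β s') (finFunctionFinEquiv.symm_apply_apply α))
    · have hk : k < I.formula.subs.length := (List.getElem?_eq_some_iff.1 h).1
      refine ⟨fun t => ?_, fun h3 s hs => ?_⟩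
      · rw [eval_truthVar_toSeq hv rfl hk]
        have : (∃ χ, I.formula.subs[k]? = some χ ∧ ∃ t' : Fin I.sys.nS,
            (t' : ℕ) = t ∧ χ.Sat (I.withTrans tr htr) I.bound t') ↔
            χ.Sat (I.withTrans tr htr) I.bound t := by
          constructor
          · rintro ⟨χ', h', t', ht', hs⟩
            obtain rfl : χ = χ' := Option.some.inj (h.symm.trans h')
            obtain rfl : t' = t := Fin.ext ht'
            exact hs
          · exact fun hs => ⟨χ, h, t, rfl, hs⟩
        exact ⟨fun hs => if_pos (this.2 hs), fun hs => if_neg (mt this.1 hs)⟩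
      · obtain ⟨σ, h1, h2⟩ := hR k s χ h h3 s rfl hs
        exact ⟨σ, strategyReads_toSeq hv hk s h1, h2⟩

/-- Apply the hypothesis to the honest choice of the universal block. The premise holds and no entry
can be refuted, so the table affirms the formula; being correct, it shows that the formula holds. -/
theorem yes_of_forall_exists {x₀ : ℕ → ℝ}
    (H : ∀ y, ∃ z, (I.env.sentence nAg nAct).Holds (blocks x₀ y z)) :
    (paramModelChecking nAg nAct nAP).Yes I := by
  intro x hx
  have htr : ∀ s α, I.sys.toFrame.LegalProfile s α →
      (fun s' => (I.sys.trans s α s').eval x) ∈ stdSimplex ℝ (Fin I.sys.nS) :=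
    (I.sys.instantiate x hx).trans_mem
  change I.formula.Sat (I.withTrans (fun s α s' => (I.sys.trans s α s').eval x) htr) I.bound
    I.state
  obtain ⟨y, hy, hy'⟩ := exists_second_block x htr
  obtain ⟨z, hz⟩ := H y
  obtain ⟨ht, hT⟩ := hy' x₀ z
  rw [sentence_iff] at hz
  have hroot := (hT _ _ I.formula.getElem?_subs_last).1
  have hpre : (I.env.premise nAg nAct).Holds (blocks x₀ y z) := by
    rw [premise_iff]
    refine ⟨(parameters_iff hy).2 ⟨hx, ht⟩, fun k s => ?_⟩
    obtain ⟨χ, h⟩ : ∃ χ, I.formula.subs[(k : ℕ)]? = some χ := ⟨_, List.getElem?_eq_getElem k.2⟩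
    have hk := (hT k χ h).1
    have h01 : (I.env.truthVar nAg nAct k s).eval (blocks x₀ y z) = 0 ∨
        (I.env.truthVar nAg nAct k s).eval (blocks x₀ y z) = 1 := by
      by_cases hs : χ.Sat (I.withTrans _ htr) I.bound s
      · exact .inr ((hk s).1 hs)
      · exact .inl ((hk s).2 hs)
    by_cases h3 : I.env.kind k < 3
    · exact (tableEntryForm_iff h (fun i _ ξ hξ => (hT i ξ hξ).1) h3 s).2
        ⟨h01, hk.isTrue_iff s⟩
    · exact (tableEntryForm_iff_of_le (not_lt.1 h3) s).2 h01
  rcases hz hpre with hz | ⟨⟨k, hk⟩, s, h3, hz⟩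
  · exact (hroot.isTrue_iff I.state).1 hz
  · exfalso
    obtain ⟨χ, h⟩ : ∃ χ, I.formula.subs[k]? = some χ := ⟨_, List.getElem?_eq_getElem hk⟩
    have hlt := fun i (_ : i < k) ξ hξ => (hT i ξ hξ).1
    have htab := ((hT k χ h).1).isTrue_iff s
    -- A refutation of an entry marked true contradicts the winning strategy in the universal block.
    -- A refutation of an entry marked false exhibits a winning strategy, so that the entry should
    -- have been true.
    rcases (refuteForm_iff I k s _).1 hz with ⟨h1, h2⟩ | ⟨h1, h2, h4, h5⟩
    · obtain ⟨σ, hσ, hw⟩ := (hT k χ h).2 h3 s (htab.1 h1)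
      rcases h2 with h2 | ⟨h2, h4⟩
      · exact h2 ((strategyForm_iff _ (env_mem_eq h h3) s).2 ⟨σ, hσ⟩)
      · exact h4 ((cmpForm_iff_wins htr h h3 hlt ht s hσ h2).2 hw)
    · obtain ⟨σ, hσ⟩ := (strategyForm_iff _ (env_mem_eq h h3) s).1 h2
      refine h1 (htab.2 ((PATL.sat_iff_exists_wins (I.withTrans _ htr) I.bound
        (by rwa [← env_kind_eq h]) s).2
        ⟨σ, (cmpForm_iff_wins htr h h3 hlt ht s hσ h4).1 h5⟩))

end Reduction

theorem mainTheorem7 (nAg nAct nAP : ℕ) (hAg : 0 < nAg) (hAct : 0 < nAct) (hAP : 0 < nAP) :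
    (paramModelChecking nAg nAct nAP).InSigma3R := by
  obtain ⟨p, T, h⟩ := PolyTime.sentence (nAg := nAg) (nAct := nAct) (nAP := nAP)
  -- The first block carries no variable of the sentence, so `0` serves as its witness.
  exact ⟨fun I => I.env.sentence nAg nAct, p, T, h, fun I =>
    ⟨fun hI => ⟨0, exists_holds_of_yes hI 0⟩, fun ⟨_, H⟩ => yes_of_forall_exists H⟩⟩
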